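/- Let $\mathbf T=\mathbf R/2\pi\mathbf Z$, $\hat f(k)=\frac1{2\pi}\int_0^{2\pi}f(x)e^{-ikx}\,dx$, $\langle k\rangle=(1+k^2)^{1/2}$, $\|f\|_{H^s}=\bigl(\sum_{k\in\mathbf Z}\langle k\rangle^{2s}|\hat f(k)|^2\bigr)^{1/2}$, let $D$ be the Fourier multiplier with symbol $\langle k\rangle$, and $P_Nf=\sum_{|k|\le N}\hat f(k)e^{ikx}$. Let $\beta\in\mathbf R$ with $2\beta/3\notin\mathbf Z$. For $s\ge 0$ and $u_0\in H^s(\mathbf T)$ let $u\in C(\mathbf R;H^s(\mathbf T))\cap L^4_{\rm loc}(\mathbf R;L^4(\mathbf T))$ be the global solution of $$\partial_tu=-i(i\partial_x^3+\beta\partial_x^2)u-i|u|^2u,\qquad u(0)=u_0,$$ and, for $N\in\mathbf N$, let $u_N$ be the global solution of $$\partial_tu_N=-i(i\partial_x^3+\beta\partial_x^2)u_N-iP_N(|u_N|^2u_N),\qquad u_N(0)=P_Nu_0 ,$$ both equations being understood in the sense of Duhamel's formula. For $w=u$ or $w=u_N$ put $\hat v(t,k)=e^{it(k^3-\beta k^2)}\hat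 w(t,k)$, $\varPhi=3(k_1-k_2)(-k_2+k_3)(k_3+k_1-2\beta/3)$ and, for $T>0$ and $\alpha\in\mathbf R$, $$F(w)=\mathrm{Im}\sum_{\substack{k,k_1,k_2,k_3\in\mathbf Z,\ k=k_1-k_2+k_3\\(k_1-k_2)(-k_2+k_3)\ne0}}\int_0^T e^{-ir\varPhi}\,\hat v(-r,k_1)\overline{\hat v(-r,k_2)}\hat v(-r,k_3)\langle k\rangle^{2\alpha}\overline{\hat v(-r,k)}\,dr .$$ Lemma. Let $\alpha\in(1/2,1]$. There is $\varepsilon_0>0$ (depending on $\alpha,\beta$) such that for every $\varepsilon\in(0,\varepsilon_0)$, with $s=\alpha-\frac12-\varepsilon$, there is a function $C(\cdot,\cdot)$ (depending on $\alpha,\beta,\varepsilon$) such that for all $T>0$ and all $u_0\in H^s(\mathbf T)$ the following holds. (i) The series defining $F(u)$ converges absolutely, and $$|F(u)|\le C\bigl(\|u_0\|_{L^2},T\bigr)\,\|u_0\|_{H^s}^3 .$$ Moreover $$2\pi F(u)=\mathrm{Im}\int_0^T\Bigl(\bigl(|u|^2-\tfrac1\pi\|u\|_{L^2(0,2\pi)}^2\bigr)u(-r),\,D^{2\alpha}u(-r)\Bigr)_{L^2(0,2\pi)}dr,$$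 where the right-hand side is understood as the convergent sum over $k\in\mathbf Z$ of the contributions of the $k$-th Fourier modes, each integrated over $r\in(0,T)$. (ii) For every $N$ the same statements hold for $u_N$, with the same bound $|F(u_N)|\le C(\|u_0\|_{L^2},T)\|u_0\|_{H^s}^3$. (iii) $F(u_N)\to F(u)$ as $N\to\infty$. -/

import Mathlib

open MeasureTheory Filter Topology
open scoped ENNReal ComplexConjugate

noncomputable section

namespace ThirdOrderNLS

instance instFactTwoPiPos : Fact (0 < 2 * Real.pi) := ⟨Real.two_pi_pos⟩

/-- The torus `ℝ / 2πℤ`. -/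
abbrev Torus : Type := AddCircle (2 * Real.pi)

/-- `L²(𝐓)`, with respect to the normalized Haar measure `dx / 2π`. -/
abbrev L2 : Type := Lp ℂ 2 (AddCircle.haarAddCircle : Measure Torus)

/-- The Fourier coefficient `f̂(k) = (1 / 2π) ∫ f(x) e^{-ikx} dx` of `f ∈ L²(𝐓)`. -/
def hat (f : L2) (k : ℤ) : ℂ := fourierCoeff (f : Torus → ℂ) k

/-- The Japanese bracket `⟨k⟩ = (1 + k²)^{1/2}`. -/
def jb (k : ℤ) : ℝ := Real.sqrt (1 + (k : ℝ) ^ 2)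

/-- `f ∈ H^s(𝐓)`, for `f ∈ L²(𝐓)`. -/
def MemHs (s : ℝ) (f : L2) : Prop := Summable fun k : ℤ => jb k ^ (2 * s) * ‖hat f k‖ ^ 2

/-- The norm `‖f‖_{H^s} = (∑ₖ ⟨k⟩^{2s} |f̂(k)|²)^{1/2}` of `f ∈ H^s(𝐓)`. -/
def hsNorm (s : ℝ) (f : L2) : ℝ := Real.sqrt (∑' k : ℤ, jb k ^ (2 * s) * ‖hat f k‖ ^ 2)

/-- `u ∈ C(ℝ; H^s(𝐓))`. -/
def ContinuousHs (s : ℝ) (u : ℝ → L2) : Prop :=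
  (∀ t, MemHs s (u t)) ∧ ∀ t₀, Tendsto (fun t => hsNorm s (u t - u t₀)) (𝓝 t₀) (𝓝 0)

/-- The space-time integrability `u ∈ L⁴((-T, T) × 𝐓)` for every `T > 0`. -/
def LocallyL4 (u : ℝ → L2) : Prop :=
  ∀ T : ℝ, 0 < T →
    ∫⁻ t in Set.Ioo (-T) T, ∫⁻ x : Torus, ‖(u t : Torus → ℂ) x‖ₑ ^ 4 ∂AddCircle.haarAddCircle < ∞

/-- The projection `P_N f = ∑_{|k| ≤ N} f̂(k) e^{ikx}`. -/
def proj (N : ℕ) (f : L2) : L2 :=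
  ∑ k ∈ Finset.Icc (-(N : ℤ)) (N : ℤ), hat f k • fourierLp 2 k

/-- The dispersion relation: `-i (i ∂ₓ³ + β ∂ₓ²)` is the Fourier multiplier `-i (k³ - β k²)`. -/
def disp (β : ℝ) (k : ℤ) : ℝ := (k : ℝ) ^ 3 - β * (k : ℝ) ^ 2

/-- The Fourier coefficients of the cubic nonlinearity `|f|² f`. -/
def cubicHat (f : L2) (k : ℤ) : ℂ :=
  fourierCoeff (fun x : Torus => ((‖(f : Torus → ℂ) x‖ ^ 2 : ℝ) : ℂ) * (f : Torus → ℂ) x) k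

/-- `u` is the global solution in `C(ℝ; H^s(𝐓))` of
`∂ₜ u = -i (i ∂ₓ³ + β ∂ₓ²) u - i |u|² u`, `u(0) = u₀`.
The equation is Duhamel's formula, written for each Fourier coefficient. The local space-time `L⁴`
integrability makes `|u|² u` a locally integrable function of space and time; it holds for every
function in the Fourier restriction spaces `X^{s,1/2}_T`, and it singles out the solution `u(t, u₀)`
of the well-posedness theory. -/
structure IsSolution (β s : ℝ) (u₀ : L2) (u : ℝ → L2) : Prop where
  continuousHs : ContinuousHs s u
  locallyL4 : LocallyL4 u
  initial : u 0 = u₀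
  duhamel : ∀ (t : ℝ) (k : ℤ),
    hat (u t) k = Complex.exp (-(Complex.I * (t * disp β k : ℝ))) * hat u₀ k
      - Complex.I * ∫ r in (0 : ℝ)..t,
          Complex.exp (-(Complex.I * ((t - r) * disp β k : ℝ))) * cubicHat (u r) k

/-- `u` is the global solution of the truncated equation
`∂ₜ u = -i (i ∂ₓ³ + β ∂ₓ²) u - i P_N (|u|² u)`, `u(0) = P_N u₀`.
Duhamel's formula forces the frequencies of `u(t)` into `[-N, N]`, so that this is an ordinary
differential equation for a trigonometric polynomial. -/
structure IsTruncatedSolution (β : ℝ) (N : ℕ) (u₀ : L2) (u : ℝ → L2) : Prop where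
  continuous : Continuous u
  initial : u 0 = proj N u₀
  duhamel : ∀ (t : ℝ) (k : ℤ),
    hat (u t) k = Complex.exp (-(Complex.I * (t * disp β k : ℝ))) * hat (proj N u₀) k
      - Complex.I * ∫ r in (0 : ℝ)..t,
          Complex.exp (-(Complex.I * ((t - r) * disp β k : ℝ)))
            * (if |k| ≤ (N : ℤ) then cubicHat (u r) k else 0)

/-- The phase function `Φ = 3 (k₁ - k₂) (-k₂ + k₃) (k₃ + k₁ - 2β/3)`. -/
def phase (β : ℝ) (k₁ k₂ k₃ : ℤ) : ℝ :=
  3 * ((k₁ : ℝ) - k₂) * (-(k₂ : ℝ) + k₃) * ((k₃ : ℝ) + k₁ - 2 * β / 3)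

/-- The interaction representation `v̂(t, k) = e^{it(k³ - βk²)} û(t, k)`. -/
def vhat (β : ℝ) (u : ℝ → L2) (t : ℝ) (k : ℤ) : ℂ :=
  Complex.exp (Complex.I * (t * disp β k : ℝ)) * hat (u t) k

/-- The frequencies `(k, k₁, k₂, k₃)` with `k = k₁ - k₂ + k₃` and `(k₁ - k₂)(-k₂ + k₃) ≠ 0`. -/
structure Freq where
  k : ℤ
  k₁ : ℤ
  k₂ : ℤ
  k₃ : ℤ
  sum_eq : k = k₁ - k₂ + k₃
  nonres : (k₁ - k₂) * (-k₂ + k₃) ≠ 0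

/-- The contribution of one quadruple of frequencies to the quadrilinear time integral:
`∫₀ᵀ e^{-irΦ} v̂(-r,k₁) conj(v̂(-r,k₂)) v̂(-r,k₃) ⟨k⟩^{2α} conj(v̂(-r,k)) dr`. -/
def quadTerm (α β T : ℝ) (u : ℝ → L2) (q : Freq) : ℂ :=
  ∫ r in (0 : ℝ)..T,
    Complex.exp (-(Complex.I * (r * phase β q.k₁ q.k₂ q.k₃ : ℝ)))
      * vhat β u (-r) q.k₁ * conj (vhat β u (-r) q.k₂) * vhat β u (-r) q.k₃
      * ((jb q.k ^ (2 * α) : ℝ) : ℂ) * conj (vhat β u (-r) q.k)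

/-- The functional `F(u)`: the imaginary part of the non-resonant quadrilinear time integral.
The sum over the frequencies is taken after the integration in time; for `u ∈ C(ℝ; H^s)` the series
under the integral sign need not converge. -/
def quadForm (α β T : ℝ) (u : ℝ → L2) : ℝ := (∑' q : Freq, quadTerm α β T u q).im

/-- The `k`-th term, by Parseval's identity, of the `L²(0, 2π)` inner product
`((|f|² - ‖f‖² / π) f, D^{2α} f)`, where `‖f‖² = ∫₀^{2π} |f|² dx`. -/
def interactionTerm (α : ℝ) (f : L2) (k : ℤ) : ℂ :=
  2 * Real.pi
    * fourierCoeff (fun x : Torus =>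
        ((‖(f : Torus → ℂ) x‖ ^ 2 - 1 / Real.pi * ∫ y : Torus, ‖(f : Torus → ℂ) y‖ ^ 2 : ℝ) : ℂ)
          * (f : Torus → ℂ) x) k
    * conj (((jb k ^ (2 * α) : ℝ) : ℂ) * hat f k)

end ThirdOrderNLS

end

/-! Each quadruple of frequencies oscillates in time with the phase `Φ = 3xy(z - 2β/3)`, where `x =
k₁ - k₂`, `y = k₃ - k₂`, `z = k₁ + k₃`. Since `x, y ≠ 0` and `2β/3` is not an integer, `|Φ| ≥
c⟨x⟩⟨y⟩⟨z⟩` (`exists_phase_lower`). One integration by parts in time gains `|Φ|⁻¹`. The price is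
boundary terms and terms in which one coefficient is replaced by its time derivative in the
interaction representation, that is, by a Fourier coefficient of `|u|²u`. What remains is to bound
quadrilinear sums, with weights symmetric in the four frequencies, so that the differentiated factor
may always be placed at `k`.

For a loss `mx^b` with `b < 1` in the largest factor of the phase, the weight is dominated by
`⟨·⟩^{-t}⟨·⟩^{-t}`, `t > 1`, in two of the three factors. The derivative is then needed only in
`ℓ^∞`, where it is bounded by `‖u‖_{L³}³`, and the other coefficients only in `ℓ²`
(`exists_tsum_quadInt_le`). This gives conservation of the `L²` norm, and, for `2s < 1`, growth of
`‖u‖_{H^s}` by a factor depending on `‖u₀‖_{L²}` and `T` only (`exists_hsSq_le`). It is this linear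
dependence that makes the final bound cubic in `‖u₀‖_{H^s}`. The same mechanism controls `L⁴`:
`‖u‖_{L⁴}⁴` is the nonresonant quadrilinear sum plus at most `2‖u‖⁴`. Interpolating the integration
by parts with the trivial bound gains a power of the length of the time interval
(`exists_lintegral_q4_le`). Because the derivative enters through `‖u‖_{L³}³ ≤ m‖u‖_{L⁴}⁴ + m⁻³`, a
small `m` closes the a priori bound on all of `[0, T]` (`exists_lintegral_q4_bound`).

For `F` the weight is `mx^{2α+δ}|Φ|⁻¹` and three factors are taken in `H^s`
(`mx_rpow_mul_pr_inv_le`). If a second factor of the phase is comparable to the largest, `|Φ|⁻¹`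
gains almost two powers of `mx`. Otherwise all of `k₁, k₂, k₃` are of size `mx`, and the three `H^s`
weights supply `mx^{3s}`, where `3s > 2α - 1`. The derivative is measured in `ℓ^∞` and in
`H^{-3/8}`, the latter by duality with `H^{3/8} ⊂ L⁴` (`exists_cubicHat_weighted_le`).

The identity with the physical-space expression follows by grouping the quadruples according to `k`.
Sum and time integral are exchanged by frequency truncation, with `L⁴` control
(`IsFlow.tsum_fiber`), and the resonant corrections are real.

For the convergence, the spare power `mx^δ` makes the tails uniformly small in `N`, so convergence
of each term suffices (`tendsto_tsum_freq`). Each term converges because `u_N(t) → u(t)` in `L²`: an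
energy estimate for `P_N u - u_N` is closed by the same `L⁴` bound on intervals of a fixed short
length and then iterated (`exists_norm_dif_le`, `tendsto_truncated_flow`). -/

noncomputable section

namespace ThirdOrderNLS

/-! ### Primitives of integrable functions and oscillatory integrals -/

section

/-- `f` is an indefinite integral of `d` on `[a, b]`. -/
structure HasIntDeriv (f d : ℝ → ℂ) (a b : ℝ) : Prop where
  int : IntervalIntegrable d volume a b
  eq : ∀ r ∈ Set.Icc a b, f r = f a + ∫ x in a..r, d x

/-- The real and imaginary parts are primitives of real integrable functions; each is multiplied by
a constant direction, `1` or `I`, and the two are added. -/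
theorem absolutelyContinuousOnInterval_integral {d : ℝ → ℂ} {a b : ℝ}
    (h : IntervalIntegrable d volume a b) :
    AbsolutelyContinuousOnInterval (fun r => ∫ x in a..r, d x) a b := by
  have hre : IntervalIntegrable (fun x => (d x).re) volume a b := ⟨h.1.re, h.2.re⟩
  have him : IntervalIntegrable (fun x => (d x).im) volume a b := ⟨h.1.im, h.2.im⟩
  have h1 := (hre.absolutelyContinuousOnInterval_intervalIntegral (c := a) (by simp)).smul
    (LipschitzOnWith.absolutelyContinuousOnInterval (a := a) (b := b)
      ((LipschitzWith.const (1 : ℂ)).lipschitzOnWith))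
  have h2 := (him.absolutelyContinuousOnInterval_intervalIntegral (c := a) (by simp)).smul
    (LipschitzOnWith.absolutelyContinuousOnInterval (a := a) (b := b)
      ((LipschitzWith.const (Complex.I)).lipschitzOnWith))
  have h3 := h1.add h2
  have key : ∀ r ∈ Set.uIcc a b, (∫ x in a..r, d x) =
      (∫ x in a..r, (d x).re) • (1 : ℂ) + (∫ x in a..r, (d x).im) • Complex.I := by
    intro r hr
    have hs : Set.uIcc a r ⊆ Set.uIcc a b := Set.uIcc_subset_uIcc_left hr
    have e1 : IntervalIntegrable d volume a r := h.mono_set hs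
    have e2 := hre.mono_set hs
    have e3 := him.mono_set hs
    simp only [Complex.real_smul, mul_one]
    have e2' : IntervalIntegrable (fun x => ((d x).re : ℂ)) volume a r := ⟨e2.1.ofReal, e2.2.ofReal⟩
    have e3' : IntervalIntegrable (fun x => ((d x).im : ℂ)) volume a r := ⟨e3.1.ofReal, e3.2.ofReal⟩
    rw [← intervalIntegral.integral_ofReal, ← intervalIntegral.integral_ofReal,
      ← intervalIntegral.integral_mul_const, ← intervalIntegral.integral_add e2'
        (e3'.mul_const _)]
    exact intervalIntegral.integral_congr fun x _ => (Complex.re_add_im (d x)).symm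
  rw [absolutelyContinuousOnInterval_iff] at h3 ⊢
  intro ε hε
  obtain ⟨δ, hδ, H⟩ := h3 ε hε
  refine ⟨δ, hδ, fun E hE hl => ?_⟩
  refine lt_of_eq_of_lt (Finset.sum_congr rfl fun i hi => ?_) (H E hE hl)
  rw [key _ (hE.1 i hi).1, key _ (hE.1 i hi).2]
  rfl

namespace HasIntDeriv

variable {f d g e : ℝ → ℂ} {a b : ℝ}

theorem mono (h : HasIntDeriv f d a b) {a' b' : ℝ} (ha : a ≤ a') (hab : a' ≤ b') (hb : b' ≤ b) :
    HasIntDeriv f d a' b' := by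
  have hs : ∀ x ∈ Set.Icc a b, ∀ y ∈ Set.Icc a b, IntervalIntegrable d volume x y := by
    intro x hx y hy
    refine h.int.mono_set ?_
    rw [Set.uIcc_of_le (hx.1.trans hx.2)]
    exact Set.uIcc_subset_Icc hx hy
  have ha' : a' ∈ Set.Icc a b := ⟨ha, hab.trans hb⟩
  have h0 : a ∈ Set.Icc a b := ⟨le_rfl, ha.trans (hab.trans hb)⟩
  refine ⟨hs _ ha' _ ⟨ha.trans hab, hb⟩, fun r hr => ?_⟩
  have hr' : r ∈ Set.Icc a b := ⟨ha.trans hr.1, hr.2.trans hb⟩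
  rw [h.eq r hr', h.eq a' ha', add_assoc,
    intervalIntegral.integral_add_adjacent_intervals (hs _ h0 _ ha') (hs _ ha' _ hr')]

theorem continuousOn (h : HasIntDeriv f d a b) (hab : a ≤ b) : ContinuousOn f (Set.Icc a b) := by
  have := (absolutelyContinuousOnInterval_integral h.int).continuousOn
  rw [Set.uIcc_of_le hab] at this
  exact (continuousOn_const.add this).congr h.eq

theorem conjugate (h : HasIntDeriv f d a b) (hab : a ≤ b) :
    HasIntDeriv (fun r => conj (f r)) (fun r => conj (d r)) a b := by
  refine ⟨?_, fun r hr => ?_⟩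
  · rw [intervalIntegrable_iff_integrableOn_Ioc_of_le hab]
    exact (Complex.conjLIE.toContinuousLinearEquiv.integrable_comp_iff).2
      ((intervalIntegrable_iff_integrableOn_Ioc_of_le hab).1 h.int)
  · rw [h.eq r hr, map_add, intervalIntegral.integral_of_le hr.1,
      intervalIntegral.integral_of_le hr.1, integral_conj]

/-- The difference between the product and the primitive of the candidate derivative is absolutely
continuous and, by Lebesgue differentiation, has derivative zero almost everywhere; hence it is
constant. No continuity of `d` and `e` is needed, which matters because the nonlinearity is only
integrable in time. -/
theorem mul (hf : HasIntDeriv f d a b) (hg : HasIntDeriv g e a b) (hab : a ≤ b) :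
    HasIntDeriv (fun r => f r * g r) (fun r => d r * g r + f r * e r) a b := by
  have cf := hf.continuousOn hab
  have cg := hg.continuousOn hab
  have u := Set.uIcc_of_le hab
  have hint : IntervalIntegrable (fun r => d r * g r + f r * e r) volume a b :=
    (hf.int.mul_continuousOn (by rwa [u])).add (hg.int.continuousOn_mul (by rwa [u]))
  refine ⟨hint, ?_⟩
  -- `f` and `g` are known only on `[a, b]`; the primitives `F` and `G` are defined on the whole
  -- line and can be differentiated at the endpoints.
  set F : ℝ → ℂ := fun r => f a + ∫ x in a..r, d x
  set G : ℝ → ℂ := fun r => g a + ∫ x in a..r, e x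
  have hc : ∀ c : ℂ, AbsolutelyContinuousOnInterval (fun _ : ℝ => c) a b := fun c =>
    LipschitzOnWith.absolutelyContinuousOnInterval ((LipschitzWith.const c).lipschitzOnWith)
  have aF : AbsolutelyContinuousOnInterval F a b :=
    (hc (f a)).add (absolutelyContinuousOnInterval_integral hf.int)
  have aG : AbsolutelyContinuousOnInterval G a b :=
    (hc (g a)).add (absolutelyContinuousOnInterval_integral hg.int)
  have aH := (aF.smul aG).sub (absolutelyContinuousOnInterval_integral hint)
  obtain ⟨C, hC⟩ := aH.const_of_ae_hasDerivAt_zero (by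
    filter_upwards [hf.int.ae_hasDerivAt_integral, hg.int.ae_hasDerivAt_integral,
      hint.ae_hasDerivAt_integral] with x h1 h2 h3 hx
    have d1 : HasDerivAt F (d x) x := (h1 hx a (by simp)).const_add _
    have d2 : HasDerivAt G (e x) x := (h2 hx a (by simp)).const_add _
    have d3 := h3 hx a (by simp)
    have hx' : x ∈ Set.Icc a b := by rwa [u] at hx
    have := (d1.mul d2).sub d3
    have e0 : d x * G x + F x * e x - (d x * g x + f x * e x) = 0 := by
      rw [hf.eq x hx', hg.eq x hx']; simp only [F, G]; ring
    rw [e0] at this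
    exact this)
  intro r hr
  have h1 := hC r (by rwa [u])
  have h2 := hC a (by simp)
  have h1' : F r * G r - ∫ x in a..r, d x * g x + f x * e x = C := h1
  have h2' : F a * G a - ∫ x in a..a, d x * g x + f x * e x = C := h2
  have a0 : a ∈ Set.Icc a b := ⟨le_rfl, hab⟩
  simp only [F, G] at h1' h2'
  rw [← hf.eq r hr, ← hg.eq r hr] at h1'
  rw [← hf.eq a a0, ← hg.eq a a0, intervalIntegral.integral_same, sub_zero] at h2'
  rw [h2', ← h1']; ring

theorem of_hasDerivAt (h : ∀ x, HasDerivAt f (d x) x) (hd : Continuous d) :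
    HasIntDeriv f d a b := by
  refine ⟨hd.intervalIntegrable _ _, fun r hr => ?_⟩
  rw [intervalIntegral.integral_eq_sub_of_hasDerivAt (fun x _ => h x) (hd.intervalIntegrable _ _)]
  ring

theorem integral_eq (h : HasIntDeriv f d a b) (hab : a ≤ b) : ∫ x in a..b, d x = f b - f a := by
  rw [h.eq b ⟨hab, le_rfl⟩]; ring

theorem sub (hf : HasIntDeriv f d a b) (hg : HasIntDeriv g e a b) :
    HasIntDeriv (fun r => f r - g r) (fun r => d r - e r) a b := by
  refine ⟨hf.int.sub hg.int, fun r hr => ?_⟩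
  rw [hf.eq r hr, hg.eq r hr, intervalIntegral.integral_sub]
  · ring
  · exact (hf.mono le_rfl hr.1 hr.2).int
  · exact (hg.mono le_rfl hr.1 hr.2).int

end HasIntDeriv

theorem norm_cexp_neg_I_mul (x : ℝ) : ‖Complex.exp (-(Complex.I * (x : ℂ)))‖ = 1 := by
  rw [← mul_neg, ← Complex.ofReal_neg, mul_comm, Complex.norm_exp_ofReal_mul_I]

/-- Non-stationary phase: one integration by parts. -/
theorem norm_integral_osc_le {P d : ℝ → ℂ} {a b : ℝ} (hab : a ≤ b) (h : HasIntDeriv P d a b)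
    {Φ : ℝ} (hΦ : Φ ≠ 0) :
    ‖∫ r in a..b, Complex.exp (-(Complex.I * (r * Φ : ℝ))) * P r‖ₑ
      ≤ ENNReal.ofReal |Φ|⁻¹ * (‖P a‖ₑ + ‖P b‖ₑ + ∫⁻ r in Set.Ioc a b, ‖d r‖ₑ) := by
  have hΦ' : (-(Complex.I * Φ)) ≠ 0 := by simp [hΦ]
  set E : ℝ → ℂ := fun r => Complex.exp (-(Complex.I * (r * Φ : ℝ))) with hE
  have hE1 : ∀ r, HasDerivAt (fun r => (-(Complex.I * Φ))⁻¹ * E r) (E r) r := by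
    intro r
    have h1 : HasDerivAt (fun r : ℝ => -(Complex.I * ((r * Φ : ℝ) : ℂ)))
        (-(Complex.I * Φ)) r := by
      have h0 : HasDerivAt (fun r : ℝ => (r * Φ)) Φ r := by
        simpa using (hasDerivAt_id r).mul_const Φ
      exact (h0.ofReal_comp.const_mul Complex.I).neg
    have h2 := (h1.cexp).const_mul (-(Complex.I * (Φ:ℂ)))⁻¹
    exact h2.congr_deriv (by rw [mul_comm (Complex.exp _), ← mul_assoc, inv_mul_cancel₀ hΦ', one_mul])
  have hEc : Continuous E := by simp only [hE]; fun_prop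
  have hE2 : HasIntDeriv (fun r => (-(Complex.I * Φ))⁻¹ * E r) E a b :=
    HasIntDeriv.of_hasDerivAt hE1 hEc
  have hn : ∀ r, ‖E r‖ = 1 := fun r => norm_cexp_neg_I_mul _
  have hprod := (hE2.mul h hab)
  have key := hprod.integral_eq hab
  have i2 : IntervalIntegrable (fun r => (-(Complex.I * (Φ:ℂ)))⁻¹ * E r * d r) volume a b :=
    h.int.continuousOn_mul (by fun_prop)
  have i1 : IntervalIntegrable (fun r => E r * P r) volume a b := by
    apply ContinuousOn.intervalIntegrable
    rw [Set.uIcc_of_le hab]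
    exact hEc.continuousOn.mul (h.continuousOn hab)
  rw [intervalIntegral.integral_add i1 i2] at key
  have e3 : ‖(-(Complex.I * (Φ:ℂ)))⁻¹‖ₑ = ENNReal.ofReal |Φ|⁻¹ := by
    rw [← ofReal_norm]; simp
  have hne : ∀ r, ‖E r‖ₑ = 1 := fun r => by rw [← ofReal_norm, hn]; simp
  have : (∫ r in a..b, E r * P r) = (-(Complex.I * (Φ:ℂ)))⁻¹ * (E b * P b)
      - ((-(Complex.I * (Φ:ℂ)))⁻¹ * (E a * P a)) - ∫ r in a..b, (-(Complex.I * (Φ:ℂ)))⁻¹ * E r * d r := by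
    rw [← mul_assoc, ← mul_assoc, ← key]; ring
  rw [this]
  calc _ ≤ ‖(-(Complex.I * (Φ:ℂ)))⁻¹ * (E b * P b)‖ₑ + ‖(-(Complex.I * (Φ:ℂ)))⁻¹ * (E a * P a)‖ₑ
        + ‖∫ r in a..b, (-(Complex.I * (Φ:ℂ)))⁻¹ * E r * d r‖ₑ :=
        (enorm_sub_le).trans (add_le_add enorm_sub_le le_rfl)
    _ ≤ ENNReal.ofReal |Φ|⁻¹ * ‖P b‖ₑ + ENNReal.ofReal |Φ|⁻¹ * ‖P a‖ₑ
        + ∫⁻ r in Set.Ioc a b, ENNReal.ofReal |Φ|⁻¹ * ‖d r‖ₑ := by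
        gcongr
        · rw [enorm_mul, enorm_mul, e3, hne, one_mul]
        · rw [enorm_mul, enorm_mul, e3, hne, one_mul]
        · rw [intervalIntegral.integral_of_le hab]
          refine (enorm_integral_le_lintegral_enorm _).trans (le_of_eq ?_)
          refine lintegral_congr fun r => ?_
          rw [enorm_mul, enorm_mul, e3, hne, mul_one]
    _ = _ := by
        rw [lintegral_const_mul' _ _ ENNReal.ofReal_ne_top]; ring

/-- Interpolation between the trivial bound and one integration by parts. -/
theorem norm_integral_osc_le_interp {P d : ℝ → ℂ} {a b : ℝ} (hab : a < b)
    (h : HasIntDeriv P d a b) {Φ : ℝ} (hΦ : Φ ≠ 0) :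
    ‖∫ r in a..b, Complex.exp (-(Complex.I * (r * Φ : ℝ))) * P r‖ₑ
      ≤ ENNReal.ofReal ((b - a) ^ (1 / 4 : ℝ)) * (ENNReal.ofReal (|Φ| ^ (-(3 / 4) : ℝ))
        * (ENNReal.ofReal (b - a)⁻¹ * (∫⁻ r in Set.Ioc a b, ‖P r‖ₑ)
          + (‖P a‖ₑ + ‖P b‖ₑ + ∫⁻ r in Set.Ioc a b, ‖d r‖ₑ))) := by
  have hl : 0 < b - a := sub_pos.2 hab
  have hp : 0 < |Φ| := abs_pos.2 hΦ
  have b1 := norm_integral_osc_le hab.le h hΦ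
  have b2 : ‖∫ r in a..b, Complex.exp (-(Complex.I * (r * Φ : ℝ))) * P r‖ₑ
      ≤ ∫⁻ r in Set.Ioc a b, ‖P r‖ₑ := by
    rw [intervalIntegral.integral_of_le hab.le]
    refine (enorm_integral_le_lintegral_enorm _).trans (le_of_eq (lintegral_congr fun r => ?_))
    rw [enorm_mul, ← ofReal_norm, norm_cexp_neg_I_mul, ENNReal.ofReal_one, one_mul]
  have hq : (|Φ|⁻¹) ^ (3 / 4 : ℝ) = |Φ| ^ (-(3 / 4) : ℝ) := by
    rw [Real.inv_rpow hp.le, Real.rpow_neg hp.le]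
  rw [← hq, ← mul_assoc, ← ENNReal.ofReal_mul (by positivity)]
  -- With `l = b - a`, both cases rest on `min(l, |Φ|⁻¹) ≤ l^{1/4}|Φ|^{-3/4}`: the trivial bound is
  -- used when `l` is smaller, integration by parts otherwise.
  rcases le_total (b - a) |Φ|⁻¹ with hc | hc
  · have : b - a ≤ (b - a) ^ (1 / 4 : ℝ) * (|Φ|⁻¹) ^ (3 / 4 : ℝ) := by
      calc b - a = (b - a) ^ (1 / 4 : ℝ) * (b - a) ^ (3 / 4 : ℝ) := by
            rw [← Real.rpow_add hl]; norm_num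
        _ ≤ _ := by gcongr
    refine b2.trans ?_
    calc _ = ENNReal.ofReal (b - a) * (ENNReal.ofReal (b - a)⁻¹ * ∫⁻ r in Set.Ioc a b, ‖P r‖ₑ) := by
          rw [← mul_assoc, ← ENNReal.ofReal_mul hl.le, mul_inv_cancel₀ hl.ne']; simp
      _ ≤ _ := by
          gcongr
          exact le_self_add
  · have : |Φ|⁻¹ ≤ (b - a) ^ (1 / 4 : ℝ) * (|Φ|⁻¹) ^ (3 / 4 : ℝ) := by
      calc |Φ|⁻¹ = (|Φ|⁻¹) ^ (1 / 4 : ℝ) * (|Φ|⁻¹) ^ (3 / 4 : ℝ) := by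
            rw [← Real.rpow_add (by positivity)]; norm_num
        _ ≤ _ := by gcongr
    exact b1.trans (mul_le_mul' (ENNReal.ofReal_le_ofReal this) le_add_self)

theorem HasIntDeriv.quad {f₀ f₁ f₂ f₃ d₀ d₁ d₂ d₃ : ℝ → ℂ} {a b : ℝ} (hab : a ≤ b)
    (h₀ : HasIntDeriv f₀ d₀ a b) (h₁ : HasIntDeriv f₁ d₁ a b) (h₂ : HasIntDeriv f₂ d₂ a b)
    (h₃ : HasIntDeriv f₃ d₃ a b) :
    HasIntDeriv (fun r => f₁ r * conj (f₂ r) * f₃ r * conj (f₀ r))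
      (fun r => ((d₁ r * conj (f₂ r) + f₁ r * conj (d₂ r)) * f₃ r + f₁ r * conj (f₂ r) * d₃ r)
        * conj (f₀ r) + f₁ r * conj (f₂ r) * f₃ r * conj (d₀ r)) a b :=
  ((h₁.mul (h₂.conjugate hab) hab).mul h₃ hab).mul (h₀.conjugate hab) hab

end

/-! ### Brackets, symmetries of the quadruples, lower bound for the phase -/

section

/-- The bracket `1 + |n|`, equivalent to `⟨n⟩` and submultiplicative under addition. -/
def br (n : ℤ) : ℝ := 1 + |(n : ℝ)|

theorem one_le_br (n : ℤ) : 1 ≤ br n := le_add_of_nonneg_right (abs_nonneg _)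

theorem br_pos (n : ℤ) : 0 < br n := one_pos.trans_le (one_le_br n)

theorem one_le_jb (n : ℤ) : 1 ≤ jb n :=
  Real.one_le_sqrt.2 (le_add_of_nonneg_right (sq_nonneg _))

theorem jb_pos (n : ℤ) : 0 < jb n := one_pos.trans_le (one_le_jb n)

theorem jb_le_br (n : ℤ) : jb n ≤ br n := by
  refine Real.sqrt_le_iff.2 ⟨(br_pos n).le, ?_⟩
  have := abs_nonneg (n : ℝ)
  unfold br
  nlinarith [sq_abs (n : ℝ)]

theorem br_le_two_mul_jb (n : ℤ) : br n ≤ 2 * jb n := by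
  have h1 := one_le_jb n
  have h2 : |(n : ℝ)| ≤ jb n := Real.abs_le_sqrt (by linarith)
  unfold br; linarith

theorem br_neg (n : ℤ) : br (-n) = br n := by simp [br]

theorem br_le_mul {l m n : ℤ} (h : |l| ≤ |m| + |n|) : br l ≤ br m * br n := by
  have h' : |(l : ℝ)| ≤ |(m : ℝ)| + |(n : ℝ)| := by exact_mod_cast h
  unfold br
  nlinarith [abs_nonneg (m : ℝ), abs_nonneg (n : ℝ), mul_nonneg (abs_nonneg (m : ℝ)) (abs_nonneg (n : ℝ))]

namespace Freq

@[ext] theorem ext' {q q' : Freq} (h : q.k = q'.k) (h₁ : q.k₁ = q'.k₁) (h₂ : q.k₂ = q'.k₂)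
    (h₃ : q.k₃ = q'.k₃) : q = q' := by
  cases q; cases q'; simp_all

/-- The difference `k₁ - k₂ = k - k₃`. -/
def x (q : Freq) : ℤ := q.k₁ - q.k₂
/-- The difference `k₃ - k₂ = k - k₁`. -/
def y (q : Freq) : ℤ := q.k₃ - q.k₂
/-- The sum `k₁ + k₃ = k + k₂`. -/
def z (q : Freq) : ℤ := q.k₁ + q.k₃

/-- The largest of the three brackets in the phase. -/
def mx (q : Freq) : ℝ := max (br q.x) (max (br q.y) (br q.z))

/-- The product of the three brackets in the phase. -/
def pr (q : Freq) : ℝ := br q.x * br q.y * br q.z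

/-- The kernel `∑ ⟨a⟩^{-t} ⟨b⟩^{-t}` over the pairs `a, b` among the three factors of the phase. -/
def kern (t : ℝ) (q : Freq) : ℝ :=
  (br q.x * br q.y) ^ (-t) + (br q.x * br q.z) ^ (-t) + (br q.y * br q.z) ^ (-t)

theorem pr_pos (q : Freq) : 0 < q.pr := mul_pos (mul_pos (br_pos _) (br_pos _)) (br_pos _)

theorem one_le_mx (q : Freq) : 1 ≤ q.mx := le_max_of_le_left (one_le_br _)

theorem mx_pos (q : Freq) : 0 < q.mx := one_pos.trans_le q.one_le_mx

/-- The exchange `k ↔ k₁`, `k₂ ↔ k₃`. -/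
def swap₁ : Freq ≃ Freq where
  toFun q := ⟨q.k₁, q.k, q.k₃, q.k₂, by have := q.sum_eq; omega, by
    have h := q.nonres; have := q.sum_eq
    rw [show (q.k - q.k₃) * (-q.k₃ + q.k₂) = -((q.k₁ - q.k₂) * (-q.k₂ + q.k₃)) by rw [this]; ring]
    exact neg_ne_zero.2 h⟩
  invFun q := ⟨q.k₁, q.k, q.k₃, q.k₂, by have := q.sum_eq; omega, by
    have h := q.nonres; have := q.sum_eq
    rw [show (q.k - q.k₃) * (-q.k₃ + q.k₂) = -((q.k₁ - q.k₂) * (-q.k₂ + q.k₃)) by rw [this]; ring]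
    exact neg_ne_zero.2 h⟩
  left_inv _ := rfl
  right_inv _ := rfl

/-- The exchange `k₁ ↔ k₃`. -/
def swap₁₃ : Freq ≃ Freq where
  toFun q := ⟨q.k, q.k₃, q.k₂, q.k₁, by have := q.sum_eq; omega, by
    have h := q.nonres
    rw [show (q.k₃ - q.k₂) * (-q.k₂ + q.k₁) = (q.k₁ - q.k₂) * (-q.k₂ + q.k₃) by ring]
    exact h⟩
  invFun q := ⟨q.k, q.k₃, q.k₂, q.k₁, by have := q.sum_eq; omega, by
    have h := q.nonres
    rw [show (q.k₃ - q.k₂) * (-q.k₂ + q.k₁) = (q.k₁ - q.k₂) * (-q.k₂ + q.k₃) by ring]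
    exact h⟩
  left_inv _ := rfl
  right_inv _ := rfl

/-- The exchange `k ↔ k₃`, `k₁ ↔ k₂`. -/
def swap₃ : Freq ≃ Freq := (swap₁₃.trans swap₁).trans swap₁₃

/-- The exchange `k ↔ k₂`. -/
def swap₂ : Freq ≃ Freq := swap₁.trans swap₃

theorem swap₁_x (q : Freq) : (swap₁ q).x = q.x := by
  have := q.sum_eq; simp only [x, swap₁, Equiv.coe_fn_mk]; omega
theorem swap₁_y (q : Freq) : (swap₁ q).y = -q.y := by
  have := q.sum_eq; simp only [y, swap₁, Equiv.coe_fn_mk]; omega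
theorem swap₁_z (q : Freq) : (swap₁ q).z = q.z := by
  have := q.sum_eq; simp only [z, swap₁, Equiv.coe_fn_mk]; omega

theorem phase_eq (β : ℝ) (q : Freq) :
    phase β q.k₁ q.k₂ q.k₃ = 3 * (q.x : ℝ) * q.y * (q.z - 2 * β / 3) := by
  simp only [phase, x, y, z]; push_cast; ring

theorem abs_phase_swap₁ (β : ℝ) (q : Freq) :
    |phase β (swap₁ q).k₁ (swap₁ q).k₂ (swap₁ q).k₃| = |phase β q.k₁ q.k₂ q.k₃| := by
  rw [phase_eq, phase_eq, swap₁_x, swap₁_y, swap₁_z]; push_cast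
  rw [← abs_neg]; congr 1; ring

theorem abs_phase_swap₁₃ (β : ℝ) (q : Freq) :
    |phase β (swap₁₃ q).k₁ (swap₁₃ q).k₂ (swap₁₃ q).k₃| = |phase β q.k₁ q.k₂ q.k₃| := by
  congr 1; simp only [phase, swap₁₃, Equiv.coe_fn_mk]; ring

theorem mx_swap₁ (q : Freq) : (swap₁ q).mx = q.mx := by
  rw [mx, swap₁_x, swap₁_y, swap₁_z, br_neg]; rfl

theorem mx_swap₁₃ (q : Freq) : (swap₁₃ q).mx = q.mx := by
  have e1 : (swap₁₃ q).x = q.y := rfl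
  have e2 : (swap₁₃ q).y = q.x := rfl
  have e3 : (swap₁₃ q).z = q.z := by simp only [z, swap₁₃, Equiv.coe_fn_mk]; omega
  rw [mx, mx, e1, e2, e3, max_left_comm]

/-- A weight that is invariant under the permutations of the frequencies. -/
structure Invariant (W : Freq → ℝ≥0∞) : Prop where
  one : ∀ q, W (swap₁ q) = W q
  one_three : ∀ q, W (swap₁₃ q) = W q

variable {W : Freq → ℝ≥0∞}

/-- The quadrilinear sum with one distinguished factor. -/
def quadSum (W : Freq → ℝ≥0∞) (A B : ℤ → ℝ≥0∞) : ℝ≥0∞ :=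
  ∑' q : Freq, W q * (A q.k * B q.k₁ * B q.k₂ * B q.k₃)

/-- Exchanging `k` with `k₁`, `k₂` or `k₃` permutes the quadruples and preserves `W`. After
integration by parts it therefore does not matter which coefficient was differentiated. -/
theorem Invariant.tsum_four (hW : Invariant W) (A B : ℤ → ℝ≥0∞) :
    ∑' q : Freq, W q * (A q.k * B q.k₁ * B q.k₂ * B q.k₃ + A q.k₁ * B q.k * B q.k₂ * B q.k₃
      + A q.k₂ * B q.k * B q.k₁ * B q.k₃ + A q.k₃ * B q.k * B q.k₁ * B q.k₂)
      = 4 * quadSum W A B := by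
  have h3 : ∀ q, W (swap₃ q) = W q := fun q => by
    simp only [swap₃, Equiv.trans_apply, hW.one, hW.one_three]
  have h2 : ∀ q, W (swap₂ q) = W q := fun q => by
    simp only [swap₂, Equiv.trans_apply, h3, hW.one]
  simp only [mul_add]
  rw [ENNReal.tsum_add, ENNReal.tsum_add, ENNReal.tsum_add]
  have e1 : ∑' q : Freq, W q * (A q.k₁ * B q.k * B q.k₂ * B q.k₃) = quadSum W A B := by
    rw [quadSum, ← swap₁.tsum_eq]
    refine tsum_congr fun q => ?_
    rw [hW.one]
    change W q * (A q.k * B q.k₁ * B q.k₃ * B q.k₂) = _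
    ring
  have e2 : ∑' q : Freq, W q * (A q.k₂ * B q.k * B q.k₁ * B q.k₃) = quadSum W A B := by
    rw [quadSum, ← swap₂.tsum_eq]
    refine tsum_congr fun q => ?_
    rw [h2]
    change W q * (A q.k * B q.k₂ * B q.k₃ * B q.k₁) = _
    ring
  have e3 : ∑' q : Freq, W q * (A q.k₃ * B q.k * B q.k₁ * B q.k₂) = quadSum W A B := by
    rw [quadSum, ← swap₃.tsum_eq]
    refine tsum_congr fun q => ?_
    rw [h3]
    change W q * (A q.k * B q.k₃ * B q.k₂ * B q.k₁) = _
    ring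
  rw [e1, e2, e3, ← quadSum]; ring

end Freq

/-- With `θ = 2β/3`, the quantity `|z - θ|` is at least `⟨z⟩/2` for `|z| ≥ 2|θ| + 1`. For the
remaining `z` it is at least the distance `d > 0` from `θ` to the integers, while `⟨z⟩ ≤ 2|θ| + 2`.
The nonzero integers `x, y` satisfy `⟨x⟩ ≤ 2|x|` and `⟨y⟩ ≤ 2|y|`. -/
theorem exists_phase_lower (β : ℝ) (hβ : ∀ m : ℤ, 2 * β / 3 ≠ (m : ℝ)) :
    ∃ c : ℝ, 0 < c ∧ ∀ q : Freq, c * q.pr ≤ |phase β q.k₁ q.k₂ q.k₃| := by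
  set θ := 2 * β / 3 with hθ
  set d := |θ - round θ|
  have hd : 0 < d := abs_pos.2 (sub_ne_zero.2 (hβ _))
  set c := min (1 / 2) (d / (2 * |θ| + 2)) with hc
  have hc0 : 0 < c := lt_min (by norm_num) (by positivity)
  have hz : ∀ n : ℤ, c * br n ≤ |(n : ℝ) - θ| := by
    intro n
    rcases le_total (2 * |θ| + 1) |(n : ℝ)| with h | h
    · have h1 : c ≤ 1 / 2 := min_le_left _ _
      have h2 : |(n : ℝ)| - |θ| ≤ |(n : ℝ) - θ| := abs_sub_abs_le_abs_sub _ _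
      have h3 := br_pos n
      have : c * br n ≤ 1 / 2 * br n := by gcongr
      unfold br at this ⊢; linarith
    · have h1 : c ≤ d / (2 * |θ| + 2) := min_le_right _ _
      have h2 : d ≤ |(n : ℝ) - θ| := by rw [abs_sub_comm]; exact round_le θ n
      refine le_trans ?_ h2
      calc c * br n ≤ d / (2 * |θ| + 2) * (2 * |θ| + 2) := by
            refine mul_le_mul h1 ?_ (br_pos n).le (by positivity)
            unfold br; linarith
        _ = d := by field_simp
  have hi : ∀ n : ℤ, n ≠ 0 → br n ≤ 2 * |(n : ℝ)| := by
    intro n hn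
    have : (1 : ℝ) ≤ |(n : ℝ)| := by exact_mod_cast Int.one_le_abs hn
    unfold br; linarith
  refine ⟨c / 2, by positivity, fun q => ?_⟩
  have hx : q.x ≠ 0 := fun h => q.nonres (by simp only [Freq.x] at h; simp [h])
  have hy : q.y ≠ 0 := fun h => q.nonres (by
    rw [show -q.k₂ + q.k₃ = q.y by simp only [Freq.y]; ring, h, mul_zero])
  rw [Freq.phase_eq, abs_mul, abs_mul, abs_mul, ← hθ]
  have e : |(3 : ℝ)| = 3 := by norm_num
  rw [e]
  calc c / 2 * q.pr = 1 / 2 * (br q.x * br q.y * (c * br q.z)) := by unfold Freq.pr; ring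
    _ ≤ 1 / 2 * ((2 * |(q.x : ℝ)|) * (2 * |(q.y : ℝ)|) * |(q.z : ℝ) - θ|) := by
        have := hz q.z
        have := hi q.x hx
        have := hi q.y hy
        have := br_pos q.x
        have := br_pos q.y
        have := br_pos q.z
        gcongr
    _ ≤ _ := by
        have : 0 ≤ |(q.x : ℝ)| * |(q.y : ℝ)| * |(q.z : ℝ) - θ| := by positivity
        nlinarith

namespace Freq

/-- Since `qr ≤ p²`, the decay `p^{-a}` in the largest number is worth `(qr)^{-a/2}` in the other
two. -/
theorem sorted_le {p q r a : ℝ} (b : ℝ) (hq : 1 ≤ q) (hr : 1 ≤ r) (hpq : q ≤ p) (hpr : r ≤ p)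
    (ha : 0 ≤ a) : p ^ (-a) * (q * r) ^ (-b) ≤ (q * r) ^ (-(b + a / 2)) := by
  have h0 : 0 < q * r := by positivity
  have hp : 0 < p := by linarith
  have h1 : q * r ≤ p ^ 2 := by nlinarith
  have h2 : p ^ (-a) ≤ (q * r) ^ (-(a / 2)) := by
    calc p ^ (-a) = (p ^ 2) ^ (-(a / 2)) := by
          rw [← Real.rpow_natCast, ← Real.rpow_mul hp.le]; congr 1; push_cast; ring
      _ ≤ _ := Real.rpow_le_rpow_of_nonpos h0 h1 (by linarith)
  calc _ ≤ (q * r) ^ (-(a / 2)) * (q * r) ^ (-b) := by gcongr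
    _ = _ := by rw [← Real.rpow_add h0]; congr 1; ring

/-- The decay in the largest factor of the phase is passed on to the two others. Which factor is
largest varies with `q`, hence the sum over the three pairs in `kern`. -/
theorem mx_rpow_mul_le_kern {a : ℝ} (b : ℝ) (ha : 0 ≤ a) (q : Freq) :
    q.mx ^ (-a) * (q.pr / q.mx) ^ (-b) ≤ kern (b + a / 2) q := by
  have h1 := one_le_br q.x
  have h2 := one_le_br q.y
  have h3 := one_le_br q.z
  have p1 : 0 ≤ (br q.x * br q.y) ^ (-(b + a / 2)) := by positivity
  have p2 : 0 ≤ (br q.x * br q.z) ^ (-(b + a / 2)) := by positivity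
  have p3 : 0 ≤ (br q.y * br q.z) ^ (-(b + a / 2)) := by positivity
  have hx : br q.x ≤ q.mx := le_max_left _ _
  have hy : br q.y ≤ q.mx := (le_max_left _ _).trans (le_max_right _ _)
  have hz : br q.z ≤ q.mx := (le_max_right _ _).trans (le_max_right _ _)
  have : q.mx = br q.x ∨ q.mx = br q.y ∨ q.mx = br q.z := by
    rcases max_choice (br q.x) (max (br q.y) (br q.z)) with h | h
    · exact .inl h
    · rcases max_choice (br q.y) (br q.z) with h' | h'
      · exact .inr (.inl (h.trans h'))
      · exact .inr (.inr (h.trans h'))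
  unfold kern
  rcases this with h | h | h
  · rw [show q.pr / q.mx = br q.y * br q.z by rw [h, pr]; field_simp]
    linarith [sorted_le b h2 h3 hy hz ha]
  · rw [show q.pr / q.mx = br q.x * br q.z by rw [h, pr]; field_simp]
    linarith [sorted_le b h1 h3 hx hz ha]
  · rw [show q.pr / q.mx = br q.x * br q.y by rw [h, pr]; field_simp]
    linarith [sorted_le b h1 h2 hx hy ha]

end Freq

end

/-! ### Summation over the quadruples -/

section

/-- The Cauchy–Schwarz inequality for sums in `[0, ∞]`. -/
theorem ennreal_tsum_mul_sq_le {ι : Type*} (f g : ι → ℝ≥0∞) :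
    (∑' i, f i * g i) ^ 2 ≤ (∑' i, f i ^ 2) * ∑' i, g i ^ 2 := by
  have hfin : ∀ s : Finset ι, (∑ i ∈ s, f i * g i) ^ 2 ≤ (∑' i, f i ^ 2) * ∑' i, g i ^ 2 := by
    intro s
    have h := ENNReal.inner_le_Lp_mul_Lq s f g (p := 2) (q := 2) Real.HolderConjugate.two_two
    have h2 : (∑ i ∈ s, f i * g i) ^ 2 ≤ (∑ i ∈ s, f i ^ 2) * ∑ i ∈ s, g i ^ 2 := by
      refine (pow_le_pow_left' h 2).trans (le_of_eq ?_)
      rw [mul_pow, ← ENNReal.rpow_natCast, ← ENNReal.rpow_natCast, ← ENNReal.rpow_mul,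
        ← ENNReal.rpow_mul]
      norm_num
    exact h2.trans (mul_le_mul' (ENNReal.sum_le_tsum s) (ENNReal.sum_le_tsum s))
  have hcont : Tendsto (fun s : Finset ι => (∑ i ∈ s, f i * g i) ^ 2) atTop
      (𝓝 ((∑' i, f i * g i) ^ 2)) :=
    ((ENNReal.continuous_pow 2).tendsto _).comp ENNReal.summable.hasSum
  exact le_of_tendsto' hcont hfin

theorem ennreal_tsum_mul_le {ι : Type*} {f g : ι → ℝ≥0∞} {a b : ℝ≥0∞} (hf : ∑' i, f i ^ 2 ≤ a ^ 2)
    (hg : ∑' i, g i ^ 2 ≤ b ^ 2) : ∑' i, f i * g i ≤ a * b := by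
  have := (ennreal_tsum_mul_sq_le f g).trans (mul_le_mul' hf hg)
  rw [← mul_pow] at this
  exact (ENNReal.pow_le_pow_left_iff two_ne_zero).1 this

theorem ennreal_le_of_tsum_sq {ι : Type*} {f : ι → ℝ≥0∞} {a : ℝ≥0∞} (hf : ∑' i, f i ^ 2 ≤ a ^ 2)
    (i : ι) : f i ≤ a :=
  (ENNReal.pow_le_pow_left_iff two_ne_zero).1 ((ENNReal.le_tsum i).trans hf)

theorem ennreal_tsum_comp_le {ι κ : Type*} {g : ι → κ} (hg : Function.Injective g)
    (f : κ → ℝ≥0∞) : ∑' i, f (g i) ≤ ∑' j, f j :=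
  ENNReal.tsum_comp_le_tsum_of_injective hg f

theorem ennreal_mul_le_sq_add_sq (a b : ℝ≥0∞) : a * b ≤ a ^ 2 + b ^ 2 := by
  rcases le_total a b with h | h
  · calc a * b ≤ b * b := by gcongr
      _ = b ^ 2 := by ring
      _ ≤ _ := le_add_self
  · calc a * b ≤ a * a := by gcongr
      _ = a ^ 2 := by ring
      _ ≤ _ := le_self_add

namespace Freq

/-- The summation over the frequencies is dominated by the one over `k` and two factors of the
phase. -/
theorem tsum_pair_le {e : Freq → ℤ × ℤ × ℤ} (he : Function.Injective e) (κ : ℤ → ℝ≥0∞)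
    {A B : ℤ → ℝ≥0∞} {a S N : ℝ≥0∞} (hA : ∀ k, A k ≤ a) (hB : ∀ k, B k ≤ S)
    (hN : ∑' k, B k ^ 2 ≤ N) (g₁ g₂ : ℤ → ℤ → ℤ → ℤ) (hg₁ : ∀ u v, Function.Injective (g₁ u v))
    (hg₂ : ∀ u v, Function.Injective (g₂ u v))
    (h₁ : ∀ q, q.k₁ = g₁ (e q).1 (e q).2.1 (e q).2.2)
    (h₂ : ∀ q, q.k₂ = g₂ (e q).1 (e q).2.1 (e q).2.2) :
    ∑' q : Freq, κ (e q).1 * κ (e q).2.1 * (A q.k * B q.k₁ * B q.k₂ * B q.k₃)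
      ≤ 2 * (∑' n, κ n) ^ 2 * (a * S * N) := by
  calc _ ≤ ∑' q : Freq, (fun p : ℤ × ℤ × ℤ => κ p.1 * κ p.2.1 *
          ((B (g₁ p.1 p.2.1 p.2.2) ^ 2 + B (g₂ p.1 p.2.1 p.2.2) ^ 2) * (a * S))) (e q) := by
        refine ENNReal.tsum_le_tsum fun q => ?_
        simp only [← h₁, ← h₂]
        refine mul_le_mul' le_rfl ?_
        -- Two factors are turned into squares, which are summable in `k` once the two phase factors
        -- are fixed; the other two are replaced by their suprema.
        calc A q.k * B q.k₁ * B q.k₂ * B q.k₃ = (B q.k₁ * B q.k₂) * (A q.k * B q.k₃) := by ring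
          _ ≤ _ := by
            gcongr
            · exact ennreal_mul_le_sq_add_sq _ _
            · exact hA _
            · exact hB _
    _ ≤ ∑' p : ℤ × ℤ × ℤ, κ p.1 * κ p.2.1 *
          ((B (g₁ p.1 p.2.1 p.2.2) ^ 2 + B (g₂ p.1 p.2.1 p.2.2) ^ 2) * (a * S)) :=
        ennreal_tsum_comp_le he _
    _ = ∑' u, ∑' v, ∑' n, κ u * κ v * ((B (g₁ u v n) ^ 2 + B (g₂ u v n) ^ 2) * (a * S)) := by
        rw [ENNReal.tsum_prod']
        refine tsum_congr fun u => ?_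
        rw [ENNReal.tsum_prod']
    _ ≤ ∑' u, ∑' v, κ u * (κ v * (2 * N * (a * S))) := by
        refine ENNReal.tsum_le_tsum fun u => ENNReal.tsum_le_tsum fun v => ?_
        rw [ENNReal.tsum_mul_left, ENNReal.tsum_mul_right, ENNReal.tsum_add, mul_assoc, two_mul]
        gcongr
        · exact (ennreal_tsum_comp_le (hg₁ u v) (fun n => B n ^ 2)).trans hN
        · exact (ennreal_tsum_comp_le (hg₂ u v) (fun n => B n ^ 2)).trans hN
    _ = _ := by
        simp_rw [ENNReal.tsum_mul_left, ENNReal.tsum_mul_right]; ring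

/-- The summation over the frequencies is dominated by the one over one factor of the phase and one
frequency of each of the two pairs it separates. -/
theorem tsum_single_le {e : Freq → ℤ × ℤ × ℤ} (he : Function.Injective e) (κ : ℤ → ℝ≥0∞)
    {A B : ℤ → ℝ≥0∞} {a b : ℝ≥0∞} (hA : ∑' k, A k ^ 2 ≤ a ^ 2) (hB : ∑' k, B k ^ 2 ≤ b ^ 2)
    (g h : ℤ → ℤ → ℤ) (hg : ∀ u, Function.Injective (g u)) (hh : ∀ u, Function.Injective (h u))
    (F : Freq → ℝ≥0∞)
    (hF : ∀ q, F q = A (e q).2.1 * B (g (e q).1 (e q).2.1)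
      * (B (e q).2.2 * B (h (e q).1 (e q).2.2))) :
    ∑' q : Freq, κ (e q).1 * F q ≤ (∑' n, κ n) * (a * b ^ 3) := by
  calc _ = ∑' q : Freq, (fun p : ℤ × ℤ × ℤ => κ p.1 * (A p.2.1 * B (g p.1 p.2.1)
          * (B p.2.2 * B (h p.1 p.2.2)))) (e q) := by simp only [hF]
    _ ≤ ∑' p : ℤ × ℤ × ℤ, κ p.1 * (A p.2.1 * B (g p.1 p.2.1) * (B p.2.2 * B (h p.1 p.2.2))) :=
        ennreal_tsum_comp_le he _
    _ = ∑' u, ∑' m, ∑' n, κ u * (A m * B (g u m) * (B n * B (h u n))) := by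
        rw [ENNReal.tsum_prod']
        refine tsum_congr fun u => ?_
        rw [ENNReal.tsum_prod']
    _ ≤ ∑' u, κ u * (a * b * (b * b)) := by
        refine ENNReal.tsum_le_tsum fun u => ?_
        simp_rw [ENNReal.tsum_mul_left, ENNReal.tsum_mul_right]
        gcongr
        · exact ennreal_tsum_mul_le hA
            ((ennreal_tsum_comp_le (hg u) (fun n => B n ^ 2)).trans hB)
        · exact ennreal_tsum_mul_le hB
            ((ennreal_tsum_comp_le (hh u) (fun n => B n ^ 2)).trans hB)
    _ = _ := by rw [ENNReal.tsum_mul_right]; ring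

end Freq

/-- The sum `∑ ⟨n⟩^{-t}`. -/
def brSum (t : ℝ) : ℝ≥0∞ := ∑' n : ℤ, ENNReal.ofReal (br n ^ (-t))

theorem summable_br_rpow {t : ℝ} (ht : 1 < t) : Summable fun n : ℤ => br n ^ (-t) := by
  have h : Summable fun n : ℤ => |(n : ℝ)| ^ (-t) := Real.summable_abs_int_rpow ht
  refine Summable.of_norm_bounded_eventually h ?_
  have : ∀ᶠ n : ℤ in cofinite, n ≠ 0 := by
    simpa using (Set.finite_singleton (0 : ℤ)).compl_mem_cofinite
  filter_upwards [this] with n hn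
  have hn' : 0 < |(n : ℝ)| := by simpa using hn
  rw [Real.norm_of_nonneg (Real.rpow_nonneg (br_pos n).le _)]
  exact Real.rpow_le_rpow_of_nonpos hn' (by unfold br; linarith) (by linarith)

theorem brSum_ne_top {t : ℝ} (ht : 1 < t) : brSum t ≠ ∞ := by
  rw [brSum, ← ENNReal.ofReal_tsum_of_nonneg (fun n => Real.rpow_nonneg (br_pos n).le _)
    (summable_br_rpow ht)]
  exact ENNReal.ofReal_ne_top

namespace Freq

theorem ofReal_mul_rpow (m n : ℤ) (t : ℝ) : ENNReal.ofReal ((br m * br n) ^ (-t))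
    = ENNReal.ofReal (br m ^ (-t)) * ENNReal.ofReal (br n ^ (-t)) := by
  rw [Real.mul_rpow (br_pos m).le (br_pos n).le,
    ENNReal.ofReal_mul (Real.rpow_nonneg (br_pos m).le _)]

/-- Any two of `x, y, z` together with `k` determine the quadruple. The kernel sums over the two
phase factors and the squares of `B` over `k`, so that nothing beyond boundedness is asked of `A`,
the slot of the differentiated coefficient. -/
theorem tsum_kern_le (t : ℝ) {A B : ℤ → ℝ≥0∞} {a S N : ℝ≥0∞} (hA : ∀ k, A k ≤ a)
    (hB : ∀ k, B k ≤ S) (hN : ∑' k, B k ^ 2 ≤ N) :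
    ∑' q : Freq, ENNReal.ofReal (kern t q) * (A q.k * B q.k₁ * B q.k₂ * B q.k₃)
      ≤ 6 * brSum t ^ 2 * (a * S * N) := by
  have nn : ∀ m n : ℤ, 0 ≤ (br m * br n) ^ (-t) := fun m n =>
    Real.rpow_nonneg (mul_pos (br_pos m) (br_pos n)).le _
  have inj : ∀ q q' : Freq, q.k₁ = q'.k₁ → q.k₂ = q'.k₂ → q.k₃ = q'.k₃ → q = q' := by
    intro q q' h1 h2 h3
    exact ext' (by rw [q.sum_eq, q'.sum_eq, h1, h2, h3]) h1 h2 h3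
  have e1 := tsum_pair_le (e := fun q => (q.x, q.y, q.k)) (fun q q' h => by
      simp only [Prod.mk.injEq, x, y] at h
      have := q.sum_eq; have := q'.sum_eq
      exact inj q q' (by omega) (by omega) (by omega))
    (fun n => ENNReal.ofReal (br n ^ (-t))) hA hB hN (fun _ v n => n - v) (fun u v n => n - u - v)
    (fun u v m n h => by simpa using h) (fun u v m n h => by simpa using h)
    (fun q => by have := q.sum_eq; simp only [y]; omega)
    (fun q => by have := q.sum_eq; simp only [x, y]; omega)
  have e2 := tsum_pair_le (e := fun q => (q.x, q.z, q.k)) (fun q q' h => by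
      simp only [Prod.mk.injEq, x, z] at h
      have := q.sum_eq; have := q'.sum_eq
      exact inj q q' (by omega) (by omega) (by omega))
    (fun n => ENNReal.ofReal (br n ^ (-t))) hA hB hN (fun u v n => v - n + u) (fun _ v n => v - n)
    (fun u v m n h => by simpa using h) (fun u v m n h => by simpa using h)
    (fun q => by have := q.sum_eq; simp only [x, z]; omega)
    (fun q => by have := q.sum_eq; simp only [z]; omega)
  have e3 := tsum_pair_le (e := fun q => (q.y, q.z, q.k)) (fun q q' h => by
      simp only [Prod.mk.injEq, y, z] at h
      have := q.sum_eq; have := q'.sum_eq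
      exact inj q q' (by omega) (by omega) (by omega))
    (fun n => ENNReal.ofReal (br n ^ (-t))) hA hB hN (fun u _ n => n - u) (fun _ v n => v - n)
    (fun u v m n h => by simpa using h) (fun u v m n h => by simpa using h)
    (fun q => by have := q.sum_eq; simp only [y]; omega)
    (fun q => by have := q.sum_eq; simp only [z]; omega)
  simp only [kern]
  simp_rw [ENNReal.ofReal_add (add_nonneg (nn _ _) (nn _ _)) (nn _ _),
    ENNReal.ofReal_add (nn _ _) (nn _ _), ofReal_mul_rpow, add_mul]
  rw [ENNReal.tsum_add, ENNReal.tsum_add]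
  refine (add_le_add (add_le_add e1 e2) e3).trans (le_of_eq ?_)
  unfold brSum; ring

/-- Fixing one of `x, y, z` splits the four frequencies into two pairs, each tied by a fixed sum or
difference. Cauchy–Schwarz in each pair leaves a sum over the single fixed factor, at the price of
requiring `A` in `ℓ²`. -/
theorem tsum_br_le (t : ℝ) {A B : ℤ → ℝ≥0∞} {a b : ℝ≥0∞} (hA : ∑' k, A k ^ 2 ≤ a ^ 2)
    (hB : ∑' k, B k ^ 2 ≤ b ^ 2) :
    ∑' q : Freq, ENNReal.ofReal (br q.x ^ (-t) + br q.y ^ (-t) + br q.z ^ (-t))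
        * (A q.k * B q.k₁ * B q.k₂ * B q.k₃)
      ≤ 3 * brSum t * (a * b ^ 3) := by
  have nn : ∀ n : ℤ, 0 ≤ br n ^ (-t) := fun n => Real.rpow_nonneg (br_pos n).le _
  have inj : ∀ q q' : Freq, q.k₁ = q'.k₁ → q.k₂ = q'.k₂ → q.k₃ = q'.k₃ → q = q' := by
    intro q q' h1 h2 h3
    exact ext' (by rw [q.sum_eq, q'.sum_eq, h1, h2, h3]) h1 h2 h3
  have e1 := tsum_single_le (e := fun q => (q.x, q.k, q.k₁)) (fun q q' h => by
      simp only [Prod.mk.injEq, x] at h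
      have := q.sum_eq; have := q'.sum_eq
      exact inj q q' (by omega) (by omega) (by omega))
    (fun n => ENNReal.ofReal (br n ^ (-t))) hA hB (fun u n => n - u) (fun u n => n - u)
    (fun u m n h => by simpa using h) (fun u m n h => by simpa using h)
    (fun q => A q.k * B q.k₁ * B q.k₂ * B q.k₃) (fun q => by
      have := q.sum_eq
      rw [show q.k - q.x = q.k₃ by simp only [x]; omega,
        show q.k₁ - q.x = q.k₂ by simp only [x]; omega]; ring)
  have e2 := tsum_single_le (e := fun q => (q.y, q.k, q.k₃)) (fun q q' h => by
      simp only [Prod.mk.injEq, y] at h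
      have := q.sum_eq; have := q'.sum_eq
      exact inj q q' (by omega) (by omega) (by omega))
    (fun n => ENNReal.ofReal (br n ^ (-t))) hA hB (fun u n => n - u) (fun u n => n - u)
    (fun u m n h => by simpa using h) (fun u m n h => by simpa using h)
    (fun q => A q.k * B q.k₁ * B q.k₂ * B q.k₃) (fun q => by
      have := q.sum_eq
      rw [show q.k - q.y = q.k₁ by simp only [y]; omega,
        show q.k₃ - q.y = q.k₂ by simp only [y]; omega]; ring)
  have e3 := tsum_single_le (e := fun q => (q.z, q.k, q.k₁)) (fun q q' h => by
      simp only [Prod.mk.injEq, z] at h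
      have := q.sum_eq; have := q'.sum_eq
      exact inj q q' (by omega) (by omega) (by omega))
    (fun n => ENNReal.ofReal (br n ^ (-t))) hA hB (fun u n => u - n) (fun u n => u - n)
    (fun u m n h => by simpa using h) (fun u m n h => by simpa using h)
    (fun q => A q.k * B q.k₁ * B q.k₂ * B q.k₃) (fun q => by
      have := q.sum_eq
      rw [show q.z - q.k = q.k₂ by simp only [z]; omega,
        show q.z - q.k₁ = q.k₃ by simp only [z]; omega]; ring)
  simp_rw [ENNReal.ofReal_add (add_nonneg (nn _) (nn _)) (nn _),
    ENNReal.ofReal_add (nn _) (nn _), add_mul]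
  rw [ENNReal.tsum_add, ENNReal.tsum_add]
  refine (add_le_add (add_le_add e1 e2) e3).trans (le_of_eq ?_)
  unfold brSum; ring

end Freq

end

/-! ### Bounds for the weights divided by the phase -/

section

namespace Freq

theorem kern_nonneg (t : ℝ) (q : Freq) : 0 ≤ kern t q := by
  have := br_pos q.x
  have := br_pos q.y
  have := br_pos q.z
  unfold kern; positivity

theorem invariant_kern (t : ℝ) : Invariant fun q => ENNReal.ofReal (kern t q) where
  one q := by simp only [kern, swap₁_x, swap₁_y, swap₁_z, br_neg]
  one_three q := by
    have e1 : (swap₁₃ q).x = q.y := rfl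
    have e2 : (swap₁₃ q).y = q.x := rfl
    have e3 : (swap₁₃ q).z = q.z := by simp only [z, swap₁₃, Equiv.coe_fn_mk]; omega
    simp only [kern, e1, e2, e3]; congr 1
    rw [mul_comm (br q.y) (br q.x)]; ring

/-- Each frequency is half a signed sum of the phase factors: `2k = x + y + z`, `2k₁ = x - y + z`,
`2k₂ = z - x - y`, `2k₃ = y - x + z`. -/
theorem abs_le (q : Freq) : (|q.k| ≤ |q.x| + |q.y| + |q.z| ∧ |q.k₁| ≤ |q.x| + |q.y| + |q.z|) ∧
    |q.k₂| ≤ |q.x| + |q.y| + |q.z| ∧ |q.k₃| ≤ |q.x| + |q.y| + |q.z| := by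
  have := q.sum_eq
  simp only [x, y, z, abs_eq_max_neg]; omega

theorem br_x_le (q : Freq) : br q.x ≤ q.mx := le_max_left _ _
theorem br_y_le (q : Freq) : br q.y ≤ q.mx := (le_max_left _ _).trans (le_max_right _ _)
theorem br_z_le (q : Freq) : br q.z ≤ q.mx := (le_max_right _ _).trans (le_max_right _ _)

theorem br_le_mx {q : Freq} {n : ℤ} (hn : |n| ≤ |q.x| + |q.y| + |q.z|) : br n ≤ 3 * q.mx := by
  have h : |(n : ℝ)| ≤ |(q.x : ℝ)| + |(q.y : ℝ)| + |(q.z : ℝ)| := by exact_mod_cast hn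
  have h1 := q.br_x_le
  have h2 := q.br_y_le
  have h3 := q.br_z_le
  unfold br at *; linarith

end Freq

open Freq

variable {β c : ℝ} (hc : 0 < c) (hΦ : ∀ q : Freq, c * q.pr ≤ |phase β q.k₁ q.k₂ q.k₃|)
include hc hΦ

theorem phase_ne_zero (q : Freq) : phase β q.k₁ q.k₂ q.k₃ ≠ 0 :=
  abs_pos.1 ((mul_pos hc q.pr_pos).trans_le (hΦ q))

/-- The exponent `9/8 = 3/4 + 3/8` arises by sharing `mx^{-3/4}` between the two smaller factors. It
exceeds `1`, so the kernel is summable even after the interpolation. -/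
theorem abs_phase_rpow_le (q : Freq) : |phase β q.k₁ q.k₂ q.k₃| ^ (-(3 / 4) : ℝ)
    ≤ c ^ (-(3 / 4) : ℝ) * kern (9 / 8) q := by
  have h1 := q.mx_rpow_mul_le_kern (a := 3 / 4) (3 / 4) (by norm_num)
  have hm := q.mx_pos
  have hp := q.pr_pos
  calc _ ≤ (c * q.pr) ^ (-(3 / 4) : ℝ) :=
        Real.rpow_le_rpow_of_nonpos (by positivity) (hΦ q) (by norm_num)
    _ = c ^ (-(3 / 4) : ℝ) * (q.mx ^ (-(3 / 4) : ℝ) * (q.pr / q.mx) ^ (-(3 / 4) : ℝ)) := by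
        rw [Real.mul_rpow hc.le hp.le, ← Real.mul_rpow hm.le (by positivity),
          mul_div_cancel₀ _ hm.ne']
    _ ≤ _ := by
        rw [show (3 / 4 : ℝ) + 3 / 4 / 2 = 9 / 8 by norm_num] at h1
        gcongr

/-- A loss of less than one power of the largest factor leaves `mx^{-a}` with `a > 0` to share,
which pushes the kernel exponent above `1`. -/
theorem mx_rpow_mul_abs_phase_inv_le {a b : ℝ} (ha : 0 ≤ a) (hb : b ≤ 1 - a) (q : Freq) :
    q.mx ^ b * |phase β q.k₁ q.k₂ q.k₃|⁻¹ ≤ c⁻¹ * kern (1 + a / 2) q := by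
  have h1 := q.mx_rpow_mul_le_kern (a := a) 1 ha
  have hm := q.mx_pos
  have hp := q.pr_pos
  calc _ ≤ q.mx ^ (1 - a) * (c * q.pr)⁻¹ := by
        gcongr
        · exact q.one_le_mx
        · exact hΦ q
    _ = c⁻¹ * (q.mx ^ (-a) * (q.pr / q.mx) ^ (-1 : ℝ)) := by
        rw [show 1 - a = -a + 1 by ring, Real.rpow_add hm, Real.rpow_one, Real.rpow_neg_one]
        field_simp
    _ ≤ _ := by gcongr

-- Here `p` is the largest phase factor, `q` one comparable to it, `r` the third, and `n₀, …, n₃`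
-- are the brackets of the frequencies. Two large factors leave `p^{2α-2+δ}r⁻¹`. As `2α - 2 ≤ 0` and
-- `n₀ ≤ 3p`, the power `2α - 2` may be moved to `n₀`, while `p^δ` is paid by `n₀` and `n₁n₂n₃`. The
-- rest of `(n₁n₂n₃)^s` then buys `n₀^ρ` and `r^η`, because `n₁n₂n₃` dominates both `n₀` and `r`.
omit hc hΦ in
theorem comparable_le {α s δ η ρ p q r n₀ n₁ n₂ n₃ : ℝ} (hα : 1 / 2 ≤ α) (hα' : α ≤ 1) (hδ : 0 ≤ δ)
    (hη : 0 ≤ η) (hs : η ≤ s - δ) (hρ : 2 * α - 2 + δ + ρ ≤ s - δ - η) (hr : 1 ≤ r)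
    (h₀ : 1 ≤ n₀) (h₁ : 1 ≤ n₁) (h₂ : 1 ≤ n₂) (h₃ : 1 ≤ n₃) (hp₀ : n₀ ≤ 3 * p)
    (hqp : p / 8 ≤ q) (h01 : n₀ ≤ n₁ * r) (h23 : r ≤ n₂ * n₃) (hp : p ≤ n₀ * (n₁ * n₂ * n₃)) :
    p ^ (2 * α + δ) * (p * (q * r))⁻¹
      ≤ 24 * ((n₁ * n₂ * n₃) ^ s * (n₀ ^ (-ρ) * r ^ (-(1 + η)))) := by
  have hp1 : 0 < p := by linarith
  set m := n₁ * n₂ * n₃ with hm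
  have hn0 : 0 < n₀ := by linarith
  have hm0 : 0 < m := by positivity
  have hr0 : 0 < r := by linarith
  have hn2 : 1 ≤ n₂ * n₃ := one_le_mul_of_one_le_of_one_le h₂ h₃
  have hmr : r ≤ m := by rw [hm, mul_assoc]; nlinarith
  have hmn : n₀ ≤ m := by
    calc n₀ ≤ n₁ * r := h01
      _ ≤ n₁ * (n₂ * n₃) := by gcongr
      _ = m := by rw [hm]; ring
  have e1 : p ^ (2 * α + δ) * (p * (q * r))⁻¹ ≤ 8 * (p ^ (2 * α - 2) * p ^ δ * r⁻¹) := by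
    calc _ ≤ p ^ (2 * α + δ) * (p * (p / 8 * r))⁻¹ := by gcongr
      _ = _ := by
        rw [show 2 * α + δ = (2 * α - 2) + δ + 2 by ring, Real.rpow_add hp1, Real.rpow_add hp1,
          Real.rpow_two]
        field_simp
  have e2 : p ^ (2 * α - 2) ≤ 3 * n₀ ^ (2 * α - 2) := by
    calc p ^ (2 * α - 2) ≤ (n₀ / 3) ^ (2 * α - 2) :=
          Real.rpow_le_rpow_of_nonpos (by positivity) (by linarith) (by linarith)
      _ = 3 ^ (2 - 2 * α) * n₀ ^ (2 * α - 2) := by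
          rw [Real.div_rpow hn0.le (by norm_num), show 2 - 2 * α = -(2 * α - 2) by ring,
            Real.rpow_neg (by norm_num : (0 : ℝ) ≤ 3)]
          field_simp
      _ ≤ 3 ^ (1 : ℝ) * n₀ ^ (2 * α - 2) := by
          gcongr
          · norm_num
          · linarith
      _ = _ := by rw [Real.rpow_one]
  have e3 : p ^ δ ≤ n₀ ^ δ * m ^ δ := by
    rw [← Real.mul_rpow hn0.le hm0.le]; gcongr
  have e4 : n₀ ^ (2 * α - 2 + δ + ρ) * r ^ η ≤ m ^ (s - δ) := by
    calc _ ≤ n₀ ^ (s - δ - η) * r ^ η := by gcongr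
      _ ≤ m ^ (s - δ - η) * m ^ η := by
          have : 0 ≤ s - δ - η := by linarith
          gcongr
      _ = _ := by rw [← Real.rpow_add hm0]; congr 1; ring
  calc _ ≤ 8 * (p ^ (2 * α - 2) * p ^ δ * r⁻¹) := e1
    _ ≤ 8 * ((3 * n₀ ^ (2 * α - 2)) * (n₀ ^ δ * m ^ δ) * r⁻¹) := by gcongr
    _ = 24 * ((n₀ ^ (2 * α - 2 + δ + ρ) * r ^ η) * m ^ δ * (n₀ ^ (-ρ) * r ^ (-(1 + η)))) := by
        rw [Real.rpow_neg hn0.le, Real.rpow_neg hr0.le, Real.rpow_add hr0, Real.rpow_one,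
          show 2 * α - 2 + δ + ρ = (2 * α - 2) + δ + ρ by ring, Real.rpow_add hn0,
          Real.rpow_add hn0]
        have := Real.rpow_pos_of_pos hn0 ρ
        have := Real.rpow_pos_of_pos hr0 η
        field_simp
        ring
    _ ≤ 24 * (m ^ (s - δ) * m ^ δ * (n₀ ^ (-ρ) * r ^ (-(1 + η)))) := by gcongr
    _ = _ := by rw [← Real.rpow_add hm0]; congr 3; ring

-- All of `n₁, n₂, n₃` are of the size of the largest factor `p`, so the three weights give
-- `p^{3s}`, up to `64 = 4³`. This exceeds the loss `p^{2α-1+δ}` by `p^{2η}`, which is shared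
-- between `q` and `r`.
omit hc hΦ in
theorem separated_le {α s δ η p q r n₁ n₂ n₃ : ℝ} (hs0 : 0 ≤ s) (hs1 : s ≤ 1) (hη : 0 ≤ η)
    (hq : 1 ≤ q) (hr : 1 ≤ r) (hqp : q ≤ p) (hrp : r ≤ p) (hs : 2 * α - 1 + δ - 3 * s ≤ -(2 * η))
    (h₁ : p / 4 ≤ n₁) (h₂ : p / 4 ≤ n₂) (h₃ : p / 4 ≤ n₃) :
    p ^ (2 * α + δ) * (p * (q * r))⁻¹ ≤ 64 * ((n₁ * n₂ * n₃) ^ s * (q * r) ^ (-(1 + η))) := by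
  have hp1 : 1 ≤ p := hq.trans hqp
  have hp : 0 < p := by linarith
  have e0 := sorted_le (a := 2 * η) 1 hq hr hqp hrp (by linarith)
  rw [show 2 * η / 2 = η by ring] at e0
  have e1 : p ^ (3 * s) ≤ 64 * (n₁ * n₂ * n₃) ^ s := by
    calc p ^ (3 * s) = 64 ^ s * (p / 4 * (p / 4) * (p / 4)) ^ s := by
          rw [← Real.mul_rpow (by norm_num) (by positivity), Real.rpow_mul hp.le]
          congr 1; norm_num; ring
      _ ≤ 64 ^ (1 : ℝ) * (n₁ * n₂ * n₃) ^ s := by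
          have : 0 < n₁ := by linarith
          have : 0 < n₂ := by linarith
          gcongr
          norm_num
      _ = _ := by rw [Real.rpow_one]
  calc p ^ (2 * α + δ) * (p * (q * r))⁻¹
      = p ^ (3 * s) * (p ^ (2 * α - 1 + δ - 3 * s) * (q * r) ^ (-1 : ℝ)) := by
        rw [show 2 * α + δ = 3 * s + (2 * α - 1 + δ - 3 * s) + 1 by ring, Real.rpow_add hp,
          Real.rpow_add hp, Real.rpow_one, Real.rpow_neg_one]
        field_simp
    _ ≤ (64 * (n₁ * n₂ * n₃) ^ s) * (p ^ (-(2 * η)) * (q * r) ^ (-1 : ℝ)) := by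
        have : 0 ≤ 64 * (n₁ * n₂ * n₃) ^ s := (Real.rpow_nonneg hp.le _).trans e1
        gcongr
    _ ≤ (64 * (n₁ * n₂ * n₃) ^ s) * (q * r) ^ (-(1 + η)) := by
        have : 0 ≤ 64 * (n₁ * n₂ * n₃) ^ s := (Real.rpow_nonneg hp.le _).trans e1
        gcongr
    _ = _ := by ring

omit hc hΦ in
/-- The weight of the energy functional against the three factors in `H^s`. -/
theorem mx_rpow_mul_pr_inv_le {α s δ η ρ : ℝ} (hα : 1 / 2 ≤ α) (hα' : α ≤ 1) (hδ : 0 ≤ δ)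
    (hη : 0 ≤ η) (hs : η ≤ s - δ) (hs1 : s ≤ 1) (hρ : 2 * α - 2 + δ + ρ ≤ s - δ - η)
    (hs' : 2 * α - 1 + δ - 3 * s ≤ -(2 * η)) (q : Freq) :
    q.mx ^ (2 * α + δ) * q.pr⁻¹ ≤ 64 * ((br q.k₁ * br q.k₂ * br q.k₃) ^ s *
      (br q.k ^ (-ρ) * (br q.x ^ (-(1 + η)) + br q.y ^ (-(1 + η)) + br q.z ^ (-(1 + η)))
        + kern (1 + η) q)) := by
  have hsum := q.sum_eq
  obtain ⟨⟨a0, a1⟩, a2, a3⟩ := q.abs_le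
  have h0 := one_le_br q.k
  have h1 := one_le_br q.k₁
  have h2 := one_le_br q.k₂
  have h3 := one_le_br q.k₃
  have hx := one_le_br q.x
  have hy := one_le_br q.y
  have hz := one_le_br q.z
  have mx := q.br_x_le
  have my := q.br_y_le
  have mz := q.br_z_le
  have b0 := br_le_mx a0
  have ex : q.x = q.k₁ - q.k₂ := rfl
  have ey : q.y = q.k₃ - q.k₂ := rfl
  have ez : q.z = q.k₁ + q.k₃ := rfl
  have s0 : 0 ≤ s := by linarith
  have n1 : 0 ≤ br q.x ^ (-(1 + η)) := by positivity
  have n2 : 0 ≤ br q.y ^ (-(1 + η)) := by positivity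
  have n3 : 0 ≤ br q.z ^ (-(1 + η)) := by positivity
  have n0 : 0 ≤ br q.k ^ (-ρ) := by positivity
  have m1 : 0 ≤ (br q.x * br q.y) ^ (-(1 + η)) := by positivity
  have m2 : 0 ≤ (br q.x * br q.z) ^ (-(1 + η)) := by positivity
  have m3 : 0 ≤ (br q.y * br q.z) ^ (-(1 + η)) := by positivity
  have hP : 0 ≤ (br q.k₁ * br q.k₂ * br q.k₃) ^ s := by positivity
  have hm : q.mx ≤ br q.k * (br q.k₁ * br q.k₂ * br q.k₃) := by
    have i1 : br q.x ≤ br q.k₁ * br q.k₂ := br_le_mul (by simp only [abs_eq_max_neg]; omega)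
    have i2 : br q.y ≤ br q.k₂ * br q.k₃ := br_le_mul (by simp only [abs_eq_max_neg]; omega)
    have i3 : br q.z ≤ br q.k₁ * br q.k₃ := br_le_mul (by simp only [abs_eq_max_neg]; omega)
    have j : br q.k₁ * br q.k₂ * br q.k₃ ≤ br q.k * (br q.k₁ * br q.k₂ * br q.k₃) :=
      le_mul_of_one_le_left (by positivity) h0
    refine le_trans (max_le ?_ (max_le ?_ ?_)) j
    · exact i1.trans (le_mul_of_one_le_right (by positivity) h3)
    · exact i2.trans (by nlinarith [mul_pos (br_pos q.k₂) (br_pos q.k₃)])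
    · exact i3.trans (by nlinarith [mul_pos (br_pos q.k₁) (br_pos q.k₃)])
  -- the three shapes of the comparable case
  have cx : ∀ w, q.mx / 8 ≤ w → q.mx ^ (2 * α + δ) * (q.mx * (w * br q.x))⁻¹
      ≤ 24 * ((br q.k₁ * br q.k₂ * br q.k₃) ^ s * (br q.k ^ (-ρ) * br q.x ^ (-(1 + η)))) := by
    intro w hw
    have := comparable_le (r := br q.x) (n₁ := br q.k₃) (n₂ := br q.k₁) (n₃ := br q.k₂)
      hα hα' hδ hη hs hρ hx h0 h3 h1 h2 b0 hw (br_le_mul (by simp only [abs_eq_max_neg]; omega)) (br_le_mul (by simp only [abs_eq_max_neg]; omega))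
      (hm.trans_eq (by ring))
    rwa [show br q.k₃ * br q.k₁ * br q.k₂ = br q.k₁ * br q.k₂ * br q.k₃ by ring] at this
  have cy : ∀ w, q.mx / 8 ≤ w → q.mx ^ (2 * α + δ) * (q.mx * (w * br q.y))⁻¹
      ≤ 24 * ((br q.k₁ * br q.k₂ * br q.k₃) ^ s * (br q.k ^ (-ρ) * br q.y ^ (-(1 + η)))) := by
    intro w hw
    exact comparable_le (r := br q.y) (n₁ := br q.k₁) (n₂ := br q.k₂) (n₃ := br q.k₃)
      hα hα' hδ hη hs hρ hy h0 h1 h2 h3 b0 hw (br_le_mul (by simp only [abs_eq_max_neg]; omega)) (br_le_mul (by simp only [abs_eq_max_neg]; omega)) hm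
  have cz : ∀ w, q.mx / 8 ≤ w → q.mx ^ (2 * α + δ) * (q.mx * (w * br q.z))⁻¹
      ≤ 24 * ((br q.k₁ * br q.k₂ * br q.k₃) ^ s * (br q.k ^ (-ρ) * br q.z ^ (-(1 + η)))) := by
    intro w hw
    have := comparable_le (r := br q.z) (n₁ := br q.k₂) (n₂ := br q.k₁) (n₃ := br q.k₃)
      hα hα' hδ hη hs hρ hz h0 h2 h1 h3 b0 hw (br_le_mul (by simp only [abs_eq_max_neg]; omega)) (br_le_mul (by simp only [abs_eq_max_neg]; omega))
      (hm.trans_eq (by ring))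
    rwa [show br q.k₂ * br q.k₁ * br q.k₃ = br q.k₁ * br q.k₂ * br q.k₃ by ring] at this
  -- when two factors are much smaller than the third, all frequencies are comparable to it
  have sep : ∀ u v w : ℤ, q.mx = br u → br v < q.mx / 8 → br w < q.mx / 8 →
      ∀ n : ℤ, |u| ≤ 2 * |n| + |v| + |w| → q.mx / 4 ≤ br n := by
    intro u v w hu hv hw n hn
    have hn' : |(u : ℝ)| ≤ 2 * |(n : ℝ)| + |(v : ℝ)| + |(w : ℝ)| := by exact_mod_cast hn
    have := abs_nonneg (u : ℝ)
    rw [hu] at hv hw ⊢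
    unfold br at hv hw ⊢; linarith
  have sepb : ∀ u v w : ℤ, q.mx = br u → br v < q.mx / 8 → br w < q.mx / 8 →
      (|u| ≤ 2 * |q.k₁| + |v| + |w|) → (|u| ≤ 2 * |q.k₂| + |v| + |w|) →
      (|u| ≤ 2 * |q.k₃| + |v| + |w|) → q.mx ^ (2 * α + δ) * (q.mx * (br v * br w))⁻¹
      ≤ 64 * ((br q.k₁ * br q.k₂ * br q.k₃) ^ s * (br v * br w) ^ (-(1 + η))) := by
    intro u v w hu hv hw h1 h2 h3
    have := q.mx_pos
    exact separated_le s0 hs1 hη (one_le_br v) (one_le_br w) (by linarith) (by linarith) hs'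
      (sep u v w hu hv hw _ h1) (sep u v w hu hv hw _ h2) (sep u v w hu hv hw _ h3)
  set P := (br q.k₁ * br q.k₂ * br q.k₃) ^ s
  have fin : ∀ {A X : ℝ}, 0 ≤ X → A ≤ 24 * (P * (br q.k ^ (-ρ) * X)) →
      X ≤ br q.x ^ (-(1 + η)) + br q.y ^ (-(1 + η)) + br q.z ^ (-(1 + η)) →
      A ≤ 64 * (P * (br q.k ^ (-ρ) * (br q.x ^ (-(1 + η)) + br q.y ^ (-(1 + η))
        + br q.z ^ (-(1 + η))) + kern (1 + η) q)) := by
    intro A X hX h hle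
    refine h.trans ?_
    have := kern_nonneg (1 + η) q
    calc 24 * (P * (br q.k ^ (-ρ) * X)) ≤ 64 * (P * (br q.k ^ (-ρ) * X)) := by
          gcongr ?_ * _; norm_num
      _ ≤ _ := by gcongr; linarith [mul_le_mul_of_nonneg_left hle n0]
  have fin' : ∀ {A X : ℝ}, A ≤ 64 * (P * X) → X ≤ kern (1 + η) q →
      A ≤ 64 * (P * (br q.k ^ (-ρ) * (br q.x ^ (-(1 + η)) + br q.y ^ (-(1 + η))
        + br q.z ^ (-(1 + η))) + kern (1 + η) q)) := by
    intro A X h hle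
    refine h.trans ?_
    have : 0 ≤ br q.k ^ (-ρ) * (br q.x ^ (-(1 + η)) + br q.y ^ (-(1 + η))
        + br q.z ^ (-(1 + η))) := by positivity
    refine mul_le_mul_of_nonneg_left (mul_le_mul_of_nonneg_left (by linarith) hP) (by norm_num)
  have hcase : q.mx = br q.x ∨ q.mx = br q.y ∨ q.mx = br q.z := by
    rcases max_choice (br q.x) (max (br q.y) (br q.z)) with h | h
    · exact .inl h
    · rcases max_choice (br q.y) (br q.z) with h' | h'
      · exact .inr (.inl (h.trans h'))
      · exact .inr (.inr (h.trans h'))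
  -- For each choice of the largest factor: if one of the other two is at least `mx/8` the
  -- comparable estimate applies, with the remaining factor as `r`; if neither is, the separated one
  -- does.
  rcases hcase with h | h | h
  · rcases le_or_gt (q.mx / 8) (br q.y) with hc1 | hc1
    · rw [show q.pr = q.mx * (br q.y * br q.z) by rw [h, pr]; ring]
      exact fin n3 (cz _ hc1) (by linarith)
    rcases le_or_gt (q.mx / 8) (br q.z) with hc2 | hc2
    · rw [show q.pr = q.mx * (br q.z * br q.y) by rw [h, pr]; ring]
      exact fin n2 (cy _ hc2) (by linarith)
    rw [show q.pr = q.mx * (br q.y * br q.z) by rw [h, pr]; ring]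
    exact fin' (sepb _ _ _ h hc1 hc2 (by simp only [abs_eq_max_neg]; omega) (by simp only [abs_eq_max_neg]; omega) (by simp only [abs_eq_max_neg]; omega)) (by unfold kern; linarith)
  · rcases le_or_gt (q.mx / 8) (br q.x) with hc1 | hc1
    · rw [show q.pr = q.mx * (br q.x * br q.z) by rw [h, pr]; ring]
      exact fin n3 (cz _ hc1) (by linarith)
    rcases le_or_gt (q.mx / 8) (br q.z) with hc2 | hc2
    · rw [show q.pr = q.mx * (br q.z * br q.x) by rw [h, pr]; ring]
      exact fin n1 (cx _ hc2) (by linarith)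
    rw [show q.pr = q.mx * (br q.x * br q.z) by rw [h, pr]; ring]
    exact fin' (sepb _ _ _ h hc1 hc2 (by simp only [abs_eq_max_neg]; omega) (by simp only [abs_eq_max_neg]; omega) (by simp only [abs_eq_max_neg]; omega)) (by unfold kern; linarith)
  · rcases le_or_gt (q.mx / 8) (br q.x) with hc1 | hc1
    · rw [show q.pr = q.mx * (br q.x * br q.y) by rw [h, pr]; ring]
      exact fin n2 (cy _ hc1) (by linarith)
    rcases le_or_gt (q.mx / 8) (br q.y) with hc2 | hc2
    · rw [show q.pr = q.mx * (br q.y * br q.x) by rw [h, pr]; ring]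
      exact fin n1 (cx _ hc2) (by linarith)
    rw [show q.pr = q.mx * (br q.x * br q.y) by rw [h, pr]; ring]
    exact fin' (sepb _ _ _ h hc1 hc2 (by simp only [abs_eq_max_neg]; omega) (by simp only [abs_eq_max_neg]; omega) (by simp only [abs_eq_max_neg]; omega)) (by unfold kern; linarith)

end

/-! ### The weighted quadrilinear estimate -/

section

open Freq

theorem quadSum_kern_le (t : ℝ) {A B : ℤ → ℝ≥0∞} {a S : ℝ≥0∞} (hA : ∀ k, A k ≤ a)
    (hB : ∑' k, B k ^ 2 ≤ S ^ 2) :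
    quadSum (fun q => ENNReal.ofReal (kern t q)) A B ≤ 6 * brSum t ^ 2 * (a * S ^ 3) := by
  refine (tsum_kern_le t hA (ennreal_le_of_tsum_sq hB) hB).trans (le_of_eq ?_)
  ring

theorem quadSum_const_mul_le {W : Freq → ℝ} {t C : ℝ} (hC : 0 ≤ C) (hW : ∀ q, W q ≤ C * kern t q)
    (A B : ℤ → ℝ≥0∞) : quadSum (fun q => ENNReal.ofReal (W q)) A B
      ≤ ENNReal.ofReal C * quadSum (fun q => ENNReal.ofReal (kern t q)) A B := by
  unfold quadSum
  rw [← ENNReal.tsum_mul_left]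
  refine ENNReal.tsum_le_tsum fun q => ?_
  rw [← mul_assoc (ENNReal.ofReal C), ← ENNReal.ofReal_mul hC]
  exact mul_le_mul' (ENNReal.ofReal_le_ofReal (hW q)) le_rfl

/-- The weight `⟨k⟩^{2α}` singles out `k`; bounding it by a power of `mx` restores the symmetry
needed to move the derivative between the four factors. -/
theorem invariant_of_mx_phase (β a : ℝ) :
    Invariant fun q => ENNReal.ofReal (q.mx ^ a * |phase β q.k₁ q.k₂ q.k₃|⁻¹) where
  one q := by simp only [mx_swap₁, abs_phase_swap₁]
  one_three q := by simp only [mx_swap₁₃, abs_phase_swap₁₃]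

/-- The quadrilinear estimate behind the energy functional: three factors in `H^s`. -/
theorem exists_quadSum_le {β c : ℝ} (hc : 0 < c)
    (hΦ : ∀ q : Freq, c * q.pr ≤ |phase β q.k₁ q.k₂ q.k₃|) {α s δ η : ℝ}
    (hα : 1 / 2 ≤ α) (hα' : α ≤ 1) (hδ : 0 ≤ δ)
    (hη : 0 < η) (hs : η ≤ s - δ) (hs1 : s ≤ 1) (hρ : 2 * α - 2 + δ + 3 / 8 ≤ s - δ - η)
    (hs' : 2 * α - 1 + δ - 3 * s ≤ -(2 * η)) :
    ∃ C : ℝ≥0∞, C ≠ ∞ ∧ ∀ (A V : ℤ → ℝ≥0∞) (a b : ℝ≥0∞), (∀ k, A k ≤ a) →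
      ∑' k, (ENNReal.ofReal (jb k ^ (-(3 / 8) : ℝ)) * A k) ^ 2 ≤ a ^ 2 →
      ∑' k, (ENNReal.ofReal (jb k ^ s) * V k) ^ 2 ≤ b ^ 2 →
      quadSum (fun q => ENNReal.ofReal (q.mx ^ (2 * α + δ) * |phase β q.k₁ q.k₂ q.k₃|⁻¹)) A V
        ≤ C * (a * b ^ 3) := by
  -- The factor `8 = 2³` comes from replacing `jb` by `br` in three factors; the bracket adds the
  -- two summation constants, and `64` is that of the pointwise weight bound.
  refine ⟨ENNReal.ofReal (c⁻¹ * 64) * ((3 * brSum (1 + η) + 6 * brSum (1 + η) ^ 2) * 8), ?_, ?_⟩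
  · have := brSum_ne_top (t := 1 + η) (by linarith)
    finiteness
  intro A V a b hA hA2 hV
  set B : ℤ → ℝ≥0∞ := fun k => ENNReal.ofReal (br k ^ s) * V k with hBdef
  set A' : ℤ → ℝ≥0∞ := fun k => ENNReal.ofReal (br k ^ (-(3 / 8) : ℝ)) * A k with hA'def
  have s0 : 0 ≤ s := by linarith
  have hB : ∑' k, B k ^ 2 ≤ (2 * b) ^ 2 := by
    rw [mul_pow]
    refine le_trans ?_ (mul_le_mul' le_rfl hV)
    rw [← ENNReal.tsum_mul_left]
    refine ENNReal.tsum_le_tsum fun k => ?_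
    rw [← mul_pow, ← mul_assoc]
    simp only [hBdef]
    gcongr
    rw [show (2 : ℝ≥0∞) = ENNReal.ofReal 2 by simp, ← ENNReal.ofReal_mul (by norm_num)]
    refine ENNReal.ofReal_le_ofReal ?_
    calc br k ^ s ≤ (2 * jb k) ^ s := Real.rpow_le_rpow (br_pos k).le (br_le_two_mul_jb k) s0
      _ = 2 ^ s * jb k ^ s := Real.mul_rpow (by norm_num) (jb_pos k).le
      _ ≤ 2 ^ (1 : ℝ) * jb k ^ s := by
        have := jb_pos k
        gcongr
        norm_num
      _ = _ := by rw [Real.rpow_one]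
  have hA' : ∑' k, A' k ^ 2 ≤ a ^ 2 := by
    refine le_trans (ENNReal.tsum_le_tsum fun k => ?_) hA2
    simp only [hA'def]
    gcongr ?_ ^ 2
    refine mul_le_mul' (ENNReal.ofReal_le_ofReal ?_) le_rfl
    exact Real.rpow_le_rpow_of_nonpos (jb_pos k) (jb_le_br k) (by norm_num)
  have h1 := tsum_br_le (1 + η) hA' hB
  have h2 : ∑' q : Freq, ENNReal.ofReal (kern (1 + η) q) * (A q.k * B q.k₁ * B q.k₂ * B q.k₃)
      ≤ _ := quadSum_kern_le (1 + η) hA hB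
  calc _ ≤ ∑' q : Freq, ENNReal.ofReal (c⁻¹ * 64) *
        (ENNReal.ofReal (br q.x ^ (-(1 + η)) + br q.y ^ (-(1 + η)) + br q.z ^ (-(1 + η)))
          * (A' q.k * B q.k₁ * B q.k₂ * B q.k₃)
        + ENNReal.ofReal (kern (1 + η) q) * (A q.k * B q.k₁ * B q.k₂ * B q.k₃)) := by
        refine ENNReal.tsum_le_tsum fun q => ?_
        have hx := br_pos q.x
        have hy := br_pos q.y
        have hz := br_pos q.z
        have h0 := br_pos q.k
        have b1 := br_pos q.k₁
        have b2 := br_pos q.k₂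
        have b3 := br_pos q.k₃
        have hk := kern_nonneg (1 + η) q
        have hm := q.mx_pos
        have hp := q.pr_pos
        have key := mx_rpow_mul_pr_inv_le hα hα' hδ hη.le hs hs1 hρ hs' q
        set X := br q.x ^ (-(1 + η)) + br q.y ^ (-(1 + η)) + br q.z ^ (-(1 + η)) with hX
        have hX0 : 0 ≤ X := by positivity
        have hj : q.mx ^ (2 * α + δ) * |phase β q.k₁ q.k₂ q.k₃|⁻¹ ≤ (c⁻¹ * 64) *
            (br q.k₁ ^ s * br q.k₂ ^ s * br q.k₃ ^ s *
              (br q.k ^ (-(3 / 8) : ℝ) * X + kern (1 + η) q)) := by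
          calc _ ≤ q.mx ^ (2 * α + δ) * (c * q.pr)⁻¹ := by
                gcongr
                exact hΦ q
            _ = c⁻¹ * (q.mx ^ (2 * α + δ) * q.pr⁻¹) := by rw [mul_inv]; ring
            _ ≤ c⁻¹ * (64 * ((br q.k₁ * br q.k₂ * br q.k₃) ^ s *
                (br q.k ^ (-(3 / 8) : ℝ) * X + kern (1 + η) q))) := by gcongr
            _ = _ := by
              rw [Real.mul_rpow (by positivity) b3.le, Real.mul_rpow b1.le b2.le]; ring
        refine (mul_le_mul' (ENNReal.ofReal_le_ofReal hj) le_rfl).trans (le_of_eq ?_)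
        rw [ENNReal.ofReal_mul (by positivity), ENNReal.ofReal_mul (by positivity),
          ENNReal.ofReal_mul (by positivity),
          ENNReal.ofReal_mul (by positivity), ENNReal.ofReal_mul (by positivity),
          ENNReal.ofReal_add (by positivity) hk, ENNReal.ofReal_mul (by positivity)]
        simp only [hBdef, hA'def]
        ring
    _ ≤ ENNReal.ofReal (c⁻¹ * 64) * (3 * brSum (1 + η) * (a * (2 * b) ^ 3)
        + 6 * brSum (1 + η) ^ 2 * (a * (2 * b) ^ 3)) := by
        rw [ENNReal.tsum_mul_left, ENNReal.tsum_add]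
        gcongr
    _ = _ := by ring

end

/-! ### Fourier coefficients, projections and tails in `L²` -/

section

/-- The normalized Haar measure of the torus. -/
abbrev haarT : Measure Torus := AddCircle.haarAddCircle

theorem hat_eq_repr (f : L2) (k : ℤ) : hat f k = fourierBasis.repr f k := (fourierBasis_repr f k).symm

theorem hat_sub (f g : L2) (k : ℤ) : hat (f - g) k = hat f k - hat g k := by
  simp [hat_eq_repr]

theorem hat_smul (c : ℂ) (f : L2) (k : ℤ) : hat (c • f) k = c * hat f k := by
  simp [hat_eq_repr]

theorem hat_eq_inner (f : L2) (k : ℤ) : hat f k = inner ℂ (fourierLp 2 k : L2) f := by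
  rw [hat_eq_repr, HilbertBasis.repr_apply_apply, coe_fourierBasis]

theorem continuous_hat (k : ℤ) : Continuous fun f : L2 => hat f k := by
  simp only [hat_eq_inner]; fun_prop

theorem hat_fourierLp (m k : ℤ) : hat (fourierLp 2 m : L2) k = if k = m then 1 else 0 := by
  rw [hat_eq_inner]; exact orthonormal_iff_ite.1 orthonormal_fourier k m

theorem hasSum_norm_hat_sq (f : L2) : HasSum (fun k => ‖hat f k‖ ^ 2) (‖f‖ ^ 2) := by
  simp_rw [hat_eq_repr]
  have H : HasSum (fun i => ‖fourierBasis.repr f i‖ ^ 2) (‖fourierBasis.repr f‖ ^ 2) := by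
    apply_mod_cast lp.hasSum_norm ?_ (fourierBasis.repr f)
    simp
  simpa using H

theorem tsum_enorm_hat_sq (f : L2) : ∑' k, ‖hat f k‖ₑ ^ 2 = ‖f‖ₑ ^ 2 := by
  have h := hasSum_norm_hat_sq f
  have e : ∀ z : ℂ, ‖z‖ₑ ^ 2 = ENNReal.ofReal (‖z‖ ^ 2) := fun z => by
    rw [← ofReal_norm, ENNReal.ofReal_pow (norm_nonneg _)]
  simp_rw [e]
  rw [← ENNReal.ofReal_tsum_of_nonneg (fun _ => by positivity) h.summable, h.tsum_eq,
    ENNReal.ofReal_pow (norm_nonneg _), ofReal_norm]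

theorem hat_ext {f g : L2} (h : ∀ k, hat f k = hat g k) : f = g := by
  apply fourierBasis.repr.injective
  ext k
  rw [← hat_eq_repr, ← hat_eq_repr, h]

theorem enorm_hat_le (f : L2) (k : ℤ) : ‖hat f k‖ₑ ≤ ‖f‖ₑ :=
  ennreal_le_of_tsum_sq (tsum_enorm_hat_sq f).le k

/-- The frequencies `|k| ≤ N`. -/
abbrev freqs (N : ℕ) : Finset ℤ := Finset.Icc (-(N : ℤ)) (N : ℤ)

theorem mem_freqs {N : ℕ} {k : ℤ} : k ∈ freqs N ↔ |k| ≤ N := by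
  rw [Finset.mem_Icc, abs_le]

theorem hat_sum {ι : Type*} (s : Finset ι) (F : ι → L2) (k : ℤ) :
    hat (∑ i ∈ s, F i) k = ∑ i ∈ s, hat (F i) k := by
  simp only [hat_eq_inner, inner_sum]

/-- The trigonometric polynomial with given coefficients. -/
def tpoly (s : Finset ℤ) (c : ℤ → ℂ) : L2 := ∑ k ∈ s, c k • fourierLp 2 k

theorem hat_tpoly (s : Finset ℤ) (c : ℤ → ℂ) (k : ℤ) :
    hat (tpoly s c) k = if k ∈ s then c k else 0 := by
  simp [tpoly, hat_sum, hat_smul, hat_fourierLp]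

theorem proj_eq_tpoly (N : ℕ) (f : L2) : proj N f = tpoly (freqs N) (hat f) := rfl

theorem hat_proj (N : ℕ) (f : L2) (k : ℤ) : hat (proj N f) k = if |k| ≤ N then hat f k else 0 := by
  rw [proj_eq_tpoly, hat_tpoly]; simp only [mem_freqs]

theorem continuous_proj (N : ℕ) : Continuous (proj N) := by
  unfold proj
  exact continuous_finsetSum _ fun k _ => (continuous_hat k).smul continuous_const

theorem proj_sub (N : ℕ) (f g : L2) : proj N (f - g) = proj N f - proj N g := by
  refine hat_ext fun k => ?_
  simp only [hat_proj, hat_sub]; split_ifs <;> simp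

theorem hat_sub_proj (N : ℕ) (f : L2) (k : ℤ) :
    hat (f - proj N f) k = if |k| ≤ N then 0 else hat f k := by
  rw [hat_sub, hat_proj]; split_ifs <;> simp

theorem norm_le_of_hat {f g : L2} (h : ∀ k, ‖hat f k‖ ≤ ‖hat g k‖) : ‖f‖ ≤ ‖g‖ := by
  have := hasSum_le (fun k => pow_le_pow_left₀ (norm_nonneg _) (h k) 2) (hasSum_norm_hat_sq f)
    (hasSum_norm_hat_sq g)
  exact (pow_le_pow_iff_left₀ (norm_nonneg _) (norm_nonneg _) two_ne_zero).1 this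

theorem norm_proj_le (N : ℕ) (f : L2) : ‖proj N f‖ ≤ ‖f‖ :=
  norm_le_of_hat fun k => by rw [hat_proj]; split_ifs <;> simp

theorem norm_sub_proj_le (N : ℕ) (f : L2) : ‖f - proj N f‖ ≤ ‖f‖ :=
  norm_le_of_hat fun k => by rw [hat_sub_proj]; split_ifs <;> simp

theorem antitone_norm_sub_proj (f : L2) : Antitone fun N => ‖f - proj N f‖ := fun M N h =>
  norm_le_of_hat fun k => by
    rw [hat_sub_proj, hat_sub_proj]
    have : (M : ℤ) ≤ N := by exact_mod_cast h
    split_ifs with h1 h2 h3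
    · simp
    · simp
    · omega
    · exact le_rfl

theorem tendsto_proj (f : L2) : Tendsto (fun N => proj N f) atTop (𝓝 f) := by
  have h := hasSum_fourier_series_L2 f
  have hs : Tendsto freqs atTop atTop := by
    refine tendsto_atTop_finset_of_monotone (fun M N h => ?_) fun k => ⟨k.natAbs, ?_⟩
    · exact Finset.Icc_subset_Icc (by simpa using h) (by simpa using h)
    · rw [mem_freqs]; simp
  exact h.comp hs

theorem tendsto_norm_sub_proj (f : L2) : Tendsto (fun N => ‖f - proj N f‖) atTop (𝓝 0) := by
  have := (tendsto_const_nhds (x := f)).sub (tendsto_proj f)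
  simpa using this.norm

/-- Uniform convergence of the truncations on compact time intervals. -/
theorem tendstoUniformlyOn_norm_sub_proj {U : ℝ → L2} (hU : Continuous U) (T : ℝ) :
    TendstoUniformlyOn (fun N t => ‖U t - proj N (U t)‖) (fun _ => 0) atTop (Set.Icc 0 T) := by
  refine Antitone.tendstoUniformlyOn_of_forall_tendsto isCompact_Icc (fun N => ?_) (fun t _ => ?_)
    continuousOn_const (fun t _ => ?_)
  · exact (hU.sub ((continuous_proj N).comp hU)).norm.continuousOn
  · exact antitone_norm_sub_proj (U t)
  · exact tendsto_norm_sub_proj (U t)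

/-- The fourth power of the `L⁴` norm. -/
def q4 (f : L2) : ℝ≥0∞ := ∫⁻ x, ‖(f : Torus → ℂ) x‖ₑ ^ 4 ∂haarT

/-- The third power of the `L³` norm. -/
def q3 (f : L2) : ℝ≥0∞ := ∫⁻ x, ‖(f : Torus → ℂ) x‖ₑ ^ 3 ∂haarT

theorem enorm_sq_eq_lintegral {E : Type*} [NormedAddCommGroup E] (f : Lp E 2 haarT) :
    ‖f‖ₑ ^ 2 = ∫⁻ x, ‖f x‖ₑ ^ 2 ∂haarT := by
  rw [Lp.enorm_def, eLpNorm_eq_lintegral_rpow_enorm_toReal two_ne_zero (by simp)]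
  simp only [ENNReal.toReal_ofNat, one_div]
  rw [← ENNReal.rpow_natCast, ← ENNReal.rpow_mul]
  norm_num

theorem aestronglyMeasurable_coe (f : L2) : AEStronglyMeasurable (f : Torus → ℂ) haarT :=
  Lp.aestronglyMeasurable f

theorem tpoly_coe (s : Finset ℤ) (c : ℤ → ℂ) :
    (tpoly s c : Torus → ℂ) =ᵐ[haarT] fun x => ∑ k ∈ s, c k * fourier k x := by
  have h1 : (tpoly s c : Torus → ℂ) =ᵐ[haarT]
      ∑ k ∈ s, ((c k • fourierLp 2 k : L2) : Torus → ℂ) := Lp.coeFn_finsetSum _ _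
  have h2 : ∀ k : ℤ, ((c k • fourierLp 2 k : L2) : Torus → ℂ) =ᵐ[haarT]
      fun x => c k * fourier k x := fun k => by
    filter_upwards [Lp.coeFn_smul (c k) (fourierLp 2 k : L2), coeFn_fourierLp (T := 2 * Real.pi) 2 k]
      with x e1 e2
    rw [e1, Pi.smul_apply, e2, smul_eq_mul]
  have h3 := ae_all_iff.2 h2
  filter_upwards [h1, h3] with x e1 e3
  rw [e1, Finset.sum_apply]
  exact Finset.sum_congr rfl fun k _ => e3 k

end

/-! ### The cubic nonlinearity and the `L⁴` norm of trigonometric polynomials -/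

section

theorem enorm_fourier (k : ℤ) (x : Torus) : ‖fourier k x‖ₑ = 1 := by
  rw [← ofReal_norm, fourier_apply, Circle.norm_coe, ENNReal.ofReal_one]

/-- The cubic nonlinearity, pointwise. -/
def cube (z : ℂ) : ℂ := ((‖z‖ ^ 2 : ℝ) : ℂ) * z

theorem cube_eq (z : ℂ) : cube z = z * conj z * z := by
  rw [cube, Complex.mul_conj, Complex.normSq_eq_norm_sq]

theorem continuous_cube : Continuous cube := by unfold cube; fun_prop

theorem enorm_cube (z : ℂ) : ‖cube z‖ₑ = ‖z‖ₑ ^ 3 := by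
  rw [cube, enorm_mul, ← ofReal_norm, ← ofReal_norm, Complex.norm_real, norm_pow, norm_norm,
    ENNReal.ofReal_pow (norm_nonneg _), ← pow_succ]

theorem cubicHat_eq (f : L2) (k : ℤ) : cubicHat f k = fourierCoeff (fun x => cube (f x)) k := rfl

theorem aestronglyMeasurable_cube (f : L2) : AEStronglyMeasurable (fun x => cube (f x)) haarT :=
  continuous_cube.comp_aestronglyMeasurable (aestronglyMeasurable_coe f)

theorem integrable_cube {f : L2} (hf : q3 f ≠ ∞) : Integrable (fun x => cube (f x)) haarT := by
  refine ⟨aestronglyMeasurable_cube f, ?_⟩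
  rw [HasFiniteIntegral]
  simp only [enorm_cube]
  exact hf.lt_top

theorem enorm_cubicHat_le (f : L2) (k : ℤ) : ‖cubicHat f k‖ₑ ≤ q3 f := by
  rw [cubicHat_eq, fourierCoeff]
  refine (enorm_integral_le_lintegral_enorm _).trans (le_of_eq (lintegral_congr fun x => ?_))
  rw [enorm_smul, enorm_fourier, one_mul, enorm_cube]

theorem pow_three_le (a : ℝ≥0∞) : a ^ 3 ≤ 1 + a ^ 4 := by
  rcases le_total a 1 with h | h
  · exact (pow_le_one' h 3).trans le_self_add
  · exact (pow_le_pow_right₀ h (by norm_num)).trans le_add_self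

theorem q3_le (f : L2) : q3 f ≤ 1 + q4 f := by
  calc q3 f ≤ ∫⁻ x, (1 + ‖(f : Torus → ℂ) x‖ₑ ^ 4) ∂haarT := lintegral_mono fun x => pow_three_le _
    _ = _ := by rw [lintegral_add_left measurable_const]; simp [q4]

theorem q3_ne_top {f : L2} (hf : q4 f ≠ ∞) : q3 f ≠ ∞ :=
  ne_top_of_le_ne_top (by finiteness) (q3_le f)

section Polynomials

variable (s : Finset ℤ) (c : ℤ → ℂ)

theorem cube_sum (x : Torus) : cube (∑ k ∈ s, c k * fourier k x)
    = ∑ k₁ ∈ s, ∑ k₂ ∈ s, ∑ k₃ ∈ s, (c k₁ * conj (c k₂) * c k₃) * fourier (k₁ - k₂ + k₃) x := by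
  rw [cube_eq, map_sum, Finset.sum_mul_sum, Finset.sum_mul]
  refine Finset.sum_congr rfl fun k₁ _ => ?_
  rw [Finset.sum_mul]
  refine Finset.sum_congr rfl fun k₂ _ => ?_
  rw [Finset.mul_sum]
  refine Finset.sum_congr rfl fun k₃ _ => ?_
  rw [fourier_add, sub_eq_add_neg, fourier_add, fourier_neg, map_mul]; ring

theorem integrable_fourier_mul (a : ℂ) (m : ℤ) :
    Integrable (fun x : Torus => a * fourier m x) haarT :=
  (Continuous.integrable_of_hasCompactSupport (by fun_prop)
    (HasCompactSupport.of_compactSpace _))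

theorem cubicHat_tpoly (k : ℤ) : cubicHat (tpoly s c) k
    = ∑ k₁ ∈ s, ∑ k₂ ∈ s, ∑ k₃ ∈ s,
      if k = k₁ - k₂ + k₃ then c k₁ * conj (c k₂) * c k₃ else 0 := by
  have h1 : (fun x => cube ((tpoly s c : Torus → ℂ) x)) =ᵐ[haarT]
      ∑ k₁ ∈ s, ∑ k₂ ∈ s, ∑ k₃ ∈ s,
        fun x => (c k₁ * conj (c k₂) * c k₃) * fourier (k₁ - k₂ + k₃) x := by
    filter_upwards [tpoly_coe s c] with x hx
    rw [hx, cube_sum]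
    simp only [Finset.sum_apply]
  have i3 : ∀ k₁ k₂ k₃, Integrable
      (fun x : Torus => (c k₁ * conj (c k₂) * c k₃) * fourier (k₁ - k₂ + k₃) x) haarT :=
    fun k₁ k₂ k₃ => integrable_fourier_mul _ _
  have i2 : ∀ k₁ k₂, Integrable (∑ k₃ ∈ s,
      fun x : Torus => (c k₁ * conj (c k₂) * c k₃) * fourier (k₁ - k₂ + k₃) x) haarT :=
    fun k₁ k₂ => integrable_finsetSum' _ fun k₃ _ => i3 k₁ k₂ k₃
  have i1 : ∀ k₁, Integrable (∑ k₂ ∈ s, ∑ k₃ ∈ s,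
      fun x : Torus => (c k₁ * conj (c k₂) * c k₃) * fourier (k₁ - k₂ + k₃) x) haarT :=
    fun k₁ => integrable_finsetSum' _ fun k₂ _ => i2 k₁ k₂
  rw [cubicHat_eq, fourierCoeff_congr_ae h1, fourierCoeff.sum _ _ fun k₁ _ => i1 k₁,
    Finset.sum_apply]
  refine Finset.sum_congr rfl fun k₁ _ => ?_
  rw [fourierCoeff.sum _ _ fun k₂ _ => i2 k₁ k₂, Finset.sum_apply]
  refine Finset.sum_congr rfl fun k₂ _ => ?_
  rw [fourierCoeff.sum _ _ fun k₃ _ => i3 k₁ k₂ k₃, Finset.sum_apply]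
  refine Finset.sum_congr rfl fun k₃ _ => ?_
  rw [fourierCoeff.const_mul, fourierCoeff_fourier, Pi.single_apply]
  split_ifs <;> simp

theorem integral_mul_conj_tpoly {h : Torus → ℂ} (hh : Integrable h haarT) :
    ∫ x, h x * conj ((tpoly s c : Torus → ℂ) x) ∂haarT
      = ∑ k ∈ s, fourierCoeff h k * conj (c k) := by
  have h1 : (fun x => h x * conj ((tpoly s c : Torus → ℂ) x)) =ᵐ[haarT]
      fun x => ∑ k ∈ s, conj (c k) * (fourier (-k) x • h x) := by
    filter_upwards [tpoly_coe s c] with x hx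
    rw [hx, map_sum, Finset.mul_sum]
    refine Finset.sum_congr rfl fun k _ => ?_
    rw [map_mul, fourier_neg, smul_eq_mul]; ring
  rw [integral_congr_ae h1, integral_finsetSum _ fun k _ => (hh.fourier_smul (-k)).const_mul _]
  refine Finset.sum_congr rfl fun k _ => ?_
  rw [integral_const_mul, fourierCoeff, mul_comm]

theorem tpoly_bound : ∀ᵐ x ∂haarT, ‖(tpoly s c : Torus → ℂ) x‖ₑ ≤ ∑ k ∈ s, ‖c k‖ₑ := by
  filter_upwards [tpoly_coe s c] with x hx
  rw [hx]
  refine (enorm_sum_le _ _).trans (Finset.sum_le_sum fun k _ => ?_)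
  rw [enorm_mul, enorm_fourier, mul_one]

theorem q4_tpoly_ne_top : q4 (tpoly s c) ≠ ∞ := by
  have h : q4 (tpoly s c) ≤ ∫⁻ _, (∑ k ∈ s, ‖c k‖ₑ) ^ 4 ∂haarT :=
    lintegral_mono_ae ((tpoly_bound s c).mono fun x hx => by gcongr)
  refine ne_top_of_le_ne_top ?_ h
  rw [lintegral_const, measure_univ, mul_one]
  exact ENNReal.pow_ne_top (ENNReal.sum_ne_top.2 fun _ _ => enorm_ne_top)

theorem q4_tpoly : (q4 (tpoly s c)).toReal = (∑ k ∈ s, cubicHat (tpoly s c) k * conj (c k)).re := by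
  have h1 := integral_mul_conj_tpoly s c (integrable_cube (q3_ne_top (q4_tpoly_ne_top s c)))
  simp only [← cubicHat_eq] at h1
  rw [← h1]
  have h2 : ∀ x, cube ((tpoly s c : Torus → ℂ) x) * conj ((tpoly s c : Torus → ℂ) x)
      = ((‖(tpoly s c : Torus → ℂ) x‖ ^ 4 : ℝ) : ℂ) := by
    intro x
    rw [cube, mul_assoc, Complex.mul_conj, Complex.normSq_eq_norm_sq, ← Complex.ofReal_mul]
    congr 1; ring
  simp only [h2]
  have hm : AEStronglyMeasurable (fun x => ‖(tpoly s c : Torus → ℂ) x‖ ^ 4) haarT :=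
    (aestronglyMeasurable_coe _).norm.pow 4
  rw [integral_complex_ofReal, Complex.ofReal_re, integral_eq_lintegral_of_nonneg_ae
    (Eventually.of_forall fun x => by positivity) hm]
  congr 1
  refine lintegral_congr fun x => ?_
  rw [ENNReal.ofReal_pow (norm_nonneg _), ofReal_norm]

/-- The quartic sum dominates the fourth power of the `L⁴` norm. -/
theorem q4_tpoly_le_tsum {b : ℤ → ℝ≥0∞} (hb : ∀ k ∈ s, ‖c k‖ₑ ≤ b k) :
    q4 (tpoly s c) ≤ ∑' p, (∑' j, b j * b (p - j)) ^ 2 := by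
  classical
  set b' : ℤ → ℝ≥0∞ := fun k => if k ∈ s then b k else 0 with hb'
  have hle : ∀ k, b' k ≤ b k := fun k => by simp only [hb']; split_ifs <;> simp
  have e1 : q4 (tpoly s c) ≤ ∑ k ∈ s, ∑ k₁ ∈ s, ∑ k₂ ∈ s, ∑ k₃ ∈ s,
      if k = k₁ - k₂ + k₃ then b' k₁ * b' k₂ * b' k₃ * b' k else 0 := by
    rw [← ENNReal.ofReal_toReal (q4_tpoly_ne_top s c), q4_tpoly]
    calc _ ≤ ‖∑ k ∈ s, cubicHat (tpoly s c) k * conj (c k)‖ₑ := by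
          rw [← ofReal_norm]; exact ENNReal.ofReal_le_ofReal (Complex.re_le_norm _)
      _ ≤ _ := by
          refine (enorm_sum_le _ _).trans (Finset.sum_le_sum fun k hk => ?_)
          rw [cubicHat_tpoly, Finset.sum_mul]
          refine (enorm_sum_le _ _).trans (Finset.sum_le_sum fun k₁ h₁ => ?_)
          rw [Finset.sum_mul]
          refine (enorm_sum_le _ _).trans (Finset.sum_le_sum fun k₂ h₂ => ?_)
          rw [Finset.sum_mul]
          refine (enorm_sum_le _ _).trans (Finset.sum_le_sum fun k₃ h₃ => ?_)
          split_ifs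
          · rw [enorm_mul, enorm_mul, enorm_mul, RCLike.enorm_conj, RCLike.enorm_conj]
            simp only [hb', hk, h₁, h₂, h₃, if_true]
            gcongr
            · exact hb _ h₁
            · exact hb _ h₂
            · exact hb _ h₃
            · exact hb _ hk
          · simp
  have e2 : ∀ k k₁ : ℤ, (∑ k₂ ∈ s, ∑ k₃ ∈ s,
      if k = k₁ - k₂ + k₃ then b' k₁ * b' k₂ * b' k₃ * b' k else 0)
      ≤ ∑' k₂, b' k₁ * b' k₂ * b' (k - k₁ + k₂) * b' k := by
    intro k k₁
    refine le_trans (Finset.sum_le_sum fun k₂ _ => ?_) (ENNReal.sum_le_tsum s)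
    have : ∀ k₃, (k = k₁ - k₂ + k₃) ↔ (k₃ = k - k₁ + k₂) := fun k₃ => by omega
    simp only [this, Finset.sum_ite_eq']
    split_ifs
    · exact le_rfl
    · exact zero_le
  calc q4 (tpoly s c) ≤ ∑ k ∈ s, ∑ k₁ ∈ s, ∑' k₂, b' k₁ * b' k₂ * b' (k - k₁ + k₂) * b' k :=
        e1.trans (Finset.sum_le_sum fun k _ => Finset.sum_le_sum fun k₁ _ => e2 k k₁)
    _ ≤ ∑' k, ∑' k₁, ∑' k₂, b k₁ * b k₂ * b (k - k₁ + k₂) * b k := by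
        refine (Finset.sum_le_sum fun k _ => ENNReal.sum_le_tsum s).trans
          ((ENNReal.sum_le_tsum s).trans ?_)
        refine ENNReal.tsum_le_tsum fun k => ENNReal.tsum_le_tsum fun k₁ =>
          ENNReal.tsum_le_tsum fun k₂ => ?_
        gcongr <;> exact hle _
    -- The substitution `p = k + k₂` gives `k₁ + k₃ = p`: for fixed `p` the constraint decouples
    -- into two independent pairs, and the sum becomes a square.
    _ = ∑' k, ∑' p, ∑' k₁, b k₁ * b (p - k) * b (p - k₁) * b k := by
        refine tsum_congr fun k => ?_
        rw [ENNReal.tsum_comm (f := fun p k₁ => b k₁ * b (p - k) * b (p - k₁) * b k)]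
        refine tsum_congr fun k₁ => ?_
        rw [← (Equiv.subRight k).tsum_eq
          (fun k₂ => b k₁ * b k₂ * b (k - k₁ + k₂) * b k)]
        refine tsum_congr fun p => ?_
        simp only [Equiv.subRight_apply]
        rw [show k - k₁ + (p - k) = p - k₁ by ring]
    _ = ∑' p, ∑' k, ∑' k₁, b k₁ * b (p - k) * b (p - k₁) * b k := ENNReal.tsum_comm
    _ = _ := by
        refine tsum_congr fun p => ?_
        rw [sq, ← ENNReal.tsum_mul_right]
        refine tsum_congr fun k => ?_
        rw [← ENNReal.tsum_mul_left]
        exact tsum_congr fun k₁ => by ring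

end Polynomials

/-- The Sobolev embedding `H^{3/8} ⊂ L⁴` for trigonometric polynomials. -/
theorem exists_q4_tpoly_le : ∃ C : ℝ≥0∞, C ≠ ∞ ∧ ∀ (s : Finset ℤ) (c : ℤ → ℂ) (X : ℝ≥0∞),
    ∑ k ∈ s, (ENNReal.ofReal (jb k ^ (3 / 8 : ℝ)) * ‖c k‖ₑ) ^ 2 ≤ X → q4 (tpoly s c) ≤ C * X ^ 2 := by
  classical
  refine ⟨2 * (ENNReal.ofReal (2 ^ (3 / 2 : ℝ)) * brSum (3 / 2)), ?_, fun s c X hX => ?_⟩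
  · have := brSum_ne_top (t := 3 / 2) (by norm_num)
    finiteness
  set b : ℤ → ℝ≥0∞ := fun k => if k ∈ s then ‖c k‖ₑ else 0 with hb
  set v : ℤ → ℝ≥0∞ := fun k => ENNReal.ofReal (jb k ^ (-(3 / 8) : ℝ)) with hv
  set w : ℤ → ℝ≥0∞ := fun k => ENNReal.ofReal (jb k ^ (3 / 8 : ℝ)) * b k with hw
  have hbw : ∀ k, b k = w k * v k := fun k => by
    simp only [hw, hv]
    rw [mul_right_comm, ← ENNReal.ofReal_mul (Real.rpow_nonneg (jb_pos k).le _),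
      ← Real.rpow_add (jb_pos k)]
    norm_num
  have hw2 : ∑' k, w k ^ 2 ≤ X := by
    refine le_trans (le_of_eq ?_) hX
    rw [tsum_eq_sum (s := s)]
    · exact Finset.sum_congr rfl fun k hk => by simp only [hw, hb, hk, if_true]
    · intro k hk; simp [hw, hb, hk]
  have hv2 : ∑' k, v k ^ 4 ≤ ENNReal.ofReal (2 ^ (3 / 2 : ℝ)) * brSum (3 / 2) := by
    rw [brSum, ← ENNReal.tsum_mul_left]
    refine ENNReal.tsum_le_tsum fun k => ?_
    have := jb_pos k
    rw [← ENNReal.ofReal_pow (by positivity), ← ENNReal.ofReal_mul (by positivity)]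
    refine ENNReal.ofReal_le_ofReal ?_
    rw [← Real.rpow_natCast, ← Real.rpow_mul (jb_pos k).le]
    calc jb k ^ (-(3 / 8) * ((4 : ℕ) : ℝ)) = jb k ^ (-(3 / 2) : ℝ) := by norm_num
      _ ≤ (br k / 2) ^ (-(3 / 2) : ℝ) :=
        Real.rpow_le_rpow_of_nonpos (by have := br_pos k; positivity)
          (by linarith [br_le_two_mul_jb k]) (by norm_num)
      _ = _ := by
        rw [Real.div_rpow (br_pos k).le (by norm_num), Real.rpow_neg (by norm_num : (0:ℝ) ≤ 2)]
        field_simp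
  refine (q4_tpoly_le_tsum s c (b := b) fun k hk => by simp [hb, hk]).trans ?_
  -- Cauchy–Schwarz in `j`; the sum of `(v j * v (p - j))²` is bounded uniformly in `p` because
  -- `⟨k⟩^{-3/2}` is summable.
  have key : ∀ p, (∑' j, b j * b (p - j)) ^ 2 ≤ (∑' j, (w j * w (p - j)) ^ 2)
      * (2 * (ENNReal.ofReal (2 ^ (3 / 2 : ℝ)) * brSum (3 / 2))) := by
    intro p
    have h1 : ∀ j, b j * b (p - j) = (w j * w (p - j)) * (v j * v (p - j)) := fun j => by
      rw [hbw, hbw]; ring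
    simp only [h1]
    refine (ennreal_tsum_mul_sq_le _ _).trans (mul_le_mul' le_rfl ?_)
    calc ∑' j, (v j * v (p - j)) ^ 2 ≤ ∑' j, (v j ^ 4 + v (p - j) ^ 4) := by
          refine ENNReal.tsum_le_tsum fun j => ?_
          have := ennreal_mul_le_sq_add_sq (v j ^ 2) (v (p - j) ^ 2)
          calc _ = v j ^ 2 * v (p - j) ^ 2 := by ring
            _ ≤ _ := this
            _ = _ := by ring
      _ ≤ _ := by
          rw [ENNReal.tsum_add, two_mul]
          exact add_le_add hv2 ((ennreal_tsum_comp_le sub_right_injective (fun k => v k ^ 4)).trans hv2)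
  calc _ ≤ ∑' p, (∑' j, (w j * w (p - j)) ^ 2)
      * (2 * (ENNReal.ofReal (2 ^ (3 / 2 : ℝ)) * brSum (3 / 2))) := ENNReal.tsum_le_tsum key
    _ = (∑' j, w j ^ 2 * ∑' p, w (p - j) ^ 2)
        * (2 * (ENNReal.ofReal (2 ^ (3 / 2 : ℝ)) * brSum (3 / 2))) := by
        rw [ENNReal.tsum_mul_right, ENNReal.tsum_comm]
        simp_rw [mul_pow, ENNReal.tsum_mul_left]
    _ ≤ (∑' j, w j ^ 2 * X) * (2 * (ENNReal.ofReal (2 ^ (3 / 2 : ℝ)) * brSum (3 / 2))) := by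
        gcongr with j
        exact (ennreal_tsum_comp_le (sub_left_injective) (fun k => w k ^ 2)).trans hw2
    _ ≤ X * X * (2 * (ENNReal.ofReal (2 ^ (3 / 2 : ℝ)) * brSum (3 / 2))) := by
        rw [ENNReal.tsum_mul_right]; gcongr
    _ = _ := by ring

end

/-! ### The nonlinearity in `H^{-3/8}`; measurability in time -/

section

/-- A weighted Young inequality, obtained by comparing `b` with `m * a`; the free weight `m` is
later used for optimization and for absorption. -/
theorem pow_three_mul_le (a b : ℝ≥0∞) {m : ℝ≥0∞} (hm : m ≠ 0) (hm' : m ≠ ∞) :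
    a ^ 3 * b ≤ m * a ^ 4 + (m ^ 3)⁻¹ * b ^ 4 := by
  rcases le_total b (m * a) with h | h
  · calc a ^ 3 * b ≤ a ^ 3 * (m * a) := by gcongr
      _ = m * a ^ 4 := by ring
      _ ≤ _ := le_self_add
  · have ha : a ≤ m⁻¹ * b := by
      calc a = m⁻¹ * (m * a) := by rw [← mul_assoc, ENNReal.inv_mul_cancel hm hm', one_mul]
        _ ≤ _ := by gcongr
    calc a ^ 3 * b ≤ (m⁻¹ * b) ^ 3 * b := by gcongr
      _ = (m ^ 3)⁻¹ * b ^ 4 := by rw [mul_pow, ENNReal.inv_pow]; ring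
      _ ≤ _ := le_add_self

/-- The cubic nonlinearity of an `L⁴` function lies in `H^{-3/8}`. -/
theorem exists_cubicHat_weighted_le : ∃ C : ℝ≥0∞, C ≠ ∞ ∧ ∀ f : L2, q4 f ≠ ∞ →
    ∑' k, (ENNReal.ofReal (jb k ^ (-(3 / 8) : ℝ)) * ‖cubicHat f k‖ₑ) ^ 2 ≤ (q4 f + C) ^ 2 := by
  obtain ⟨C, hC, hS⟩ := exists_q4_tpoly_le
  refine ⟨C, hC, fun f hf => ?_⟩
  rw [ENNReal.tsum_eq_iSup_sum]
  refine iSup_le fun s => ?_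
  set N := cubicHat f
  -- Duality: the test polynomial with coefficients `⟨k⟩^{-3/4}N k` pairs with the nonlinearity to
  -- give `Y`, and its squared `H^{3/8}` norm is again `Y`.
  set c : ℤ → ℂ := fun k => ((jb k ^ (-(3 / 4) : ℝ) : ℝ) : ℂ) * N k with hc
  set Y : ℝ := ∑ k ∈ s, jb k ^ (-(3 / 4) : ℝ) * ‖N k‖ ^ 2 with hY
  have hjp : ∀ (k : ℤ) (t : ℝ), 0 ≤ jb k ^ t := fun k t => Real.rpow_nonneg (jb_pos k).le _
  have hY0 : 0 ≤ Y := Finset.sum_nonneg fun k _ => mul_nonneg (hjp _ _) (sq_nonneg _)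
  have e1 : ∑ k ∈ s, (ENNReal.ofReal (jb k ^ (-(3 / 8) : ℝ)) * ‖N k‖ₑ) ^ 2 = ENNReal.ofReal Y := by
    rw [hY, ENNReal.ofReal_sum_of_nonneg fun k _ => mul_nonneg (hjp _ _) (sq_nonneg _)]
    refine Finset.sum_congr rfl fun k _ => ?_
    rw [← ofReal_norm, ← ENNReal.ofReal_mul (hjp _ _), ← ENNReal.ofReal_pow
      (mul_nonneg (hjp _ _) (norm_nonneg _)), mul_pow, ← Real.rpow_natCast,
      ← Real.rpow_mul (jb_pos k).le]
    norm_num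
  have e2 : ∑ k ∈ s, (ENNReal.ofReal (jb k ^ (3 / 8 : ℝ)) * ‖c k‖ₑ) ^ 2 ≤ ENNReal.ofReal Y := by
    rw [← e1]
    refine le_of_eq (Finset.sum_congr rfl fun k _ => ?_)
    simp only [hc]
    rw [enorm_mul, ← mul_assoc, ← ofReal_norm, Complex.norm_real, Real.norm_of_nonneg (hjp _ _),
      ← ENNReal.ofReal_mul (hjp _ _), ← Real.rpow_add (jb_pos k)]
    norm_num
  have e3 : (Y : ℂ) = ∫ x, cube (f x) * conj ((tpoly s c : Torus → ℂ) x) ∂haarT := by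
    rw [integral_mul_conj_tpoly s c (integrable_cube (q3_ne_top hf)), hY, Complex.ofReal_sum]
    refine Finset.sum_congr rfl fun k _ => ?_
    simp only [hc]
    rw [← cubicHat_eq, map_mul, Complex.conj_ofReal, mul_left_comm, Complex.mul_conj,
      Complex.normSq_eq_norm_sq, ← Complex.ofReal_mul]
  have e4 : ∀ m : ℝ≥0∞, m ≠ 0 → m ≠ ∞ →
      ENNReal.ofReal Y ≤ m * q4 f + (m ^ 3)⁻¹ * (C * ENNReal.ofReal Y ^ 2) := by
    intro m hm hm'
    calc ENNReal.ofReal Y = ‖(Y : ℂ)‖ₑ := by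
          rw [← ofReal_norm, Complex.norm_real, Real.norm_of_nonneg hY0]
      _ ≤ ∫⁻ x, ‖(f : Torus → ℂ) x‖ₑ ^ 3 * ‖(tpoly s c : Torus → ℂ) x‖ₑ ∂haarT := by
          rw [e3]
          refine (enorm_integral_le_lintegral_enorm _).trans (le_of_eq (lintegral_congr fun x => ?_))
          rw [enorm_mul, enorm_cube, RCLike.enorm_conj]
      _ ≤ ∫⁻ x, (m * ‖(f : Torus → ℂ) x‖ₑ ^ 4
            + (m ^ 3)⁻¹ * ‖(tpoly s c : Torus → ℂ) x‖ₑ ^ 4) ∂haarT :=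
          lintegral_mono fun x => pow_three_mul_le _ _ hm hm'
      _ = m * q4 f + (m ^ 3)⁻¹ * q4 (tpoly s c) := by
          rw [lintegral_add_left' (((aestronglyMeasurable_coe f).enorm.pow_const 4).const_mul m),
            lintegral_const_mul' _ _ hm', lintegral_const_mul' _ _ (by finiteness)]
          rfl
      _ ≤ _ := by gcongr; exact hS s c _ e2
  rw [e1]
  rcases hY0.eq_or_lt with h0 | h0
  · rw [← h0]; simp
  -- With the weight `m = √Y` the estimate reads `ξ² ≤ ξ · q4 f + C ξ`, and one factor `ξ` cancels.
  set ξ := ENNReal.ofReal (Real.sqrt Y) with hξ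
  have hξ0 : ξ ≠ 0 := by simp [hξ, Real.sqrt_pos.2 h0]
  have hξ1 : ξ ≠ ∞ := ENNReal.ofReal_ne_top
  have hξ2 : ENNReal.ofReal Y = ξ ^ 2 := by
    rw [hξ, ← ENNReal.ofReal_pow (Real.sqrt_nonneg _), Real.sq_sqrt hY0]
  have h := e4 ξ hξ0 hξ1
  rw [hξ2] at h ⊢
  have h' : ξ * ξ ≤ ξ * (q4 f + C) := by
    calc ξ * ξ = ξ ^ 2 := by ring
      _ ≤ _ := h
      _ = ξ * q4 f + ((ξ ^ 3)⁻¹ * ξ ^ 3) * (C * ξ) := by ring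
      _ = _ := by
        rw [ENNReal.inv_mul_cancel (by positivity) (by finiteness)]; ring
  exact pow_le_pow_left' ((ENNReal.mul_le_mul_iff_right hξ0 hξ1).1 h') 2

/-- Truncation of the modulus at height `n`. -/
theorem lipschitzWith_min_sq (n : ℕ) :
    LipschitzWith (2 * n) fun z : ℂ => (min ‖z‖ n) ^ 2 := by
  refine LipschitzWith.of_dist_le_mul fun z w => ?_
  rw [Real.dist_eq]
  have h1 : |min ‖z‖ (n : ℝ) - min ‖w‖ (n : ℝ)| ≤ dist z w := by
    rw [dist_eq_norm]
    refine (abs_min_sub_min_le_max _ _ _ _).trans ?_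
    rw [sub_self, abs_zero]
    exact max_le (abs_norm_sub_norm_le z w) (norm_nonneg _)
  have h2 : 0 ≤ min ‖z‖ (n : ℝ) := le_min (norm_nonneg _) (Nat.cast_nonneg _)
  have h3 : 0 ≤ min ‖w‖ (n : ℝ) := le_min (norm_nonneg _) (Nat.cast_nonneg _)
  have h4 : min ‖z‖ (n : ℝ) ≤ n := min_le_right _ _
  have h5 : min ‖w‖ (n : ℝ) ≤ n := min_le_right _ _
  rw [sq_sub_sq, abs_mul, abs_of_nonneg (add_nonneg h2 h3)]
  push_cast
  exact mul_le_mul (by linarith) h1 (abs_nonneg _) (by positivity)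

/-- Truncating the modulus makes the cubic map globally Lipschitz, hence continuous on `L²`. For
`‖w‖ ≤ ‖z‖` the two truncated moduli coincide as soon as `‖w‖ ≥ n`; otherwise `‖w‖ ≤ n` bounds the
extra factor. -/
theorem lipschitzWith_min_sq_mul (n : ℕ) :
    LipschitzWith (3 * n ^ 2) fun z : ℂ => (((min ‖z‖ n) ^ 2 : ℝ) : ℂ) * z := by
  have key : ∀ z w : ℂ, ‖w‖ ≤ ‖z‖ →
      ‖(((min ‖z‖ n) ^ 2 : ℝ) : ℂ) * z - (((min ‖w‖ n) ^ 2 : ℝ) : ℂ) * w‖ ≤ 3 * n ^ 2 * ‖z - w‖ := by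
    intro z w hzw
    have e : (((min ‖z‖ n) ^ 2 : ℝ) : ℂ) * z - (((min ‖w‖ n) ^ 2 : ℝ) : ℂ) * w
        = (((min ‖z‖ n) ^ 2 : ℝ) : ℂ) * (z - w)
          + (((min ‖z‖ n) ^ 2 - (min ‖w‖ n) ^ 2 : ℝ) : ℂ) * w := by push_cast; ring
    have h2 : 0 ≤ min ‖z‖ (n : ℝ) := le_min (norm_nonneg _) (Nat.cast_nonneg _)
    have h4 : min ‖z‖ (n : ℝ) ≤ n := min_le_right _ _
    have h1 : |(min ‖z‖ n) ^ 2 - (min ‖w‖ n) ^ 2| * ‖w‖ ≤ 2 * n ^ 2 * ‖z - w‖ := by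
      rcases le_total (n : ℝ) ‖w‖ with h | h
      · rw [min_eq_right h, min_eq_right (h.trans hzw), sub_self, abs_zero, zero_mul]; positivity
      · have := (lipschitzWith_min_sq n).dist_le_mul z w
        rw [Real.dist_eq, dist_eq_norm] at this
        push_cast at this
        calc _ ≤ (2 * n * ‖z - w‖) * n := mul_le_mul this h (norm_nonneg _) (by positivity)
          _ = _ := by ring
    rw [e]
    refine (norm_add_le _ _).trans ?_
    rw [norm_mul, norm_mul, Complex.norm_real, Complex.norm_real, Real.norm_eq_abs, Real.norm_eq_abs,
      abs_of_nonneg (sq_nonneg (min ‖z‖ (n : ℝ)))]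
    have h6 : (min ‖z‖ (n : ℝ)) ^ 2 * ‖z - w‖ ≤ n ^ 2 * ‖z - w‖ := by gcongr
    linarith
  refine LipschitzWith.of_dist_le_mul fun z w => ?_
  rw [dist_eq_norm, dist_eq_norm, show ((3 * n ^ 2 : NNReal) : ℝ) = 3 * n ^ 2 by push_cast; rfl]
  rcases le_total ‖w‖ ‖z‖ with h | h
  · exact key z w h
  · rw [norm_sub_rev, norm_sub_rev z w]; exact key w z h

/-- Each term is a continuous function of `f ∈ L²`, so `q4` is lower semicontinuous on `L²`. This
makes it measurable along continuous curves and compatible with Fatou's lemma. -/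
theorem q4_eq_iSup (f : L2) : q4 f = ⨆ n : ℕ,
    ‖(lipschitzWith_min_sq n).compLp (by simp) f‖ₑ ^ 2 := by
  have h1 : ∀ n : ℕ, ‖(lipschitzWith_min_sq n).compLp (by simp) f‖ₑ ^ 2
      = ∫⁻ x, ENNReal.ofReal ((min ‖(f : Torus → ℂ) x‖ n) ^ 4) ∂haarT := by
    intro n
    rw [enorm_sq_eq_lintegral]
    refine lintegral_congr_ae ?_
    filter_upwards [(lipschitzWith_min_sq n).coeFn_compLp (by simp) f] with x hx
    rw [hx, ← ofReal_norm, ← ENNReal.ofReal_pow (norm_nonneg _)]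
    congr 1
    simp only [Function.comp_apply, Real.norm_eq_abs, sq_abs]
    ring
  simp only [h1]
  rw [← lintegral_iSup']
  · refine lintegral_congr fun x => ?_
    refine le_antisymm ?_ (iSup_le fun n => ?_)
    · obtain ⟨n, hn⟩ := exists_nat_ge ‖(f : Torus → ℂ) x‖
      refine le_trans ?_ (le_iSup _ n)
      rw [min_eq_left hn, ENNReal.ofReal_pow (norm_nonneg _), ofReal_norm]
    · rw [← ofReal_norm, ← ENNReal.ofReal_pow (norm_nonneg _)]
      refine ENNReal.ofReal_le_ofReal (pow_le_pow_left₀ ?_ (min_le_left _ _) 4)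
      exact le_min (norm_nonneg _) (Nat.cast_nonneg _)
  · intro n
    exact (((aestronglyMeasurable_coe f).norm.aemeasurable.min aemeasurable_const).pow_const
      4).ennreal_ofReal
  · refine Eventually.of_forall fun x m n hmn => ENNReal.ofReal_le_ofReal ?_
    refine pow_le_pow_left₀ (le_min (norm_nonneg _) (Nat.cast_nonneg _)) ?_ 4
    exact min_le_min le_rfl (by exact_mod_cast hmn)

theorem lowerSemicontinuous_q4 : LowerSemicontinuous q4 := by
  have : q4 = fun f => ⨆ n : ℕ, ‖(lipschitzWith_min_sq n).compLp (by simp) f‖ₑ ^ 2 :=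
    funext q4_eq_iSup
  rw [this]
  refine lowerSemicontinuous_iSup fun n => Continuous.lowerSemicontinuous ?_
  exact (ENNReal.continuous_pow 2).comp
    (LipschitzWith.continuous_compLp (lipschitzWith_min_sq n) (by simp)).enorm

theorem measurable_q4_comp {U : ℝ → L2} (hU : Continuous U) : Measurable fun r => q4 (U r) :=
  (lowerSemicontinuous_q4.comp hU).measurable

theorem q4_le_liminf {f : L2} {F : ℕ → L2} (h : Tendsto F atTop (𝓝 f)) :
    q4 f ≤ liminf (fun n => q4 (F n)) atTop := by
  have h1 := lowerSemicontinuous_q4.le_liminf f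
  refine h1.trans ?_
  rw [liminf_eq, liminf_eq]
  refine sSup_le_sSup fun a ha => ?_
  exact h.eventually ha

/-- Dominated convergence with majorant `|f|³`; at each point the truncated sequence is eventually
constant. It exhibits `cubicHat` along a continuous curve as a limit of continuous functions of
time. -/
theorem tendsto_hat_truncation {f : L2} (hf : q4 f ≠ ∞) (k : ℤ) :
    Tendsto (fun n : ℕ => hat ((lipschitzWith_min_sq_mul n).compLp (by simp) f) k) atTop
      (𝓝 (cubicHat f k)) := by
  have h1 : ∀ n : ℕ, hat ((lipschitzWith_min_sq_mul n).compLp (by simp) f) k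
      = ∫ x, fourier (-k) x • ((((min ‖(f : Torus → ℂ) x‖ n) ^ 2 : ℝ) : ℂ) * f x) ∂haarT := by
    intro n
    rw [hat, fourierCoeff]
    refine integral_congr_ae ?_
    filter_upwards [(lipschitzWith_min_sq_mul n).coeFn_compLp (by simp) f] with x hx
    rw [hx]; rfl
  simp only [h1]
  rw [cubicHat_eq, fourierCoeff]
  refine tendsto_integral_of_dominated_convergence (fun x => ‖cube (f x)‖) (fun n => ?_)
    (integrable_cube (q3_ne_top hf)).norm (fun n => ?_) ?_
  · refine ((map_continuous (fourier (-k))).aestronglyMeasurable).smul ?_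
    exact (lipschitzWith_min_sq_mul n).continuous.comp_aestronglyMeasurable
      (aestronglyMeasurable_coe f)
  · refine Eventually.of_forall fun x => ?_
    rw [norm_smul, fourier_apply, Circle.norm_coe, one_mul, cube, norm_mul, norm_mul,
      Complex.norm_real, Complex.norm_real, Real.norm_of_nonneg (sq_nonneg _),
      Real.norm_of_nonneg (sq_nonneg _)]
    have : 0 ≤ min ‖(f : Torus → ℂ) x‖ (n : ℝ) := le_min (norm_nonneg _) (Nat.cast_nonneg _)
    gcongr
    exact min_le_left _ _
  · refine Eventually.of_forall fun x => tendsto_const_nhds.congr' ?_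
    obtain ⟨n, hn⟩ := exists_nat_ge ‖(f : Torus → ℂ) x‖
    filter_upwards [eventually_ge_atTop n] with m hm
    rw [min_eq_left (hn.trans (by exact_mod_cast hm)), cube]

theorem aestronglyMeasurable_cubicHat {U : ℝ → L2} (hU : Continuous U) {μ : Measure ℝ}
    (h : ∀ᵐ r ∂μ, q4 (U r) ≠ ∞) (k : ℤ) :
    AEStronglyMeasurable (fun r => cubicHat (U r) k) μ := by
  refine aestronglyMeasurable_of_tendsto_ae atTop
    (f := fun (n : ℕ) r => hat ((lipschitzWith_min_sq_mul n).compLp (by simp) (U r)) k)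
    (fun n => ?_) (h.mono fun r hr => tendsto_hat_truncation hr k)
  exact ((continuous_hat k).comp
    ((LipschitzWith.continuous_compLp (lipschitzWith_min_sq_mul n) (by simp)).comp
      hU)).aestronglyMeasurable

end

/-! ### The interaction representation and sums of time integrals -/

section

/-- The coefficients of `W` in the interaction representation, for the reversed time `r = -t`. -/
def osc (β : ℝ) (W : ℝ → L2) (k : ℤ) (r : ℝ) : ℂ :=
  Complex.exp (-(Complex.I * (r * disp β k : ℝ))) * hat (W r) k

theorem enorm_osc (β : ℝ) (W : ℝ → L2) (k : ℤ) (r : ℝ) : ‖osc β W k r‖ₑ = ‖hat (W r) k‖ₑ := by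
  rw [osc, enorm_mul, ← ofReal_norm, norm_cexp_neg_I_mul, ENNReal.ofReal_one, one_mul]

/-- On `k = k₁ - k₂ + k₃` the resonance function of the dispersion relation factorizes. This is why
products of four coefficients carry exactly the oscillation `e^{-irΦ}`. -/
theorem phase_eq_disp (β : ℝ) (q : Freq) : phase β q.k₁ q.k₂ q.k₃
    = disp β q.k - disp β q.k₁ + disp β q.k₂ - disp β q.k₃ := by
  have := q.sum_eq
  simp only [phase, disp, this]; push_cast; ring

/-- The quadrilinear product of coefficients. -/
def quadProd (f : L2) (q : Freq) : ℂ :=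
  hat f q.k₁ * conj (hat f q.k₂) * hat f q.k₃ * conj (hat f q.k)

theorem quadProd_eq_osc (β : ℝ) (W : ℝ → L2) (q : Freq) (r : ℝ) : quadProd (W r) q
    = Complex.exp (-(Complex.I * (r * phase β q.k₁ q.k₂ q.k₃ : ℝ)))
      * (osc β W q.k₁ r * conj (osc β W q.k₂ r) * osc β W q.k₃ r * conj (osc β W q.k r)) := by
  simp only [osc, map_mul, ← Complex.exp_conj, map_neg, Complex.conj_I, Complex.conj_ofReal]
  rw [phase_eq_disp, quadProd]
  have : Complex.exp (-(Complex.I * (r * (disp β q.k - disp β q.k₁ + disp β q.k₂ - disp β q.k₃) : ℝ)))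
      * (Complex.exp (-(Complex.I * (r * disp β q.k₁ : ℝ)))
        * Complex.exp (-(-Complex.I * (r * disp β q.k₂ : ℝ)))
        * Complex.exp (-(Complex.I * (r * disp β q.k₃ : ℝ)))
        * Complex.exp (-(-Complex.I * (r * disp β q.k : ℝ)))) = 1 := by
    rw [← Complex.exp_add, ← Complex.exp_add, ← Complex.exp_add, ← Complex.exp_add,
      ← Complex.exp_zero]
    congr 1; push_cast; ring
  linear_combination (-(hat (W r) q.k₁ * conj (hat (W r) q.k₂) * hat (W r) q.k₃
    * conj (hat (W r) q.k))) * this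

/-- The time integral of the quadrilinear product. -/
def quadInt (W : ℝ → L2) (a b : ℝ) (q : Freq) : ℂ := ∫ r in a..b, quadProd (W r) q

theorem continuous_quadProd {W : ℝ → L2} (hW : Continuous W) (q : Freq) :
    Continuous fun r => quadProd (W r) q := by
  have h : ∀ k, Continuous fun r => hat (W r) k := fun k => (continuous_hat k).comp hW
  have hc : ∀ k, Continuous fun r => conj (hat (W r) k) := fun k =>
    Complex.continuous_conj.comp (h k)
  exact (((h _).mul (hc _)).mul (h _)).mul (hc _)

/-- The differentiated quadrilinear product is a sum of four terms. -/
def quadDeriv (A B : ℤ → ℝ≥0∞) (q : Freq) : ℝ≥0∞ :=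
  A q.k * B q.k₁ * B q.k₂ * B q.k₃ + A q.k₁ * B q.k * B q.k₂ * B q.k₃
    + A q.k₂ * B q.k * B q.k₁ * B q.k₃ + A q.k₃ * B q.k * B q.k₁ * B q.k₂

theorem Freq.injective_coords : Function.Injective fun q : Freq => (q.k₁, q.k₂, q.k₃) := fun q q' h => by
  simp only [Prod.mk.injEq] at h
  exact ext' (by rw [q.sum_eq, q'.sum_eq, h.1, h.2.1, h.2.2]) h.1 h.2.1 h.2.2

section Sum

variable {β : ℝ} {W : ℝ → L2} {d : ℤ → ℝ → ℂ} {a b : ℝ}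

theorem hasIntDeriv_quad_osc (hab : a < b) (hd : ∀ k, HasIntDeriv (osc β W k) (d k) a b)
    (q : Freq) : ∃ D : ℝ → ℂ, HasIntDeriv
      (fun r => osc β W q.k₁ r * conj (osc β W q.k₂ r) * osc β W q.k₃ r * conj (osc β W q.k r)) D a b
      ∧ ∀ r, ‖D r‖ₑ ≤ quadDeriv (fun k => ‖d k r‖ₑ) (fun k => ‖hat (W r) k‖ₑ) q := by
  refine ⟨_, HasIntDeriv.quad hab.le (hd q.k) (hd q.k₁) (hd q.k₂) (hd q.k₃), fun r => ?_⟩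
  refine (enorm_add_le _ _).trans ?_
  rw [enorm_mul]
  refine (add_le_add (mul_le_mul' (enorm_add_le _ _) le_rfl) le_rfl).trans ?_
  rw [enorm_mul]
  refine (add_le_add (mul_le_mul' (add_le_add (mul_le_mul' (enorm_add_le _ _) le_rfl) le_rfl)
    le_rfl) le_rfl).trans (le_of_eq ?_)
  simp only [enorm_mul, RCLike.enorm_conj, enorm_osc, quadDeriv]
  ring

theorem enorm_quad_osc (q : Freq) (r : ℝ) :
    ‖osc β W q.k₁ r * conj (osc β W q.k₂ r) * osc β W q.k₃ r * conj (osc β W q.k r)‖ₑ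
      = ‖hat (W r) q.k‖ₑ * ‖hat (W r) q.k₁‖ₑ * ‖hat (W r) q.k₂‖ₑ * ‖hat (W r) q.k₃‖ₑ := by
  simp only [enorm_mul, RCLike.enorm_conj, enorm_osc]; ring

theorem aemeasurable_quadDeriv (hab : a < b) (hW : Continuous W)
    (hd : ∀ k, HasIntDeriv (osc β W k) (d k) a b) (q : Freq) :
    AEMeasurable (fun r => quadDeriv (fun k => ‖d k r‖ₑ) (fun k => ‖hat (W r) k‖ₑ) q)
      (volume.restrict (Set.Ioc a b)) := by
  have h1 : ∀ k, AEMeasurable (fun r => ‖d k r‖ₑ) (volume.restrict (Set.Ioc a b)) := fun k =>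
    ((intervalIntegrable_iff_integrableOn_Ioc_of_le hab.le).1 (hd k).int).aestronglyMeasurable.enorm
  have h2 : ∀ k, AEMeasurable (fun r => ‖hat (W r) k‖ₑ) (volume.restrict (Set.Ioc a b)) := fun k =>
    ((continuous_hat k).comp hW).enorm.measurable.aemeasurable
  unfold quadDeriv
  exact ((((((h1 _).mul (h2 _)).mul (h2 _)).mul (h2 _)).add
    ((((h1 _).mul (h2 _)).mul (h2 _)).mul (h2 _))).add
    ((((h1 _).mul (h2 _)).mul (h2 _)).mul (h2 _))).add
    ((((h1 _).mul (h2 _)).mul (h2 _)).mul (h2 _))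

theorem quadInt_eq_osc (q : Freq) : quadInt W a b q
    = ∫ r in a..b, Complex.exp (-(Complex.I * (r * phase β q.k₁ q.k₂ q.k₃ : ℝ)))
      * (osc β W q.k₁ r * conj (osc β W q.k₂ r) * osc β W q.k₃ r * conj (osc β W q.k r)) := by
  rw [quadInt]
  exact intervalIntegral.integral_congr fun r _ => quadProd_eq_osc β W q r

open Freq in
/-- Summation of a termwise estimate obtained by integration by parts in time. -/
theorem tsum_quadInt_le (hab : a < b) (hW : Continuous W)
    (hd : ∀ k, HasIntDeriv (osc β W k) (d k) a b) {w ω : Freq → ℝ≥0∞} (hω : Invariant ω)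
    {κ K : ℝ≥0∞} {G : ℝ → ℝ≥0∞}
    (hterm : ∀ q, w q * ‖quadInt W a b q‖ₑ ≤ κ * (ω q * (ENNReal.ofReal (b - a)⁻¹
      * (∫⁻ r in Set.Ioc a b,
        ‖hat (W r) q.k‖ₑ * ‖hat (W r) q.k₁‖ₑ * ‖hat (W r) q.k₂‖ₑ * ‖hat (W r) q.k₃‖ₑ)
      + (‖hat (W a) q.k‖ₑ * ‖hat (W a) q.k₁‖ₑ * ‖hat (W a) q.k₂‖ₑ * ‖hat (W a) q.k₃‖ₑ
      + ‖hat (W b) q.k‖ₑ * ‖hat (W b) q.k₁‖ₑ * ‖hat (W b) q.k₂‖ₑ * ‖hat (W b) q.k₃‖ₑ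
      + ∫⁻ r in Set.Ioc a b, quadDeriv (fun k => ‖d k r‖ₑ) (fun k => ‖hat (W r) k‖ₑ) q))))
    (hK : ∀ r ∈ Set.Icc a b, quadSum ω (fun k => ‖hat (W r) k‖ₑ) (fun k => ‖hat (W r) k‖ₑ) ≤ K)
    (hG : ∀ᵐ r ∂volume.restrict (Set.Ioc a b),
      quadSum ω (fun k => ‖d k r‖ₑ) (fun k => ‖hat (W r) k‖ₑ) ≤ G r) :
    ∑' q, w q * ‖quadInt W a b q‖ₑ ≤ κ * (3 * K + 4 * ∫⁻ r in Set.Ioc a b, G r) := by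
  set P : ℝ → Freq → ℝ≥0∞ := fun r q =>
    ‖hat (W r) q.k‖ₑ * ‖hat (W r) q.k₁‖ₑ * ‖hat (W r) q.k₂‖ₑ * ‖hat (W r) q.k₃‖ₑ with hP
  have : Countable Freq := injective_coords.countable
  have hl : 0 < b - a := sub_pos.2 hab
  have hmeas : ∀ k, Measurable (fun r => ‖hat (W r) k‖ₑ) := fun k =>
    ((continuous_hat k).comp hW).enorm.measurable
  have hPm : ∀ q, AEMeasurable (fun r => P r q) (volume.restrict (Set.Ioc a b)) := fun q =>
    ((((hmeas _).mul (hmeas _)).mul (hmeas _)).mul (hmeas _)).aemeasurable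
  have hPK : ∀ r ∈ Set.Icc a b, ∑' q, ω q * P r q ≤ K := hK
  have t1 : ∑' q, ω q * (ENNReal.ofReal (b - a)⁻¹ * ∫⁻ r in Set.Ioc a b, P r q) ≤ K := by
    calc _ = ENNReal.ofReal (b - a)⁻¹ * ∑' q, ∫⁻ r in Set.Ioc a b, ω q * P r q := by
          rw [← ENNReal.tsum_mul_left]
          refine tsum_congr fun q => ?_
          rw [lintegral_const_mul'' _ (hPm q)]; ring
      _ = ENNReal.ofReal (b - a)⁻¹ * ∫⁻ r in Set.Ioc a b, ∑' q, ω q * P r q := by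
          rw [lintegral_tsum fun q => (hPm q).const_mul _]
      _ ≤ ENNReal.ofReal (b - a)⁻¹ * ∫⁻ _ in Set.Ioc a b, K := by
          refine mul_le_mul' le_rfl (setLIntegral_mono measurable_const fun r hr => ?_)
          exact hPK r ⟨hr.1.le, hr.2⟩
      _ = K := by
          rw [setLIntegral_const, Real.volume_Ioc, mul_comm K, ← mul_assoc,
            ← ENNReal.ofReal_mul (by positivity), inv_mul_cancel₀ hl.ne']
          simp
  have t4 : ∑' q, ω q * ∫⁻ r in Set.Ioc a b,
      quadDeriv (fun k => ‖d k r‖ₑ) (fun k => ‖hat (W r) k‖ₑ) q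
      ≤ 4 * ∫⁻ r in Set.Ioc a b, G r := by
    calc _ = ∑' q, ∫⁻ r in Set.Ioc a b, ω q *
          quadDeriv (fun k => ‖d k r‖ₑ) (fun k => ‖hat (W r) k‖ₑ) q := by
          refine tsum_congr fun q => ?_
          rw [lintegral_const_mul'' _ (aemeasurable_quadDeriv hab hW hd q)]
      _ = ∫⁻ r in Set.Ioc a b, ∑' q, ω q *
          quadDeriv (fun k => ‖d k r‖ₑ) (fun k => ‖hat (W r) k‖ₑ) q := by
          rw [lintegral_tsum fun q => (aemeasurable_quadDeriv hab hW hd q).const_mul _]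
      _ = ∫⁻ r in Set.Ioc a b, 4 * quadSum ω (fun k => ‖d k r‖ₑ) (fun k => ‖hat (W r) k‖ₑ) :=
          lintegral_congr fun r => by
            simpa only [quadDeriv] using
              hω.tsum_four (fun k => ‖d k r‖ₑ) (fun k => ‖hat (W r) k‖ₑ)
      _ ≤ ∫⁻ r in Set.Ioc a b, 4 * G r :=
          lintegral_mono_ae (hG.mono fun r hr => mul_le_mul' le_rfl hr)
      _ = _ := lintegral_const_mul' _ _ (by simp)
  -- The time average and the two endpoints cost `K` each; the four positions of the derivative
  -- contribute equally, by invariance of `ω`.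
  calc _ ≤ ∑' q, κ * (ω q * (ENNReal.ofReal (b - a)⁻¹ * ∫⁻ r in Set.Ioc a b, P r q)
        + (ω q * P a q + ω q * P b q
        + ω q * ∫⁻ r in Set.Ioc a b,
          quadDeriv (fun k => ‖d k r‖ₑ) (fun k => ‖hat (W r) k‖ₑ) q)) := by
        refine ENNReal.tsum_le_tsum fun q => (hterm q).trans (le_of_eq ?_)
        simp only [hP]; ring
    _ ≤ κ * (K + (K + K + 4 * ∫⁻ r in Set.Ioc a b, G r)) := by
        rw [ENNReal.tsum_mul_left, ENNReal.tsum_add, ENNReal.tsum_add, ENNReal.tsum_add]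
        gcongr
        · exact hPK a ⟨le_rfl, hab.le⟩
        · exact hPK b ⟨hab.le, le_rfl⟩
    _ = _ := by ring

variable {c : ℝ} (hc : 0 < c) (hΦ : ∀ q : Freq, c * q.pr ≤ |phase β q.k₁ q.k₂ q.k₃|)
include hc hΦ

open Freq in
/-- Summation after one integration by parts. -/
theorem tsum_mul_quadInt_le (hab : a < b) (hW : Continuous W)
    (hd : ∀ k, HasIntDeriv (osc β W k) (d k) a b) {w ω : Freq → ℝ≥0∞} (hω : Invariant ω)
    (hwω : ∀ q, w q * ENNReal.ofReal |phase β q.k₁ q.k₂ q.k₃|⁻¹ ≤ ω q)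
    {K : ℝ≥0∞} {G : ℝ → ℝ≥0∞}
    (hK : ∀ r ∈ Set.Icc a b, quadSum ω (fun k => ‖hat (W r) k‖ₑ) (fun k => ‖hat (W r) k‖ₑ) ≤ K)
    (hG : ∀ᵐ r ∂volume.restrict (Set.Ioc a b),
      quadSum ω (fun k => ‖d k r‖ₑ) (fun k => ‖hat (W r) k‖ₑ) ≤ G r) :
    ∑' q, w q * ‖quadInt W a b q‖ₑ ≤ 3 * K + 4 * ∫⁻ r in Set.Ioc a b, G r := by
  rw [← one_mul (3 * K + _)]
  refine tsum_quadInt_le hab hW hd hω (fun q => ?_) hK hG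
  obtain ⟨D, hD, hDle⟩ := hasIntDeriv_quad_osc hab hd q
  have h := norm_integral_osc_le hab.le hD (phase_ne_zero hc hΦ q)
  rw [← quadInt_eq_osc, enorm_quad_osc, enorm_quad_osc] at h
  rw [one_mul]
  refine (mul_le_mul' le_rfl h).trans ?_
  rw [← mul_assoc]
  refine mul_le_mul' (hwω q) (le_trans ?_ le_add_self)
  gcongr with r
  exact hDle r

open Freq in
/-- Summation with a gain of a power of the length of the time interval. -/
theorem tsum_quadInt_le_interp (hab : a < b) (hW : Continuous W)
    (hd : ∀ k, HasIntDeriv (osc β W k) (d k) a b) {ω : Freq → ℝ≥0∞} (hω : Invariant ω)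
    (hwω : ∀ q, ENNReal.ofReal (|phase β q.k₁ q.k₂ q.k₃| ^ (-(3 / 4) : ℝ)) ≤ ω q)
    {K : ℝ≥0∞} {G : ℝ → ℝ≥0∞}
    (hK : ∀ r ∈ Set.Icc a b, quadSum ω (fun k => ‖hat (W r) k‖ₑ) (fun k => ‖hat (W r) k‖ₑ) ≤ K)
    (hG : ∀ᵐ r ∂volume.restrict (Set.Ioc a b),
      quadSum ω (fun k => ‖d k r‖ₑ) (fun k => ‖hat (W r) k‖ₑ) ≤ G r) :
    ∑' q, ‖quadInt W a b q‖ₑ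
      ≤ ENNReal.ofReal ((b - a) ^ (1 / 4 : ℝ)) * (3 * K + 4 * ∫⁻ r in Set.Ioc a b, G r) := by
  have := tsum_quadInt_le hab hW hd (w := fun _ => 1) hω
    (κ := ENNReal.ofReal ((b - a) ^ (1 / 4 : ℝ))) (fun q => ?_) hK hG
  · simpa using this
  obtain ⟨D, hD, hDle⟩ := hasIntDeriv_quad_osc hab hd q
  have h := norm_integral_osc_le_interp hab hD (phase_ne_zero hc hΦ q)
  rw [← quadInt_eq_osc, enorm_quad_osc, enorm_quad_osc] at h
  simp only [enorm_quad_osc] at h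
  rw [one_mul]
  refine h.trans ?_
  gcongr with r
  · exact hwω q
  · exact hDle r

end Sum

end

/-! ### Resonant and nonresonant interactions -/

section

namespace Freq

/-- The frequencies all of whose components belong to a finite set. -/
def box (s : Finset ℤ) : Finset Freq :=
  ((s ×ˢ s ×ˢ s).preimage _ injective_coords.injOn).filter fun q => q.k ∈ s

theorem mem_box {s : Finset ℤ} {q : Freq} :
    q ∈ box s ↔ (q.k₁ ∈ s ∧ q.k₂ ∈ s ∧ q.k₃ ∈ s) ∧ q.k ∈ s := by
  simp only [box, Finset.mem_filter, Finset.mem_preimage, Finset.mem_product]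

theorem tendsto_box : Tendsto (fun N => box (freqs N)) atTop atTop := by
  refine tendsto_atTop_finset_of_monotone (fun M N h q hq => ?_) fun q => ?_
  · have : freqs M ⊆ freqs N := Finset.Icc_subset_Icc (by simpa using h) (by simpa using h)
    rw [mem_box] at hq ⊢
    exact ⟨⟨this hq.1.1, this hq.1.2.1, this hq.1.2.2⟩, this hq.2⟩
  · refine ⟨q.k.natAbs + q.k₁.natAbs + q.k₂.natAbs + q.k₃.natAbs, ?_⟩
    simp only [mem_box, mem_freqs, abs_eq_max_neg]; omega

end Freq

open Freq

/-- The resonant and nonresonant parts of the cubic nonlinearity. -/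
theorem cubicHat_tpoly_mul_conj (s : Finset ℤ) (c : ℤ → ℂ) {k : ℤ} (hk : k ∈ s) :
    cubicHat (tpoly s c) k * conj (c k) = ∑ q ∈ box s with q.k = k, quadProd (tpoly s c) q
      + ((2 * (∑ j ∈ s, ‖c j‖ ^ 2) * ‖c k‖ ^ 2 - ‖c k‖ ^ 4 : ℝ) : ℂ) := by
  classical
  set g : ℤ × ℤ × ℤ → ℂ := fun t => c t.1 * conj (c t.2.1) * c t.2.2 with hg
  have hsq : ∀ z : ℂ, z * conj z = ((‖z‖ ^ 2 : ℝ) : ℂ) := fun z => by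
    rw [Complex.mul_conj, Complex.normSq_eq_norm_sq]
  have e1 : cubicHat (tpoly s c) k
      = ∑ t ∈ s ×ˢ s ×ˢ s, if k = t.1 - t.2.1 + t.2.2 then g t else 0 := by
    rw [cubicHat_tpoly, Finset.sum_product]
    refine Finset.sum_congr rfl fun k₁ _ => ?_
    rw [Finset.sum_product]
  have e2 : ∑ q ∈ box s with q.k = k, quadProd (tpoly s c) q
      = (∑ t ∈ s ×ˢ s ×ˢ s, if k = t.1 - t.2.1 + t.2.2 ∧ (t.1 - t.2.1) * (-t.2.1 + t.2.2) ≠ 0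
          then g t else 0) * conj (c k) := by
    rw [← Finset.sum_filter, Finset.sum_mul]
    refine Finset.sum_bij' (fun q _ => (q.k₁, q.k₂, q.k₃))
      (fun t ht => ⟨k, t.1, t.2.1, t.2.2, (Finset.mem_filter.1 ht).2.1, (Finset.mem_filter.1 ht).2.2⟩)
      ?_ ?_ ?_ ?_ ?_
    · intro q hq
      simp only [Finset.mem_filter, mem_box, Finset.mem_product] at hq ⊢
      exact ⟨hq.1.1, by rw [← hq.2]; exact q.sum_eq, q.nonres⟩
    · intro t ht
      simp only [Finset.mem_filter, mem_box, Finset.mem_product] at ht ⊢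
      exact ⟨⟨ht.1, hk⟩, trivial⟩
    · intro q hq
      exact Freq.ext' (Finset.mem_filter.1 hq).2.symm rfl rfl rfl
    · intro t ht; rfl
    · intro q hq
      simp only [Finset.mem_filter, mem_box] at hq
      simp only [quadProd, hat_tpoly, hq.1.1.1, hq.1.1.2.1, hq.1.1.2.2, hq.2, hk, if_true, hg]
  -- Inclusion–exclusion over the resonances: given the constraint, `k₁ = k₂` forces `k₃ = k`, `k₃ =
  -- k₂` forces `k₁ = k`, and both together force all four frequencies to be equal.
  have e3 : ∀ t : ℤ × ℤ × ℤ, (if k = t.1 - t.2.1 + t.2.2 then g t else 0)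
      = (if k = t.1 - t.2.1 + t.2.2 ∧ (t.1 - t.2.1) * (-t.2.1 + t.2.2) ≠ 0 then g t else 0)
        + ((if t.1 = t.2.1 then (if t.2.2 = k then g t else 0) else 0)
        + ((if t.2.2 = t.2.1 then (if t.1 = k then g t else 0) else 0)
        - (if t.1 = k then (if t.2.1 = k then (if t.2.2 = k then g t else 0) else 0) else 0))) := by
    rintro ⟨k₁, k₂, k₃⟩
    simp only [ne_eq, mul_eq_zero, not_or]
    rcases eq_or_ne k₁ k₂ with h1 | h1
    · subst h1
      rcases eq_or_ne k₃ k with h2 | h2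
      · subst h2
        rcases eq_or_ne k₃ k₁ with h3 | h3
        · simp [h3]
        · simp [h3, h3.symm]
      · have : ¬ (k = k₁ - k₁ + k₃) := by omega
        by_cases h3 : k₃ = k₁
        · have : k₁ ≠ k := by rw [← h3]; exact h2
          simp [h3, this, this.symm]
        · simp [h2, h2.symm, h3]
    · rcases eq_or_ne k₃ k₂ with h2 | h2
      · subst h2
        rcases eq_or_ne k₁ k with h3 | h3
        · subst h3; simp [h1, h1.symm]
        · simp [h1, h3, h3.symm]
      · have h3 : k₁ - k₂ ≠ 0 := sub_ne_zero.2 h1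
        have h4 : ¬ (-k₂ + k₃ = 0) := by omega
        have h5 : ¬ (k₁ = k ∧ k₂ = k) := fun h => h1 (h.1.trans h.2.symm)
        by_cases h6 : k₁ = k
        · have : k₂ ≠ k := fun h => h5 ⟨h6, h⟩
          simp [h1, h2, h3, h4, this]
        · simp [h1, h2, h3, h4, h6]
  have e4 : ∑ t ∈ s ×ˢ s ×ˢ s, (if t.1 = t.2.1 then (if t.2.2 = k then g t else 0) else 0)
      = ((∑ j ∈ s, ‖c j‖ ^ 2 : ℝ) : ℂ) * c k := by
    rw [Finset.sum_product]
    push_cast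
    rw [Finset.sum_mul]
    refine Finset.sum_congr rfl fun k₁ h₁ => ?_
    rw [Finset.sum_product, Finset.sum_eq_single_of_mem k₁ h₁ (fun b _ hb => by simp [hb.symm])]
    simp only [if_true, Finset.sum_ite_eq', hk, hg]
    rw [hsq]; push_cast; rfl
  have e5 : ∑ t ∈ s ×ˢ s ×ˢ s, (if t.2.2 = t.2.1 then (if t.1 = k then g t else 0) else 0)
      = ((∑ j ∈ s, ‖c j‖ ^ 2 : ℝ) : ℂ) * c k := by
    rw [Finset.sum_product, Finset.sum_eq_single_of_mem k hk (fun b _ hb => by simp [hb])]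
    push_cast
    rw [Finset.sum_mul, Finset.sum_product]
    refine Finset.sum_congr rfl fun k₂ h₂ => ?_
    rw [Finset.sum_eq_single_of_mem k₂ h₂ (fun b _ hb => by simp [hb])]
    simp only [if_true, hg]
    rw [mul_assoc, mul_comm (conj _), hsq]; push_cast; ring
  have e6 : ∑ t ∈ s ×ˢ s ×ˢ s,
      (if t.1 = k then (if t.2.1 = k then (if t.2.2 = k then g t else 0) else 0) else 0)
      = ((‖c k‖ ^ 2 : ℝ) : ℂ) * c k := by
    rw [Finset.sum_eq_single_of_mem (k, k, k) (by simp [hk])]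
    · simp only [if_true, hg]; rw [hsq]
    · rintro ⟨a, b, d⟩ _ h
      by_cases h1 : a = k <;> by_cases h2 : b = k <;> by_cases h3 : d = k <;> simp_all
  rw [e2, e1, Finset.sum_congr rfl fun t _ => e3 t, Finset.sum_add_distrib, Finset.sum_add_distrib,
    Finset.sum_sub_distrib, e4, e5, e6, add_mul]
  congr 1
  have := hsq (c k)
  push_cast at this ⊢
  linear_combination (2 * ∑ j ∈ s, (‖c j‖ : ℂ) ^ 2 - (‖c k‖ : ℂ) ^ 2) * this

theorem norm_tpoly_sq (s : Finset ℤ) (c : ℤ → ℂ) : ‖tpoly s c‖ ^ 2 = ∑ k ∈ s, ‖c k‖ ^ 2 := by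
  rw [← (hasSum_norm_hat_sq (tpoly s c)).tsum_eq, tsum_eq_sum (s := s)]
  · exact Finset.sum_congr rfl fun k hk => by rw [hat_tpoly, if_pos hk]
  · intro k hk; rw [hat_tpoly, if_neg hk]; simp

/-- The resonant part sums to `2‖·‖⁴` minus a sum of fourth powers, and only its upper bound
matters. A bound for the nonresonant sums is thus a bound for `L⁴`. -/
theorem q4_tpoly_le_sum (s : Finset ℤ) (c : ℤ → ℂ) : (q4 (tpoly s c)).toReal
    ≤ (∑ q ∈ box s, quadProd (tpoly s c) q).re + 2 * ‖tpoly s c‖ ^ 4 := by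
  classical
  rw [q4_tpoly, Finset.sum_congr rfl fun k hk => cubicHat_tpoly_mul_conj s c hk,
    Finset.sum_add_distrib, Finset.sum_fiberwise_of_maps_to (fun q hq => (mem_box.1 hq).2),
    Complex.add_re, ← Complex.ofReal_sum, Complex.ofReal_re, Finset.sum_sub_distrib,
    ← Finset.mul_sum, ← norm_tpoly_sq]
  have : 0 ≤ ∑ k ∈ s, ‖c k‖ ^ 4 := Finset.sum_nonneg fun _ _ => by positivity
  linarith

end

/-! ### The space-time `L⁴` estimate -/

section

open Freq

theorem osc_proj (β : ℝ) (W : ℝ → L2) (N : ℕ) (k : ℤ) : osc β (fun r => proj N (W r)) k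
    = fun r => if |k| ≤ N then osc β W k r else 0 := by
  funext r
  simp only [osc, hat_proj]; split_ifs <;> simp

theorem hasIntDeriv_osc_proj {β : ℝ} {W : ℝ → L2} {d : ℤ → ℝ → ℂ} {a b : ℝ}
    (hd : ∀ k, HasIntDeriv (osc β W k) (d k) a b) (N : ℕ) (k : ℤ) :
    HasIntDeriv (osc β (fun r => proj N (W r)) k) (fun r => if |k| ≤ N then d k r else 0) a b := by
  rw [osc_proj]
  split_ifs
  · exact hd k
  · exact ⟨by simp, by simp⟩

theorem enorm_proj_le (N : ℕ) (f : L2) : ‖proj N f‖ₑ ≤ ‖f‖ₑ := by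
  rw [← ofReal_norm, ← ofReal_norm]
  exact ENNReal.ofReal_le_ofReal (norm_proj_le N f)

/-- The modulus `l + l^{1/4}` of the gain on an interval of length `l`. -/
def gain (l : ℝ) : ℝ≥0∞ := ENNReal.ofReal (l + l ^ (1 / 4 : ℝ))

theorem gain_ne_top (l : ℝ) : gain l ≠ ∞ := ENNReal.ofReal_ne_top

theorem tendsto_gain : Tendsto gain (𝓝 0) (𝓝 0) := by
  have h : Continuous fun l : ℝ => l + l ^ (1 / 4 : ℝ) :=
    continuous_id.add (Real.continuous_rpow_const (by norm_num))
  have := (ENNReal.continuous_ofReal.comp h).tendsto 0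
  have h0 : ENNReal.ofReal ((0 : ℝ) + (0 : ℝ) ^ (1 / 4 : ℝ)) = 0 := by norm_num
  simp only [Function.comp_apply, h0] at this
  exact this

variable {β c : ℝ} (hc : 0 < c) (hΦ : ∀ q : Freq, c * q.pr ≤ |phase β q.k₁ q.k₂ q.k₃|)
include hc hΦ

/-- The `L⁴` estimate for functions with controlled time derivative in the interaction
representation. -/
theorem exists_lintegral_q4_le : ∃ C : ℝ≥0∞, C ≠ ∞ ∧
    ∀ {W : ℝ → L2} {d : ℤ → ℝ → ℂ} {a b : ℝ} {h : ℝ → ℝ≥0∞} {S : ℝ≥0∞}, a < b → Continuous W →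
      (∀ k, HasIntDeriv (osc β W k) (d k) a b) →
      (∀ᵐ r ∂volume.restrict (Set.Ioc a b), ∀ k, ‖d k r‖ₑ ≤ h r) →
      S ≠ ∞ → (∀ r ∈ Set.Icc a b, ‖W r‖ₑ ≤ S) →
      ∫⁻ r in Set.Ioc a b, q4 (W r)
        ≤ C * gain (b - a) * (S ^ 4 + S ^ 3 * ∫⁻ r in Set.Ioc a b, h r) := by
  set C₁ : ℝ≥0∞ := ENNReal.ofReal (c ^ (-(3 / 4) : ℝ)) * (6 * brSum (9 / 8) ^ 2) with hC₁
  have hC₁t : C₁ ≠ ∞ := by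
    have := brSum_ne_top (t := 9 / 8) (by norm_num)
    finiteness
  refine ⟨2 + 4 * C₁, by finiteness, ?_⟩
  intro W d a b h S hab hW hd hh hSt hS
  set ω : Freq → ℝ≥0∞ := fun q => ENNReal.ofReal (c ^ (-(3 / 4) : ℝ) * kern (9 / 8) q) with hω
  have hωi : Invariant ω := by
    constructor
    · intro q
      have := (invariant_kern (9 / 8)).one q
      simp only [hω, ENNReal.ofReal_mul (Real.rpow_nonneg hc.le _)] at this ⊢
      rw [this]
    · intro q
      have := (invariant_kern (9 / 8)).one_three q
      simp only [hω, ENNReal.ofReal_mul (Real.rpow_nonneg hc.le _)] at this ⊢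
      rw [this]
  have hq : ∀ {A B : ℤ → ℝ≥0∞} {e : ℝ≥0∞}, (∀ k, A k ≤ e) → ∑' k, B k ^ 2 ≤ S ^ 2 →
      quadSum ω A B ≤ C₁ * (e * S ^ 3) := fun hA hB => by
    refine (quadSum_const_mul_le (Real.rpow_nonneg hc.le _) (fun q => le_rfl) _ _).trans ?_
    rw [hC₁, mul_assoc]
    exact mul_le_mul' le_rfl (quadSum_kern_le _ hA hB)
  have hmain : ∀ N : ℕ, ∫⁻ r in Set.Ioc a b, q4 (proj N (W r))
      ≤ (2 + 4 * C₁) * gain (b - a) * (S ^ 4 + S ^ 3 * ∫⁻ r in Set.Ioc a b, h r) := by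
    intro N
    set V : ℝ → L2 := fun r => proj N (W r) with hV
    have hVc : Continuous V := (continuous_proj N).comp hW
    have hVS : ∀ r ∈ Set.Icc a b, ‖V r‖ₑ ≤ S := fun r hr => (enorm_proj_le N _).trans (hS r hr)
    have hVsq : ∀ r ∈ Set.Icc a b, ∑' k, ‖hat (V r) k‖ₑ ^ 2 ≤ S ^ 2 := fun r hr => by
      rw [tsum_enorm_hat_sq]; exact pow_le_pow_left' (hVS r hr) 2
    have hsum := tsum_quadInt_le_interp hc hΦ hab hVc (hasIntDeriv_osc_proj hd N) hωi
      (fun q => ENNReal.ofReal_le_ofReal (abs_phase_rpow_le hc hΦ q)) (K := C₁ * S ^ 4)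
      (G := fun r => C₁ * S ^ 3 * h r) (fun r hr => by
        refine (hq (fun k => (enorm_hat_le _ k).trans (hVS r hr)) (hVsq r hr)).trans (le_of_eq ?_)
        ring) (by
        filter_upwards [hh, ae_restrict_mem measurableSet_Ioc] with r hr hrm
        refine (hq (e := h r) (fun k => ?_) (hVsq r ⟨hrm.1.le, hrm.2⟩)).trans (le_of_eq ?_)
        · split_ifs
          · exact hr k
          · simp
        · ring)
    rw [lintegral_const_mul' _ _ (by finiteness)] at hsum
    -- `g` dominates `q4 (V r)` at each time and is continuous; its time integral involves only the
    -- `quadInt` of finitely many quadruples and the conserved-type term `‖V r‖⁴`.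
    set g : ℝ → ℝ := fun r => (∑ q ∈ box (freqs N), quadProd (V r) q).re + 2 * ‖V r‖ ^ 4 with hg
    have hgc : Continuous g := (Complex.continuous_re.comp
      (continuous_finsetSum _ fun q _ => continuous_quadProd hVc q)).add (by fun_prop)
    have hgq : ∀ r, (q4 (V r)).toReal ≤ g r := fun r => by
      simp only [hg, hV, proj_eq_tpoly]; exact q4_tpoly_le_sum _ _
    have hint : ∫ r in a..b, g r
        = (∑ q ∈ box (freqs N), quadInt V a b q).re + ∫ r in a..b, 2 * ‖V r‖ ^ 4 := by
      have i1 : ∀ q, IntervalIntegrable (fun r => quadProd (V r) q) volume a b := fun q =>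
        (continuous_quadProd hVc q).intervalIntegrable _ _
      simp only [hg, quadInt]
      rw [intervalIntegral.integral_add, ← intervalIntegral.integral_finsetSum fun q _ => i1 q]
      · congr 1
        rw [intervalIntegral.integral_of_le hab.le, intervalIntegral.integral_of_le hab.le]
        refine integral_re (𝕜 := ℂ) (f := fun r => ∑ q ∈ box (freqs N), quadProd (V r) q) ?_
        exact ((continuous_finsetSum _ fun q _ => continuous_quadProd hVc q).intervalIntegrable
          a b).1
      · exact (Complex.continuous_re.comp
          (continuous_finsetSum _ fun q _ => continuous_quadProd hVc q)).intervalIntegrable _ _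
      · exact Continuous.intervalIntegrable (by fun_prop) _ _
    have hl : 0 < b - a := sub_pos.2 hab
    have h1 : ENNReal.ofReal ((b - a) ^ (1 / 4 : ℝ)) ≤ gain (b - a) :=
      ENNReal.ofReal_le_ofReal (by linarith)
    have h2 : ENNReal.ofReal (b - a) ≤ gain (b - a) :=
      ENNReal.ofReal_le_ofReal (by linarith [Real.rpow_nonneg hl.le (1 / 4 : ℝ)])
    calc ∫⁻ r in Set.Ioc a b, q4 (V r) ≤ ∫⁻ r in Set.Ioc a b, ENNReal.ofReal (g r) := by
          refine lintegral_mono fun r => ?_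
          have hf : q4 (V r) ≠ ∞ := q4_tpoly_ne_top (freqs N) (hat (W r))
          rw [← ENNReal.ofReal_toReal hf]
          exact ENNReal.ofReal_le_ofReal (hgq r)
      _ = ENNReal.ofReal (∫ r in a..b, g r) := by
          rw [intervalIntegral.integral_of_le hab.le, ofReal_integral_eq_lintegral_ofReal]
          · exact (hgc.intervalIntegrable a b).1
          · exact Eventually.of_forall fun r => ENNReal.toReal_nonneg.trans (hgq r)
      _ ≤ ∑ q ∈ box (freqs N), ‖quadInt V a b q‖ₑ + ∫⁻ r in Set.Ioc a b, 2 * S ^ 4 := by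
          rw [hint]
          refine ENNReal.ofReal_add_le.trans (add_le_add ?_ ?_)
          · refine le_trans ?_ (enorm_sum_le _ _)
            rw [← ofReal_norm]
            exact ENNReal.ofReal_le_ofReal (Complex.re_le_norm _)
          · rw [intervalIntegral.integral_of_le hab.le, ofReal_integral_eq_lintegral_ofReal]
            · refine setLIntegral_mono measurable_const fun r hr => ?_
              rw [ENNReal.ofReal_mul (by norm_num), ENNReal.ofReal_pow (norm_nonneg _), ofReal_norm]
              have := hVS r ⟨hr.1.le, hr.2⟩
              gcongr
              simp
            · exact (Continuous.intervalIntegrable (by fun_prop) a b).1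
            · exact Eventually.of_forall fun r => by positivity
      _ ≤ ENNReal.ofReal ((b - a) ^ (1 / 4 : ℝ)) * (3 * (C₁ * S ^ 4)
            + 4 * (C₁ * S ^ 3 * ∫⁻ r in Set.Ioc a b, h r)) + ENNReal.ofReal (b - a) * (2 * S ^ 4) := by
          refine add_le_add ((ENNReal.sum_le_tsum _).trans hsum) (le_of_eq ?_)
          rw [setLIntegral_const, Real.volume_Ioc, mul_comm]
      _ ≤ gain (b - a) * (4 * (C₁ * S ^ 4)
            + 4 * (C₁ * S ^ 3 * ∫⁻ r in Set.Ioc a b, h r))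
            + gain (b - a) * (2 * (S ^ 4 + S ^ 3 * ∫⁻ r in Set.Ioc a b, h r)) := by
          gcongr
          · norm_num
          · exact le_self_add
      _ = _ := by ring
  -- The bound for the truncations is uniform in `N`. Lower semicontinuity and Fatou's lemma carry
  -- it to `W`, so finiteness of the `L⁴` norm of `W` is a conclusion and not an assumption.
  calc ∫⁻ r in Set.Ioc a b, q4 (W r)
      ≤ ∫⁻ r in Set.Ioc a b, liminf (fun N => q4 (proj N (W r))) atTop :=
        lintegral_mono fun r => q4_le_liminf (tendsto_proj (W r))
    _ ≤ liminf (fun N => ∫⁻ r in Set.Ioc a b, q4 (proj N (W r))) atTop :=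
        lintegral_liminf_le fun N => measurable_q4_comp ((continuous_proj N).comp hW)
    _ ≤ _ := by
        refine (liminf_le_liminf (Eventually.of_forall hmain)).trans ?_
        rw [liminf_const]

end

/-! ### Solutions as flows in reversed time -/

section

/-- The time derivative of the coefficients in the interaction representation, for the equation
whose nonlinearity is restricted to the frequencies in `A`. -/
def drv (β : ℝ) (A : Set ℤ) (U : ℝ → L2) (k : ℤ) (r : ℝ) : ℂ :=
  A.indicator (fun k => Complex.I * Complex.exp (-(Complex.I * (r * disp β k : ℝ)))
    * cubicHat (U r) k) k

/-- `U` solves the time-reversed equation on `[0, T]`, with the nonlinearity restricted to the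
frequencies in `A`. -/
structure IsFlow (β : ℝ) (A : Set ℤ) (T : ℝ) (U : ℝ → L2) : Prop where
  cont : Continuous U
  q4_ne_top : ∫⁻ r in Set.Ioc 0 T, q4 (U r) ≠ ∞
  supp : ∀ r, ∀ k ∉ A, hat (U r) k = 0
  deriv : ∀ k, HasIntDeriv (osc β U k) (drv β A U k) 0 T

theorem enorm_drv_le (β : ℝ) (A : Set ℤ) (U : ℝ → L2) (k : ℤ) (r : ℝ) :
    ‖drv β A U k r‖ₑ ≤ ‖cubicHat (U r) k‖ₑ := by
  classical
  rw [drv, Set.indicator_apply]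
  split_ifs
  · rw [enorm_mul, enorm_mul, ← ofReal_norm (Complex.exp _), norm_cexp_neg_I_mul, ← ofReal_norm]
    simp
  · simp

theorem IsFlow.ae_q4_ne_top {β T : ℝ} {A : Set ℤ} {U : ℝ → L2} (h : IsFlow β A T U) :
    ∀ᵐ r ∂volume.restrict (Set.Ioc 0 T), q4 (U r) ≠ ∞ :=
  (ae_lt_top (measurable_q4_comp h.cont) h.q4_ne_top).mono fun _ hr => hr.ne

section Construction

variable {β T : ℝ} {A : Set ℤ} {U : ℝ → L2}

theorem aestronglyMeasurable_drv (hU : Continuous U)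
    (h4 : ∫⁻ r in Set.Ioc 0 T, q4 (U r) ≠ ∞) (k : ℤ) :
    AEStronglyMeasurable (drv β A U k) (volume.restrict (Set.Ioc 0 T)) := by
  classical
  have hm := aestronglyMeasurable_cubicHat hU
    ((ae_lt_top (measurable_q4_comp hU) h4).mono fun _ hr => hr.ne) k
  unfold drv
  by_cases hk : k ∈ A
  · simp only [Set.indicator_of_mem hk]
    exact (Continuous.aestronglyMeasurable (by fun_prop)).mul hm
  · simp only [Set.indicator_of_notMem hk]
    exact aestronglyMeasurable_const

theorem lintegral_q3_le (U : ℝ → L2) (a b : ℝ) :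
    ∫⁻ r in Set.Ioc a b, q3 (U r) ≤ ENNReal.ofReal (b - a) + ∫⁻ r in Set.Ioc a b, q4 (U r) := by
  refine (lintegral_mono fun r => q3_le (U r)).trans (le_of_eq ?_)
  rw [lintegral_add_left measurable_const, setLIntegral_const, Real.volume_Ioc, one_mul]

theorem integrableOn_drv (hU : Continuous U)
    (h4 : ∫⁻ r in Set.Ioc 0 T, q4 (U r) ≠ ∞) (k : ℤ) :
    IntegrableOn (drv β A U k) (Set.Ioc 0 T) := by
  refine ⟨aestronglyMeasurable_drv hU h4 k, ?_⟩
  rw [HasFiniteIntegral]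
  refine lt_of_le_of_lt (lintegral_mono fun r =>
    (enorm_drv_le β A U k r).trans (enorm_cubicHat_le _ _)) ?_
  exact (lintegral_q3_le U 0 T).trans_lt (by finiteness)

theorem isFlow_of_osc (hT : 0 < T) (hU : Continuous U)
    (h4 : ∫⁻ r in Set.Ioc 0 T, q4 (U r) ≠ ∞) (hs : ∀ r, ∀ k ∉ A, hat (U r) k = 0)
    (h : ∀ k, ∀ r ∈ Set.Icc 0 T, osc β U k r = osc β U k 0 + ∫ x in (0 : ℝ)..r, drv β A U k x) :
    IsFlow β A T U where
  cont := hU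
  q4_ne_top := h4
  supp := hs
  deriv k := ⟨(intervalIntegrable_iff_integrableOn_Ioc_of_le hT.le).2 (integrableOn_drv hU h4 k), h k⟩

end Construction

/-- Duhamel's formula after reversal of time, in the interaction representation. -/
theorem osc_of_duhamel {β : ℝ} {u : ℝ → L2} {k : ℤ} {w : ℂ} {G : ℝ → ℂ}
    (h : ∀ t : ℝ, hat (u t) k = Complex.exp (-(Complex.I * (t * disp β k : ℝ))) * w
      - Complex.I * ∫ r in (0 : ℝ)..t, Complex.exp (-(Complex.I * ((t - r) * disp β k : ℝ))) * G r)
    (r : ℝ) : osc β (fun r => u (-r)) k r = w + ∫ x in (0 : ℝ)..r,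
      Complex.I * Complex.exp (-(Complex.I * (x * disp β k : ℝ))) * G (-x) := by
  have e1 : Complex.exp (-(Complex.I * (r * disp β k : ℝ)))
      * Complex.exp (-(Complex.I * ((-r) * disp β k : ℝ))) = 1 := by
    rw [← Complex.exp_add, ← Complex.exp_zero]; congr 1; push_cast; ring
  have e2 : ∫ x in (0 : ℝ)..(-r), Complex.exp (-(Complex.I * ((-r - x) * disp β k : ℝ))) * G x
      = -∫ x in (0 : ℝ)..r, Complex.exp (-(Complex.I * ((-r - -x) * disp β k : ℝ))) * G (-x) := by
    have := intervalIntegral.integral_comp_neg (a := 0) (b := r)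
      (fun x => Complex.exp (-(Complex.I * ((-r - x) * disp β k : ℝ))) * G x)
    rw [this, neg_zero, intervalIntegral.integral_symm]
  rw [osc, h, e2, mul_sub, ← mul_assoc, e1, one_mul, ← intervalIntegral.integral_neg,
    ← intervalIntegral.integral_const_mul, ← intervalIntegral.integral_const_mul, sub_eq_add_neg,
    ← intervalIntegral.integral_neg]
  congr 1
  refine intervalIntegral.integral_congr fun x _ => ?_
  have e3 : Complex.exp (-(Complex.I * (r * disp β k : ℝ)))
      * Complex.exp (-(Complex.I * ((-r - -x) * disp β k : ℝ)))
      = Complex.exp (-(Complex.I * (x * disp β k : ℝ))) := by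
    rw [← Complex.exp_add]; congr 1; push_cast; ring
  rw [← e3]; ring

section Sobolev

variable {s : ℝ} {f g : L2}

theorem jb_rpow_nonneg (k : ℤ) (t : ℝ) : 0 ≤ jb k ^ t := Real.rpow_nonneg (jb_pos k).le _

theorem MemHs.sub (hf : MemHs s f) (hg : MemHs s g) : MemHs s (f - g) := by
  refine Summable.of_nonneg_of_le (fun k => mul_nonneg (jb_rpow_nonneg _ _) (sq_nonneg _))
    (fun k => ?_) ((hf.mul_left 2).add (hg.mul_left 2))
  have h1 : ‖hat (f - g) k‖ ^ 2 ≤ 2 * ‖hat f k‖ ^ 2 + 2 * ‖hat g k‖ ^ 2 := by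
    rw [hat_sub]
    have := norm_sub_le (hat f k) (hat g k)
    nlinarith [sq_nonneg (‖hat f k‖ - ‖hat g k‖), norm_nonneg (hat f k - hat g k)]
  nlinarith [jb_rpow_nonneg k (2 * s)]

theorem norm_le_hsNorm (hs : 0 ≤ s) (hf : MemHs s f) : ‖f‖ ≤ hsNorm s f := by
  refine Real.le_sqrt_of_sq_le ?_
  refine hasSum_le (fun k => ?_) (hasSum_norm_hat_sq f) hf.hasSum
  refine le_mul_of_one_le_left (sq_nonneg _) (Real.one_le_rpow (one_le_jb k) (by linarith))

theorem ContinuousHs.continuous (hs : 0 ≤ s) {u : ℝ → L2} (h : ContinuousHs s u) :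
    Continuous u := by
  refine continuous_iff_continuousAt.2 fun t₀ => ?_
  rw [ContinuousAt, tendsto_iff_norm_sub_tendsto_zero]
  exact squeeze_zero (fun _ => norm_nonneg _)
    (fun t => norm_le_hsNorm hs ((h.1 t).sub (h.1 t₀))) (h.2 t₀)

end Sobolev

theorem IsSolution.isFlow {β s T : ℝ} (hs : 0 ≤ s) (hT : 0 < T) {u₀ : L2} {u : ℝ → L2}
    (h : IsSolution β s u₀ u) : IsFlow β Set.univ T fun r => u (-r) := by
  have hu : Continuous u := h.continuousHs.continuous hs
  refine isFlow_of_osc hT (hu.comp continuous_neg) ?_ (fun r k hk => (hk trivial).elim) ?_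
  -- The interval is enlarged to `T + 1` because the reversed interval `(0, T]` contains the time
  -- `-T`, which `(-T, T)` does not.
  · refine ne_top_of_le_ne_top (h.locallyL4 (T + 1) (by linarith)).ne ?_
    have h1 := (Measure.measurePreserving_neg (volume : Measure ℝ)).setLIntegral_comp_preimage_emb
      (MeasurableEquiv.neg ℝ).measurableEmbedding (fun t => q4 (u t)) (Set.Ioo (-(T + 1)) (T + 1))
    refine le_trans ?_ h1.le
    refine lintegral_mono_set fun r hr => ?_
    simp only [Set.mem_preimage, Set.mem_Ioo]
    constructor <;> linarith [hr.1, hr.2]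
  · intro k r _
    have h1 := osc_of_duhamel (fun t => h.duhamel t k)
    rw [h1 r, h1 0]
    simp [drv]

theorem q4_tpoly_le (s : Finset ℤ) (c : ℤ → ℂ) : q4 (tpoly s c) ≤ (∑ k ∈ s, ‖c k‖ₑ) ^ 4 := by
  refine (lintegral_mono_ae ((tpoly_bound s c).mono fun x hx => pow_le_pow_left' hx 4)).trans ?_
  rw [lintegral_const, measure_univ, mul_one]

theorem IsTruncatedSolution.isFlow {β T : ℝ} {N : ℕ} (hT : 0 < T) {u₀ : L2} {u : ℝ → L2}
    (h : IsTruncatedSolution β N u₀ u) : IsFlow β {k | |k| ≤ N} T fun r => u (-r) := by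
  have hU : Continuous fun r => u (-r) := h.continuous.comp continuous_neg
  have hs : ∀ t, ∀ k ∉ {k : ℤ | |k| ≤ N}, hat (u t) k = 0 := by
    intro t k hk
    rw [h.duhamel t k, hat_proj]
    simp only [Set.mem_ofPred_eq] at hk
    simp [hk]
  refine isFlow_of_osc hT hU ?_ (fun r k hk => hs (-r) k hk) ?_
  · have e : ∀ r, u (-r) = tpoly (freqs N) (hat (u (-r))) := fun r => by
      rw [← proj_eq_tpoly]
      refine hat_ext fun k => ?_
      rw [hat_proj]
      split_ifs with hk
      · rfl
      · exact hs (-r) k hk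
    obtain ⟨S, hS⟩ := (isCompact_Icc (a := (0 : ℝ)) (b := T)).exists_bound_of_continuousOn
      hU.continuousOn
    have h1 : ∀ r ∈ Set.Ioc 0 T, q4 (u (-r)) ≤ (∑ k ∈ freqs N, ENNReal.ofReal S) ^ 4 := by
      intro r hr
      rw [e]
      refine (q4_tpoly_le _ _).trans ?_
      gcongr with k
      refine (enorm_hat_le _ _).trans ?_
      rw [← ofReal_norm]
      exact ENNReal.ofReal_le_ofReal (hS r ⟨hr.1.le, hr.2⟩)
    refine ne_top_of_le_ne_top ?_ (setLIntegral_mono measurable_const h1)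
    rw [setLIntegral_const, Real.volume_Ioc]
    simp only [Finset.sum_const, nsmul_eq_mul]
    finiteness
  · intro k r _
    have h1 := osc_of_duhamel (fun t => h.duhamel t k)
    rw [h1 r, h1 0]
    rw [intervalIntegral.integral_same, add_zero]
    congr 1
    refine intervalIntegral.integral_congr fun x _ => ?_
    classical
    simp only [drv, Set.indicator_apply, Set.mem_ofPred_eq]
    split_ifs <;> simp

end

/-! ### Differences of nonlinearities; summability of the time integrals -/

section

open Freq

section Difference

theorem norm_cube_sub_le (a b : ℂ) :
    ‖cube a - cube b‖ ≤ 2 * ((‖a‖ ^ 2 + ‖b‖ ^ 2) * ‖a - b‖) := by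
  have e : cube a - cube b = ((‖a‖ ^ 2 : ℝ) : ℂ) * (a - b) + ((‖a‖ ^ 2 - ‖b‖ ^ 2 : ℝ) : ℂ) * b := by
    simp only [cube]; push_cast; ring
  rw [e]
  refine (norm_add_le _ _).trans ?_
  rw [norm_mul, norm_mul, Complex.norm_real, Complex.norm_real, Real.norm_of_nonneg (sq_nonneg _),
    sq_sub_sq, Real.norm_eq_abs, abs_mul, abs_of_nonneg (by positivity : 0 ≤ ‖a‖ + ‖b‖)]
  have h := abs_norm_sub_norm_le a b
  have h1 : (‖a‖ + ‖b‖) * |‖a‖ - ‖b‖| * ‖b‖ ≤ (‖a‖ + ‖b‖) * ‖a - b‖ * ‖b‖ := by gcongr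
  nlinarith [mul_nonneg (sq_nonneg (‖a‖ - ‖b‖)) (norm_nonneg (a - b)),
    mul_nonneg (sq_nonneg ‖a‖) (norm_nonneg (a - b)), mul_nonneg (sq_nonneg ‖b‖) (norm_nonneg (a - b))]

theorem enorm_cube_sub_le (a b : ℂ) :
    ‖cube a - cube b‖ₑ ≤ 2 * ((‖a‖ₑ ^ 2 + ‖b‖ₑ ^ 2) * ‖a - b‖ₑ) := by
  simp only [← ofReal_norm]
  refine (ENNReal.ofReal_le_ofReal (norm_cube_sub_le a b)).trans (le_of_eq ?_)
  rw [ENNReal.ofReal_mul (by norm_num), ENNReal.ofReal_mul (by positivity),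
    ENNReal.ofReal_add (by positivity) (by positivity), ENNReal.ofReal_pow (norm_nonneg _),
    ENNReal.ofReal_pow (norm_nonneg _)]
  norm_num

theorem mul_le_weighted (x y : ℝ≥0∞) {m : ℝ≥0∞} (hm : m ≠ 0) (hm' : m ≠ ∞) :
    x * y ≤ m * x ^ 2 + m⁻¹ * y ^ 2 := by
  have h := ennreal_mul_le_sq_add_sq (m * x) y
  calc x * y = m⁻¹ * (m * x * y) := by
        rw [← mul_assoc, ← mul_assoc, ENNReal.inv_mul_cancel hm hm', one_mul]
    _ ≤ m⁻¹ * ((m * x) ^ 2 + y ^ 2) := by gcongr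
    _ = (m⁻¹ * m) * (m * x ^ 2) + m⁻¹ * y ^ 2 := by ring
    _ = _ := by rw [ENNReal.inv_mul_cancel hm hm', one_mul]

/-- Cauchy–Schwarz through Young's inequality with weight `‖g‖`; the case `‖g‖ = 0` is separate
because the weight has to be invertible. -/
theorem lintegral_sq_mul_le (f g : L2) :
    ∫⁻ x, ‖(f : Torus → ℂ) x‖ₑ ^ 2 * ‖(g : Torus → ℂ) x‖ₑ ∂haarT ≤ (1 + q4 f) * ‖g‖ₑ := by
  rcases eq_or_ne ‖g‖ₑ 0 with h0 | h0
  · have : (g : Torus → ℂ) =ᵐ[haarT] 0 := by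
      rw [enorm_eq_zero.1 h0]; exact Lp.coeFn_zero _ _ _
    rw [h0, mul_zero]
    refine le_of_eq ((lintegral_congr_ae ?_).trans lintegral_zero)
    filter_upwards [this] with x hx
    rw [hx]; simp
  have ht : ‖g‖ₑ ≠ ∞ := enorm_ne_top
  calc _ ≤ ∫⁻ x, (‖g‖ₑ * ‖(f : Torus → ℂ) x‖ₑ ^ 4 + ‖g‖ₑ⁻¹ * ‖(g : Torus → ℂ) x‖ₑ ^ 2) ∂haarT := by
        refine lintegral_mono fun x => (mul_le_weighted _ _ h0 ht).trans (le_of_eq ?_)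
        ring
    _ = ‖g‖ₑ * q4 f + ‖g‖ₑ⁻¹ * ‖g‖ₑ ^ 2 := by
        rw [lintegral_add_left' (((aestronglyMeasurable_coe f).enorm.pow_const 4).const_mul _),
          lintegral_const_mul' _ _ ht, lintegral_const_mul' _ _ (by finiteness),
          ← enorm_sq_eq_lintegral]
        rfl
    _ = _ := by
        rw [sq, ← mul_assoc, ENNReal.inv_mul_cancel h0 ht]; ring

/-- The bound is linear in the `L²` distance, with only `L⁴` quantities as coefficients; this lets
the comparison of two flows close in `L²`. -/
theorem enorm_cubicHat_sub_le {f g : L2} (hf : q4 f ≠ ∞) (hg : q4 g ≠ ∞) (k : ℤ) :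
    ‖cubicHat f k - cubicHat g k‖ₑ ≤ 2 * ((2 + q4 f + q4 g) * ‖f - g‖ₑ) := by
  have hi : ∀ {f : L2}, q4 f ≠ ∞ → Integrable (fun x => fourier (-k) x • cube (f x)) haarT :=
    fun hf => (integrable_cube (q3_ne_top hf)).fourier_smul (-k)
  rw [cubicHat_eq, cubicHat_eq, fourierCoeff, fourierCoeff, ← integral_sub (hi hf) (hi hg)]
  refine (enorm_integral_le_lintegral_enorm _).trans ?_
  calc _ ≤ ∫⁻ x, 2 * (‖(f : Torus → ℂ) x‖ₑ ^ 2 * ‖((f - g : L2) : Torus → ℂ) x‖ₑ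
          + ‖(g : Torus → ℂ) x‖ₑ ^ 2 * ‖((f - g : L2) : Torus → ℂ) x‖ₑ) ∂haarT := by
        refine lintegral_mono_ae ?_
        filter_upwards [Lp.coeFn_sub f g] with x hx
        rw [← smul_sub, enorm_smul, enorm_fourier, one_mul, hx, ← add_mul]
        exact enorm_cube_sub_le _ _
    _ = 2 * ((∫⁻ x, ‖(f : Torus → ℂ) x‖ₑ ^ 2 * ‖((f - g : L2) : Torus → ℂ) x‖ₑ ∂haarT)
          + ∫⁻ x, ‖(g : Torus → ℂ) x‖ₑ ^ 2 * ‖((f - g : L2) : Torus → ℂ) x‖ₑ ∂haarT) := by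
        rw [lintegral_const_mul' _ _ (by simp), lintegral_add_left']
        exact ((aestronglyMeasurable_coe f).enorm.pow_const 2).mul
          (aestronglyMeasurable_coe (f - g)).enorm
    _ ≤ 2 * ((1 + q4 f) * ‖f - g‖ₑ + (1 + q4 g) * ‖f - g‖ₑ) := by
        gcongr <;> exact lintegral_sq_mul_le _ _
    _ = _ := by ring

end Difference

/-- The multiplier depends on the output frequency alone, so an unconditionally convergent sum over
quadruples can be regrouped by `k`. The individual fiber sums then no longer involve the multiplier.
-/
theorem hasSum_fiber {F : Freq → ℂ} {m : ℤ → ℂ} (h : Summable fun q : Freq => m q.k * F q) :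
    HasSum (fun k => m k * ∑' q : Freq, if q.k = k then F q else 0) (∑' q : Freq, m q.k * F q) := by
  have h1 : HasSum (fun p : Σ k : ℤ, {q : Freq // q.k = k} => m p.2.1.k * F p.2.1)
      (∑' q : Freq, m q.k * F q) :=
    ((Equiv.sigmaFiberEquiv fun q : Freq => q.k).hasSum_iff (f := fun q => m q.k * F q)).2 h.hasSum
  have h2 := h1.sigma fun k => (h1.summable.sigma_factor k).hasSum
  refine h2.congr_fun fun k => ?_
  have h3 : ∀ q : {q : Freq // q.k = k}, m q.1.k * F q.1 = m k * F q.1 := fun q => by rw [q.2]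
  simp only [h3]
  have h4 : ∑' q : {q : Freq // q.k = k}, F q.1 = ∑' q : Freq, {q : Freq | q.k = k}.indicator F q :=
    tsum_subtype {q : Freq | q.k = k} F
  rw [tsum_mul_left, h4]
  congr 1
  refine tsum_congr fun q => ?_
  classical
  simp only [Set.indicator_apply, Set.mem_ofPred_eq]

theorem IsFlow.mono {β T T' : ℝ} {A : Set ℤ} {U : ℝ → L2} (h : IsFlow β A T U) (h0 : 0 ≤ T')
    (hT : T' ≤ T) : IsFlow β A T' U where
  cont := h.cont
  q4_ne_top := ne_top_of_le_ne_top h.q4_ne_top (lintegral_mono_set (Set.Ioc_subset_Ioc_right hT))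
  supp := h.supp
  deriv k := (h.deriv k).mono le_rfl h0 hT

theorem IsFlow.lintegral_q3_ne_top {β T : ℝ} {A : Set ℤ} {U : ℝ → L2} (h : IsFlow β A T U) :
    ∫⁻ r in Set.Ioc 0 T, q3 (U r) ≠ ∞ := by
  have := h.q4_ne_top
  exact ne_top_of_le_ne_top (by finiteness) (lintegral_q3_le U 0 T)

theorem exists_enorm_le {U : ℝ → L2} (hU : Continuous U) (T : ℝ) :
    ∃ S : ℝ≥0∞, S ≠ ∞ ∧ ∀ r ∈ Set.Icc 0 T, ‖U r‖ₑ ≤ S := by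
  obtain ⟨S, hS⟩ := (isCompact_Icc (a := (0 : ℝ)) (b := T)).exists_bound_of_continuousOn
    hU.continuousOn
  exact ⟨ENNReal.ofReal S, ENNReal.ofReal_ne_top, fun r hr => by
    rw [← ofReal_norm]; exact ENNReal.ofReal_le_ofReal (hS r hr)⟩

section

variable {β c : ℝ} (hc : 0 < c) (hΦ : ∀ q : Freq, c * q.pr ≤ |phase β q.k₁ q.k₂ q.k₃|)
include hc hΦ

/-- One integration by parts tolerates any loss `mx^b` with `b < 1`: the kernel exponent `t` stays
above `1`, the coefficients enter through `L²` and the derivative through the supremum of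
`cubicHat`, at most `q3`. The case `b = 0` serves mass conservation and `b = 2s` the `H^s` energy
estimate. -/
theorem exists_tsum_quadInt_le {b : ℝ} (hb : b < 1) : ∃ C : ℝ≥0∞, C ≠ ∞ ∧
    ∀ {A : Set ℤ} {T : ℝ} {U : ℝ → L2} {S : ℝ≥0∞}, 0 < T → IsFlow β A T U → S ≠ ∞ →
      (∀ r ∈ Set.Icc 0 T, ‖U r‖ₑ ≤ S) →
      ∑' q : Freq, ENNReal.ofReal (q.mx ^ b) * ‖quadInt U 0 T q‖ₑ
        ≤ C * (S ^ 4 + S ^ 3 * ∫⁻ r in Set.Ioc 0 T, q3 (U r)) := by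
  set t : ℝ := 1 + (1 - b) / 2 with ht
  set C₁ : ℝ≥0∞ := ENNReal.ofReal c⁻¹ * (6 * brSum t ^ 2) with hC₁
  have hC₁t : C₁ ≠ ∞ := by
    have := brSum_ne_top (t := t) (by linarith)
    finiteness
  refine ⟨4 * C₁, by finiteness, ?_⟩
  intro A T U S hT hU hSt hS
  have hq : ∀ {B D : ℤ → ℝ≥0∞} {e : ℝ≥0∞}, (∀ k, B k ≤ e) → ∑' k, D k ^ 2 ≤ S ^ 2 →
      quadSum (fun q => ENNReal.ofReal (q.mx ^ b * |phase β q.k₁ q.k₂ q.k₃|⁻¹)) B D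
        ≤ C₁ * (e * S ^ 3) := fun hB hD => by
    refine (quadSum_const_mul_le (by positivity)
      (mx_rpow_mul_abs_phase_inv_le hc hΦ (a := 1 - b) (by linarith) (by linarith)) _ _).trans ?_
    rw [hC₁, mul_assoc]
    exact mul_le_mul' le_rfl (quadSum_kern_le _ hB hD)
  have hsq : ∀ r ∈ Set.Icc 0 T, ∑' k, ‖hat (U r) k‖ₑ ^ 2 ≤ S ^ 2 := fun r hr => by
    rw [tsum_enorm_hat_sq]; exact pow_le_pow_left' (hS r hr) 2
  have h := tsum_mul_quadInt_le hc hΦ hT hU.cont hU.deriv (invariant_of_mx_phase β b)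
    (w := fun q => ENNReal.ofReal (q.mx ^ b))
    (fun q => by rw [← ENNReal.ofReal_mul (Real.rpow_nonneg q.mx_pos.le _)])
    (K := C₁ * S ^ 4) (G := fun r => C₁ * S ^ 3 * q3 (U r)) (fun r hr => by
      refine (hq (fun k => (enorm_hat_le _ k).trans (hS r hr)) (hsq r hr)).trans (le_of_eq ?_)
      ring) (by
      filter_upwards [ae_restrict_mem measurableSet_Ioc] with r hr
      refine (hq (fun k => (enorm_drv_le β A U k r).trans (enorm_cubicHat_le _ _))
        (hsq r ⟨hr.1.le, hr.2⟩)).trans (le_of_eq ?_)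
      ring)
  refine h.trans ?_
  rw [lintegral_const_mul' _ _ (by finiteness)]
  calc _ ≤ 4 * (C₁ * S ^ 4) + 4 * (C₁ * S ^ 3 * ∫⁻ r in Set.Ioc 0 T, q3 (U r)) := by
        gcongr; norm_num
    _ = _ := by ring

theorem IsFlow.summable_mul_quadInt {A : Set ℤ} {T : ℝ} {U : ℝ → L2} (hT : 0 < T)
    (hU : IsFlow β A T U) {b : ℝ} (hb : b < 1) {m : Freq → ℂ}
    (hm : ∃ C : ℝ≥0∞, C ≠ ∞ ∧ ∀ q, ‖m q‖ₑ ≤ C * ENNReal.ofReal (q.mx ^ b)) :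
    Summable fun q => m q * quadInt U 0 T q := by
  obtain ⟨C, hC, h⟩ := exists_tsum_quadInt_le hc hΦ hb
  obtain ⟨S, hS, hS'⟩ := exists_enorm_le hU.cont T
  obtain ⟨C', hC', hm⟩ := hm
  have h3 := hU.lintegral_q3_ne_top
  have h4 : ∑' q, ‖m q * quadInt U 0 T q‖ₑ ≠ ∞ := by
    refine ne_top_of_le_ne_top (b := C' * (C * (S ^ 4 + S ^ 3 * ∫⁻ r in Set.Ioc 0 T, q3 (U r))))
      (by finiteness) ?_
    refine le_trans ?_ (mul_le_mul' le_rfl (h hT hU hS hS'))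
    rw [← ENNReal.tsum_mul_left]
    refine ENNReal.tsum_le_tsum fun q => ?_
    rw [enorm_mul, ← mul_assoc]
    exact mul_le_mul' (hm q) le_rfl
  exact Summable.of_enorm h4

theorem IsFlow.summable_quadInt {A : Set ℤ} {T : ℝ} {U : ℝ → L2} (hT : 0 < T)
    (hU : IsFlow β A T U) : Summable (quadInt U 0 T) := by
  have := hU.summable_mul_quadInt hc hΦ hT (b := 0) (m := fun _ => 1) (by norm_num)
    ⟨1, by simp, fun q => by simp⟩
  simpa using this

end

end

/-! ### Exchange of sum and time integral; conservation of the `L²` norm -/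

section

open Freq

/-- The largest `L²` norm on `[0, T]` of the frequencies above `N`. -/
def tailSup (U : ℝ → L2) (T : ℝ) (N : ℕ) : ℝ≥0∞ := ⨆ r ∈ Set.Icc 0 T, ‖U r - proj N (U r)‖ₑ

theorem le_tailSup (U : ℝ → L2) {T r : ℝ} (hr : r ∈ Set.Icc 0 T) (N : ℕ) :
    ‖U r - proj N (U r)‖ₑ ≤ tailSup U T N := le_iSup₂ (f := fun r (_ : r ∈ Set.Icc 0 T) =>
      ‖U r - proj N (U r)‖ₑ) r hr

theorem tendsto_tailSup {U : ℝ → L2} (hU : Continuous U) (T : ℝ) :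
    Tendsto (tailSup U T) atTop (𝓝 0) := by
  rw [ENNReal.tendsto_nhds_zero]
  intro ε hε
  rcases eq_or_ne ε ∞ with h | h
  · simp [h]
  have h1 := Metric.tendstoUniformlyOn_iff.1 (tendstoUniformlyOn_norm_sub_proj hU T) ε.toReal
    (ENNReal.toReal_pos hε.ne' h)
  filter_upwards [h1] with N hN
  refine iSup₂_le fun r hr => ?_
  have := hN r hr
  rw [dist_zero_left, norm_norm] at this
  rw [← ofReal_norm, ← ENNReal.ofReal_toReal h]
  exact ENNReal.ofReal_le_ofReal this.le

theorem tailSup_le {U : ℝ → L2} {T : ℝ} {S : ℝ≥0∞} (hS : ∀ r ∈ Set.Icc 0 T, ‖U r‖ₑ ≤ S) (N : ℕ) :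
    tailSup U T N ≤ S := by
  refine iSup₂_le fun r hr => le_trans ?_ (hS r hr)
  rw [← ofReal_norm, ← ofReal_norm]
  exact ENNReal.ofReal_le_ofReal (norm_sub_proj_le N _)

theorem intervalIntegrable_cubicHat {U : ℝ → L2} {T : ℝ} (hT : 0 ≤ T) (hU : Continuous U)
    (h4 : ∫⁻ r in Set.Ioc 0 T, q4 (U r) ≠ ∞) (k : ℤ) :
    IntervalIntegrable (fun r => cubicHat (U r) k) volume 0 T := by
  rw [intervalIntegrable_iff_integrableOn_Ioc_of_le hT]
  refine ⟨aestronglyMeasurable_cubicHat hU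
    ((ae_lt_top (measurable_q4_comp hU) h4).mono fun _ hr => hr.ne) k, ?_⟩
  rw [HasFiniteIntegral]
  refine lt_of_le_of_lt (lintegral_mono fun r => enorm_cubicHat_le _ _) ?_
  exact (lintegral_q3_le U 0 T).trans_lt (by finiteness)

theorem continuous_conj_hat {U : ℝ → L2} (hU : Continuous U) (k : ℤ) :
    Continuous fun r => conj (hat (U r) k) :=
  Complex.continuous_conj.comp ((continuous_hat k).comp hU)

/-- The nonresonant part of the interaction of the `k`-th mode with the nonlinearity `|g|² g`. -/
def interaction (g f : L2) (k : ℤ) : ℂ := cubicHat g k * conj (hat f k)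
  - ((2 * ‖g‖ ^ 2 * ‖hat f k‖ ^ 2 - ‖hat f k‖ ^ 4 : ℝ) : ℂ)

theorem sum_box_quadProd (f : L2) (k : ℤ) {N : ℕ} (hk : |k| ≤ N) :
    ∑ q ∈ box (freqs N) with q.k = k, quadProd f q = interaction (proj N f) f k := by
  have h := cubicHat_tpoly_mul_conj (freqs N) (hat f) (mem_freqs.2 hk)
  rw [interaction, proj_eq_tpoly, h, norm_tpoly_sq, add_sub_cancel_right]
  refine Finset.sum_congr rfl fun q hq => ?_
  have := mem_box.1 (Finset.mem_filter.1 hq).1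
  simp only [quadProd, hat_tpoly, this.1.1, this.1.2.1, this.1.2.2, this.2, if_true]

theorem intervalIntegrable_interaction {U W : ℝ → L2} {T : ℝ} (hT : 0 ≤ T) (hU : Continuous U)
    (hW : Continuous W) (h4 : ∫⁻ r in Set.Ioc 0 T, q4 (W r) ≠ ∞) (k : ℤ) :
    IntervalIntegrable (fun r => interaction (W r) (U r) k) volume 0 T := by
  have := (continuous_hat k).comp hU
  refine ((intervalIntegrable_cubicHat hT hW h4 k).mul_continuousOn
    (continuous_conj_hat hU k).continuousOn).sub (Continuous.intervalIntegrable ?_ _ _)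
  exact Complex.continuous_ofReal.comp (((continuous_const.mul (hW.norm.pow 2)).mul
    (this.norm.pow 2)).sub (this.norm.pow 4))

/-- The cubic part is linear in `‖f - proj N f‖`; in the resonant part the squares of the norms are
factored as a difference times a sum. The smallness `E` thus comes out in front. -/
theorem enorm_interaction_sub_le {f : L2} {N : ℕ} {S E : ℝ≥0∞} (hf : q4 f ≠ ∞)
    (hg : q4 (proj N f) ≠ ∞) (hS : ‖f‖ₑ ≤ S) (hE : ‖f - proj N f‖ₑ ≤ E) (k : ℤ) :
    ‖interaction (proj N f) f k - interaction f f k‖ₑ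
      ≤ E * (2 * ((2 + q4 (proj N f) + q4 f) * S) + 4 * S ^ 3) := by
  have e : interaction (proj N f) f k - interaction f f k
      = (cubicHat (proj N f) k - cubicHat f k) * conj (hat f k)
        + ((2 * ((‖f‖ - ‖proj N f‖) * (‖f‖ + ‖proj N f‖)) * ‖hat f k‖ ^ 2 : ℝ) : ℂ) := by
    simp only [interaction]; push_cast; ring
  have h1 : |‖f‖ - ‖proj N f‖| ≤ ‖f - proj N f‖ := abs_norm_sub_norm_le _ _
  have h2 : ‖hat f k‖ₑ ≤ S := (enorm_hat_le f k).trans hS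
  have h3 := norm_proj_le N f
  rw [e]
  refine (enorm_add_le _ _).trans ?_
  calc _ ≤ 2 * ((2 + q4 (proj N f) + q4 f) * E) * S + E * (4 * S ^ 3) := by
        refine add_le_add ?_ ?_
        · rw [enorm_mul, RCLike.enorm_conj]
          refine mul_le_mul' ((enorm_cubicHat_sub_le hg hf k).trans ?_) h2
          rw [← neg_sub, enorm_neg]
          gcongr
        · calc _ ≤ ENNReal.ofReal (2 * (‖f - proj N f‖ * (2 * ‖f‖)) * ‖hat f k‖ ^ 2) := by
                rw [← ofReal_norm, Complex.norm_real, Real.norm_eq_abs, abs_mul, abs_mul, abs_mul,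
                  abs_of_nonneg (by norm_num : (0 : ℝ) ≤ 2), abs_of_nonneg (sq_nonneg ‖hat f k‖),
                  abs_of_nonneg (by positivity : 0 ≤ ‖f‖ + ‖proj N f‖)]
                refine ENNReal.ofReal_le_ofReal ?_
                gcongr
                linarith
            _ = 2 * (‖f - proj N f‖ₑ * (2 * ‖f‖ₑ)) * ‖hat f k‖ₑ ^ 2 := by
                simp only [← ofReal_norm]
                rw [ENNReal.ofReal_mul (by positivity), ENNReal.ofReal_mul (by positivity),
                  ENNReal.ofReal_mul (by positivity), ENNReal.ofReal_mul (by positivity),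
                  ENNReal.ofReal_pow (norm_nonneg _)]
                norm_num
            _ ≤ 2 * (E * (2 * S)) * S ^ 2 := by gcongr
            _ = _ := by ring
    _ = _ := by ring

section

variable {β c : ℝ} (hc : 0 < c) (hΦ : ∀ q : Freq, c * q.pr ≤ |phase β q.k₁ q.k₂ q.k₃|)
include hc hΦ

/-- The `L⁴` norms of the truncations of a flow are uniformly bounded. -/
theorem IsFlow.exists_lintegral_q4_proj_le {A : Set ℤ} {T : ℝ} {U : ℝ → L2} (hT : 0 < T)
    (hU : IsFlow β A T U) :
    ∃ Q : ℝ≥0∞, Q ≠ ∞ ∧ ∀ N, ∫⁻ r in Set.Ioc 0 T, q4 (proj N (U r)) ≤ Q := by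
  obtain ⟨C, hC, h⟩ := exists_lintegral_q4_le hc hΦ
  obtain ⟨S, hS, hS'⟩ := exists_enorm_le hU.cont T
  have h3 := hU.lintegral_q3_ne_top
  have hg := gain_ne_top (T - 0)
  refine ⟨_, ?_, fun N => h hT ((continuous_proj N).comp hU.cont)
    (hasIntDeriv_osc_proj hU.deriv N) (h := fun r => q3 (U r)) (Eventually.of_forall fun r k => ?_)
    hS fun r hr => (enorm_proj_le N _).trans (hS' r hr)⟩
  · finiteness
  · split_ifs
    · exact (enorm_drv_le β A U k r).trans (enorm_cubicHat_le _ _)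
    · simp

/-- The exchange of the summation over the frequencies and of the time integration. -/
theorem IsFlow.tsum_fiber {A : Set ℤ} {T : ℝ} {U : ℝ → L2} (hT : 0 < T) (hU : IsFlow β A T U)
    (k : ℤ) : ∑' q : Freq, (if q.k = k then quadInt U 0 T q else 0)
      = ∫ r in (0 : ℝ)..T, interaction (U r) (U r) k := by
  obtain ⟨Q, hQ, hQ'⟩ := hU.exists_lintegral_q4_proj_le hc hΦ hT
  obtain ⟨S, hS, hS'⟩ := exists_enorm_le hU.cont T
  have hcN : ∀ N, Continuous fun r => proj N (U r) := fun N => (continuous_proj N).comp hU.cont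
  have hs : Summable fun q : Freq => if q.k = k then quadInt U 0 T q else 0 := by
    refine Summable.of_norm_bounded (hU.summable_quadInt hc hΦ hT).norm fun q => ?_
    split_ifs <;> simp
  have t1 := hs.hasSum.comp tendsto_box
  have t2 : Tendsto (fun N => ∫ r in (0 : ℝ)..T, interaction (proj N (U r)) (U r) k) atTop
      (𝓝 (∑' q : Freq, (if q.k = k then quadInt U 0 T q else 0))) := by
    refine t1.congr' ?_
    filter_upwards [eventually_ge_atTop k.natAbs] with N hN
    have hk : |k| ≤ N := by rw [abs_eq_max_neg]; omega
    simp only [Function.comp_apply, ← Finset.sum_filter]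
    rw [← intervalIntegral.integral_congr fun r _ => sum_box_quadProd (U r) k hk,
      intervalIntegral.integral_finsetSum fun q _ =>
        (continuous_quadProd hU.cont q).intervalIntegrable _ _]
    rfl
  -- The truncated integrals have just been identified with the box sums, which converge to the
  -- fiber sum. They also converge to the integral for `U`, since `tailSup` tends to zero against
  -- `L⁴` norms bounded in `N`.
  refine tendsto_nhds_unique t2 ?_
  rw [tendsto_iff_edist_tendsto_0]
  have hM : 2 * ((2 * ENNReal.ofReal T + Q + ∫⁻ r in Set.Ioc 0 T, q4 (U r)) * S)
      + 4 * S ^ 3 * ENNReal.ofReal T ≠ ∞ := by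
    have := hU.q4_ne_top
    finiteness
  have t3 := ENNReal.Tendsto.mul_const (tendsto_tailSup hU.cont T) (Or.inr hM)
  rw [zero_mul] at t3
  refine tendsto_of_tendsto_of_tendsto_of_le_of_le tendsto_const_nhds t3 (fun _ => zero_le) fun N => ?_
  have hN4 := ne_top_of_le_ne_top hQ (hQ' N)
  have hE : tailSup U T N ≠ ∞ := ne_top_of_le_ne_top hS (tailSup_le hS' N)
  rw [edist_eq_enorm_sub, ← intervalIntegral.integral_sub
    (intervalIntegrable_interaction hT.le hU.cont (hcN N) hN4 k)
    (intervalIntegrable_interaction hT.le hU.cont hU.cont hU.q4_ne_top k),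
    intervalIntegral.integral_of_le hT.le]
  refine (enorm_integral_le_lintegral_enorm _).trans ?_
  calc _ ≤ ∫⁻ r in Set.Ioc 0 T, tailSup U T N
          * (2 * ((2 + q4 (proj N (U r)) + q4 (U r)) * S) + 4 * S ^ 3) := by
        refine lintegral_mono_ae ?_
        filter_upwards [ae_restrict_mem measurableSet_Ioc, hU.ae_q4_ne_top,
          ae_lt_top (measurable_q4_comp (hcN N)) hN4] with r hr h1 h2
        have hr' : r ∈ Set.Icc 0 T := ⟨hr.1.le, hr.2⟩
        exact enorm_interaction_sub_le h1 h2.ne (hS' r hr') (le_tailSup U hr' N) k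
    _ = tailSup U T N * (2 * ((2 * ENNReal.ofReal T + (∫⁻ r in Set.Ioc 0 T, q4 (proj N (U r)))
          + ∫⁻ r in Set.Ioc 0 T, q4 (U r)) * S) + 4 * S ^ 3 * ENNReal.ofReal T) := by
        rw [lintegral_const_mul' _ _ hE, lintegral_add_right _ measurable_const,
          lintegral_const_mul' _ _ (by simp), lintegral_mul_const' _ _ hS,
          lintegral_add_right _ (measurable_q4_comp hU.cont),
          lintegral_add_left measurable_const, setLIntegral_const, setLIntegral_const,
          Real.volume_Ioc, sub_zero]
    _ ≤ _ := by gcongr; exact hQ' N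

/-- The derivative of `|hat (U r) k|²` is `-2` times the imaginary part of the interaction, from
which real resonant terms drop out. For `k ∉ A` the coefficient vanishes at all times, and so does
the interaction. -/
theorem IsFlow.norm_hat_sq_sub {A : Set ℤ} {T : ℝ} {U : ℝ → L2} (hT : 0 < T)
    (hU : IsFlow β A T U) (k : ℤ) : ‖hat (U T) k‖ ^ 2 - ‖hat (U 0) k‖ ^ 2
      = -2 * (∑' q : Freq, (if q.k = k then quadInt U 0 T q else 0)).im := by
  rw [hU.tsum_fiber hc hΦ hT k]
  by_cases hk : k ∈ A
  · have h0 := ((hU.deriv k).mul ((hU.deriv k).conjugate hT.le) hT.le).integral_eq hT.le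
    have hsq : ∀ r, osc β U k r * conj (osc β U k r) = ((‖hat (U r) k‖ ^ 2 : ℝ) : ℂ) := fun r => by
      rw [Complex.mul_conj, Complex.normSq_eq_norm_sq, osc, norm_mul, norm_cexp_neg_I_mul, one_mul]
    have hd : ∀ r, drv β A U k r * conj (osc β U k r)
        = Complex.I * (cubicHat (U r) k * conj (hat (U r) k)) := fun r => by
      rw [drv, Set.indicator_of_mem hk, osc, map_mul]
      have : Complex.exp (-(Complex.I * (r * disp β k : ℝ)))
          * conj (Complex.exp (-(Complex.I * (r * disp β k : ℝ)))) = 1 := by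
        rw [Complex.mul_conj, Complex.normSq_eq_norm_sq, norm_cexp_neg_I_mul]; simp
      linear_combination (Complex.I * cubicHat (U r) k * conj (hat (U r) k)) * this
    have e : ∀ r, drv β A U k r * conj (osc β U k r) + osc β U k r * conj (drv β A U k r)
        = ((-2 * (interaction (U r) (U r) k).im : ℝ) : ℂ) := fun r => by
      have h1 : osc β U k r * conj (drv β A U k r) = conj (drv β A U k r * conj (osc β U k r)) := by
        rw [map_mul, Complex.conj_conj, mul_comm]
      rw [h1, Complex.add_conj, hd, interaction, Complex.sub_im, Complex.ofReal_im, sub_zero]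
      simp
      ring
    simp only [e, hsq] at h0
    rw [intervalIntegral.integral_ofReal, ← Complex.ofReal_sub, Complex.ofReal_inj,
      intervalIntegral.integral_const_mul] at h0
    rw [← h0, intervalIntegral.integral_of_le hT.le, intervalIntegral.integral_of_le hT.le]
    congr 1
    exact integral_im (𝕜 := ℂ)
      (intervalIntegrable_interaction hT.le hU.cont hU.cont hU.q4_ne_top k).1
  · simp [interaction, hU.supp _ k hk]

theorem IsFlow.hasSum_norm_hat_sq_sub {A : Set ℤ} {T : ℝ} {U : ℝ → L2} (hT : 0 < T)
    (hU : IsFlow β A T U) {m : ℤ → ℝ} (hm : Summable fun q : Freq => (m q.k : ℂ) * quadInt U 0 T q) :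
    HasSum (fun k => m k * (‖hat (U T) k‖ ^ 2 - ‖hat (U 0) k‖ ^ 2))
      (-2 * (∑' q : Freq, (m q.k : ℂ) * quadInt U 0 T q).im) := by
  have h := (Complex.imCLM.hasSum (hasSum_fiber (m := fun k => (m k : ℂ)) hm)).mul_left (-2)
  refine h.congr_fun fun k => ?_
  rw [hU.norm_hat_sq_sub hc hΦ hT]
  simp only [Complex.imCLM_apply, Complex.im_ofReal_mul]
  ring

/-- Conservation of the `L²` norm. -/
theorem IsFlow.norm_eq {A : Set ℤ} {T : ℝ} {U : ℝ → L2} (hU : IsFlow β A T U) {t : ℝ}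
    (ht : t ∈ Set.Icc 0 T) : ‖U t‖ = ‖U 0‖ := by
  rcases ht.1.eq_or_lt with h0 | h0
  · rw [← h0]
  have hV := hU.mono h0.le ht.2
  have hs := hV.summable_quadInt hc hΦ h0
  have h1 := hV.hasSum_norm_hat_sq_sub hc hΦ h0 (m := fun _ => 1) (by simpa using hs)
  simp only [Complex.ofReal_one, one_mul] at h1
  have h2 := (hasSum_norm_hat_sq (U t)).sub (hasSum_norm_hat_sq (U 0))
  have h3 := h1.unique h2
  -- The exchange `k ↔ k₁`, `k₂ ↔ k₃` conjugates the product, so the total sum is real and the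
  -- variation of the `L²` norm vanishes.
  have h4 : ∑' q, quadInt U 0 t q = conj (∑' q, quadInt U 0 t q) := by
    rw [Complex.conj_tsum, ← swap₁.tsum_eq]
    refine tsum_congr fun q => ?_
    simp only [quadInt, intervalIntegral.integral_of_le h0.le]
    rw [← integral_conj]
    refine integral_congr_ae (Eventually.of_forall fun r => ?_)
    simp only [quadProd, swap₁, Equiv.coe_fn_mk, map_mul, Complex.conj_conj]
    ring
  rw [Complex.conj_eq_iff_im.1 h4.symm] at h3
  have h5 : ‖U t‖ ^ 2 = ‖U 0‖ ^ 2 := by linarith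
  exact (pow_left_inj₀ (norm_nonneg _) (norm_nonneg _) two_ne_zero).1 h5

end

end

/-! ### A priori bounds in `L⁴` and `H^s`, and the quadrilinear bound -/

section

open Freq

/-- The cubic norm costs an arbitrarily small multiple of the quartic one plus a constant; this
subcriticality allows absorption without restricting the length of the time interval. -/
theorem lintegral_q3_le_weighted (U : ℝ → L2) (a b : ℝ) {m : ℝ≥0∞} (hm : m ≠ 0) (hm' : m ≠ ∞) :
    ∫⁻ r in Set.Ioc a b, q3 (U r)
      ≤ m * (∫⁻ r in Set.Ioc a b, q4 (U r)) + (m ^ 3)⁻¹ * ENNReal.ofReal (b - a) := by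
  have h : ∀ f : L2, q3 f ≤ m * q4 f + (m ^ 3)⁻¹ := fun f => by
    calc q3 f ≤ ∫⁻ x, (m * ‖(f : Torus → ℂ) x‖ₑ ^ 4 + (m ^ 3)⁻¹) ∂haarT :=
          lintegral_mono fun x => by simpa using pow_three_mul_le ‖(f : Torus → ℂ) x‖ₑ 1 hm hm'
      _ = _ := by
          rw [lintegral_add_right _ measurable_const, lintegral_const_mul' _ _ hm']; simp [q4]
  refine (lintegral_mono fun r => h (U r)).trans (le_of_eq ?_)
  rw [lintegral_add_right _ measurable_const, lintegral_const_mul' _ _ hm', setLIntegral_const,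
    Real.volume_Ioc]

/-- The square of the `H^s` norm, as an extended nonnegative number. -/
def hsSq (s : ℝ) (f : L2) : ℝ≥0∞ := ∑' k, (ENNReal.ofReal (jb k ^ s) * ‖hat f k‖ₑ) ^ 2

theorem ofReal_jb_mul_sq (s : ℝ) (f : L2) (k : ℤ) : (ENNReal.ofReal (jb k ^ s) * ‖hat f k‖ₑ) ^ 2
    = ENNReal.ofReal (jb k ^ (2 * s) * ‖hat f k‖ ^ 2) := by
  rw [← ofReal_norm, ← ENNReal.ofReal_mul (jb_rpow_nonneg _ _), ← ENNReal.ofReal_pow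
    (mul_nonneg (jb_rpow_nonneg _ _) (norm_nonneg _)), mul_pow, ← Real.rpow_natCast (jb k ^ s),
    ← Real.rpow_mul (jb_pos k).le, Nat.cast_ofNat, mul_comm s]

theorem jb_mul_sq_nonneg (s : ℝ) (f : L2) (k : ℤ) : 0 ≤ jb k ^ (2 * s) * ‖hat f k‖ ^ 2 :=
  mul_nonneg (jb_rpow_nonneg _ _) (sq_nonneg _)

theorem MemHs.hsSq_eq {s : ℝ} {f : L2} (h : MemHs s f) : hsSq s f = ENNReal.ofReal (hsNorm s f) ^ 2 := by
  rw [hsNorm, ← ENNReal.ofReal_pow (Real.sqrt_nonneg _),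
    Real.sq_sqrt (tsum_nonneg fun k => jb_mul_sq_nonneg s f k),
    ENNReal.ofReal_tsum_of_nonneg (fun k => jb_mul_sq_nonneg s f k) h, hsSq]
  exact tsum_congr fun k => ofReal_jb_mul_sq s f k

theorem enorm_sq_le_hsSq {s : ℝ} (hs : 0 ≤ s) (f : L2) : ‖f‖ₑ ^ 2 ≤ hsSq s f := by
  rw [← tsum_enorm_hat_sq, hsSq]
  refine ENNReal.tsum_le_tsum fun k => pow_le_pow_left' (le_mul_of_one_le_left' ?_) 2
  rw [← ENNReal.ofReal_one]
  exact ENNReal.ofReal_le_ofReal (Real.one_le_rpow (one_le_jb k) hs)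

theorem jb_rpow_le_mx {a : ℝ} (ha : 0 ≤ a) (q : Freq) : jb q.k ^ a ≤ 3 ^ a * q.mx ^ a := by
  rw [← Real.mul_rpow (by norm_num) q.mx_pos.le]
  exact Real.rpow_le_rpow (jb_pos _).le ((jb_le_br _).trans (br_le_mx q.abs_le.1.1)) ha

theorem enorm_jb_rpow_le {a : ℝ} (ha : 0 ≤ a) (q : Freq) : ‖((jb q.k ^ a : ℝ) : ℂ)‖ₑ
    ≤ ENNReal.ofReal (3 ^ a) * ENNReal.ofReal (q.mx ^ a) := by
  rw [← ofReal_norm, Complex.norm_real, Real.norm_of_nonneg (jb_rpow_nonneg _ _),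
    ← ENNReal.ofReal_mul (by positivity)]
  exact ENNReal.ofReal_le_ofReal (jb_rpow_le_mx ha q)

section

variable {β c : ℝ} (hc : 0 < c) (hΦ : ∀ q : Freq, c * q.pr ≤ |phase β q.k₁ q.k₂ q.k₃|)
include hc hΦ

theorem IsFlow.enorm_eq {A : Set ℤ} {T : ℝ} {U : ℝ → L2} (hU : IsFlow β A T U) {t : ℝ}
    (ht : t ∈ Set.Icc 0 T) : ‖U t‖ₑ = ‖U 0‖ₑ := by
  rw [← ofReal_norm, ← ofReal_norm, hU.norm_eq hc hΦ ht]

/-- The a priori bound for the space-time `L⁴` norm. -/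
theorem exists_lintegral_q4_bound : ∃ B : ℝ≥0∞ → ℝ → ℝ≥0∞, (∀ S T, S ≠ ∞ → B S T ≠ ∞) ∧
    ∀ {A : Set ℤ} {T : ℝ} {U : ℝ → L2} {S : ℝ≥0∞}, 0 < T → IsFlow β A T U → S ≠ ∞ → ‖U 0‖ₑ ≤ S →
      ∫⁻ r in Set.Ioc 0 T, q4 (U r) ≤ B S T := by
  obtain ⟨C, hC, h⟩ := exists_lintegral_q4_le hc hΦ
  refine ⟨fun S T => 2 * (C * gain T * S ^ 3 * S + C * gain T * S ^ 3
    * ((2 * (C * gain T * S ^ 3 + 1)) ^ 3 * ENNReal.ofReal T)), fun S T hS => ?_, ?_⟩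
  · have := gain_ne_top T
    finiteness
  intro A T U S hT hU hS hS'
  have hS'' : ∀ r ∈ Set.Icc 0 T, ‖U r‖ₑ ≤ S := fun r hr => by rwa [hU.enorm_eq hc hΦ hr]
  have h1 := h hT hU.cont hU.deriv (h := fun r => q3 (U r)) (Eventually.of_forall fun r k =>
    (enorm_drv_le β A U k r).trans (enorm_cubicHat_le _ _)) hS hS''
  rw [sub_zero] at h1
  have hg := gain_ne_top T
  set L := C * gain T * S ^ 3 with hL
  have hLt : L ≠ ∞ := by finiteness
  -- Chosen so that `L * m ≤ 1/2`: half of `Q` is absorbed on the left, legitimately because the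
  -- definition of a flow makes `Q` finite.
  set m : ℝ≥0∞ := (2 * (L + 1))⁻¹ with hm
  have hm0 : m ≠ 0 := ENNReal.inv_ne_zero.2 (by finiteness)
  have hmt : m ≠ ∞ := ENNReal.inv_ne_top.2 (by positivity)
  have h2 := lintegral_q3_le_weighted U 0 T hm0 hmt
  rw [sub_zero] at h2
  set Q := ∫⁻ r in Set.Ioc 0 T, q4 (U r) with hQ
  have hQt : Q ≠ ∞ := hU.q4_ne_top
  have hLm : L * m ≤ 2⁻¹ := by
    rw [hm, ENNReal.mul_inv (by simp) (by simp), mul_left_comm]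
    refine mul_le_of_le_one_right' ?_
    rw [← div_eq_mul_inv]
    exact ENNReal.div_le_of_le_mul (by rw [one_mul]; exact le_self_add)
  have h3 : Q ≤ 2⁻¹ * Q + (L * S + L * ((2 * (L + 1)) ^ 3 * ENNReal.ofReal T)) := by
    calc Q ≤ C * gain T * (S ^ 4 + S ^ 3 * (m * Q + (m ^ 3)⁻¹ * ENNReal.ofReal T)) :=
          h1.trans (by gcongr)
      _ = (L * m) * Q + (L * S + L * ((m ^ 3)⁻¹ * ENNReal.ofReal T)) := by rw [hL]; ring
      _ ≤ _ := by
          have : (m ^ 3)⁻¹ = (2 * (L + 1)) ^ 3 := by rw [hm, ENNReal.inv_pow, inv_inv]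
          rw [this]
          gcongr
  have h4 : 2⁻¹ * Q ≤ L * S + L * ((2 * (L + 1)) ^ 3 * ENNReal.ofReal T) := by
    have h5 : 2⁻¹ * Q + 2⁻¹ * Q = Q := by rw [← add_mul, ENNReal.inv_two_add_inv_two, one_mul]
    have h6 : 2⁻¹ * Q ≠ ∞ := by finiteness
    rw [← ENNReal.add_le_add_iff_left h6, h5]
    exact h3
  calc Q = 2 * (2⁻¹ * Q) := by
        rw [← mul_assoc, ENNReal.mul_inv_cancel (by simp) (by simp), one_mul]
    _ ≤ _ := mul_le_mul' le_rfl h4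

/-- The energy estimate in `H^s`, for small `s`. -/
theorem exists_hsSq_le {s : ℝ} (hs : 0 ≤ s) (hs' : 2 * s < 1) : ∃ C : ℝ≥0∞, C ≠ ∞ ∧
    ∀ {A : Set ℤ} {T : ℝ} {U : ℝ → L2}, IsFlow β A T U → MemHs s (U 0) →
      ∀ t ∈ Set.Icc 0 T, hsSq s (U t)
        ≤ hsSq s (U 0) * (1 + C * (‖U 0‖ₑ ^ 2 + ‖U 0‖ₑ * ∫⁻ r in Set.Ioc 0 T, q3 (U r))) := by
  obtain ⟨C, hC, h⟩ := exists_tsum_quadInt_le hc hΦ hs'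
  refine ⟨2 * (ENNReal.ofReal (3 ^ (2 * s)) * C), by finiteness, ?_⟩
  intro A T U hU h0 t ht
  rcases ht.1.eq_or_lt with ht0 | ht0
  · rw [← ht0]; exact le_mul_of_one_le_right' le_self_add
  have hV := hU.mono ht0.le ht.2
  have hnorm : ∀ r ∈ Set.Icc 0 t, ‖U r‖ₑ ≤ ‖U 0‖ₑ := fun r hr =>
    (hV.enorm_eq hc hΦ hr).le
  have hb := h ht0 hV enorm_ne_top hnorm
  have hm := hV.summable_mul_quadInt hc hΦ ht0 hs'
    (m := fun q => ((jb q.k ^ (2 * s) : ℝ) : ℂ))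
    ⟨ENNReal.ofReal (3 ^ (2 * s)), by finiteness, enorm_jb_rpow_le (by linarith)⟩
  have h1 := hV.hasSum_norm_hat_sq_sub hc hΦ ht0 (m := fun k => jb k ^ (2 * s)) hm
  have h2 := h1.add h0.hasSum
  have h3 : HasSum (fun k => jb k ^ (2 * s) * ‖hat (U t) k‖ ^ 2) _ :=
    h2.congr_fun fun k => by ring
  have e1 : hsSq s (U t) = ENNReal.ofReal (∑' k, jb k ^ (2 * s) * ‖hat (U t) k‖ ^ 2) := by
    rw [ENNReal.ofReal_tsum_of_nonneg (fun k => jb_mul_sq_nonneg s _ k) h3.summable, hsSq]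
    exact tsum_congr fun k => ofReal_jb_mul_sq s _ k
  have e2 : hsSq s (U 0) = ENNReal.ofReal (∑' k, jb k ^ (2 * s) * ‖hat (U 0) k‖ ^ 2) := by
    rw [ENNReal.ofReal_tsum_of_nonneg (fun k => jb_mul_sq_nonneg s _ k) h0, hsSq]
    exact tsum_congr fun k => ofReal_jb_mul_sq s _ k
  have h4 : ENNReal.ofReal (-2 * (∑' q : Freq, ((jb q.k ^ (2 * s) : ℝ) : ℂ) * quadInt U 0 t q).im)
      ≤ 2 * (ENNReal.ofReal (3 ^ (2 * s)) * (C * (‖U 0‖ₑ ^ 4 + ‖U 0‖ₑ ^ 3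
        * ∫⁻ r in Set.Ioc 0 t, q3 (U r)))) := by
    calc _ ≤ ENNReal.ofReal (2 * ‖∑' q : Freq, ((jb q.k ^ (2 * s) : ℝ) : ℂ) * quadInt U 0 t q‖) := by
          refine ENNReal.ofReal_le_ofReal ?_
          have := neg_le_of_abs_le (Complex.abs_im_le_norm
            (∑' q : Freq, ((jb q.k ^ (2 * s) : ℝ) : ℂ) * quadInt U 0 t q))
          linarith
      _ = 2 * ‖∑' q : Freq, ((jb q.k ^ (2 * s) : ℝ) : ℂ) * quadInt U 0 t q‖ₑ := by
          rw [ENNReal.ofReal_mul (by norm_num), ofReal_norm]; norm_num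
      _ ≤ _ := by
          refine mul_le_mul' le_rfl ((enorm_tsum_le_tsum_enorm).trans ?_)
          refine le_trans ?_ (mul_le_mul' le_rfl hb)
          rw [← ENNReal.tsum_mul_left]
          refine ENNReal.tsum_le_tsum fun q => ?_
          rw [enorm_mul, ← mul_assoc]
          exact mul_le_mul' (enorm_jb_rpow_le (by linarith) q) le_rfl
  rw [e1, h3.tsum_eq, add_comm]
  refine ENNReal.ofReal_add_le.trans ?_
  rw [← e2]
  refine (add_le_add le_rfl h4).trans ?_
  calc _ ≤ hsSq s (U 0) + 2 * (ENNReal.ofReal (3 ^ (2 * s)) * C) * (‖U 0‖ₑ ^ 2 * (‖U 0‖ₑ ^ 2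
        + ‖U 0‖ₑ * ∫⁻ r in Set.Ioc 0 T, q3 (U r))) := by
        have : ∫⁻ r in Set.Ioc 0 t, q3 (U r) ≤ ∫⁻ r in Set.Ioc 0 T, q3 (U r) :=
          lintegral_mono_set (Set.Ioc_subset_Ioc_right ht.2)
        calc _ ≤ hsSq s (U 0) + 2 * (ENNReal.ofReal (3 ^ (2 * s)) * (C * (‖U 0‖ₑ ^ 4 + ‖U 0‖ₑ ^ 3
              * ∫⁻ r in Set.Ioc 0 T, q3 (U r)))) := by gcongr
          _ = _ := by ring
    _ ≤ hsSq s (U 0) + 2 * (ENNReal.ofReal (3 ^ (2 * s)) * C) * (hsSq s (U 0) * (‖U 0‖ₑ ^ 2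
        + ‖U 0‖ₑ * ∫⁻ r in Set.Ioc 0 T, q3 (U r))) := by
        gcongr; exact enorm_sq_le_hsSq hs _
    _ = _ := by ring

/-- The bound for the quadrilinear sum. -/
theorem exists_tsum_mx_quadInt_le {α s δ η : ℝ} (hα : 1 / 2 ≤ α) (hα' : α ≤ 1) (hδ : 0 ≤ δ)
    (hη : 0 < η) (hsδ : η ≤ s - δ) (hs2 : 2 * s < 1) (hρ : 2 * α - 2 + δ + 3 / 8 ≤ s - δ - η)
    (hs' : 2 * α - 1 + δ - 3 * s ≤ -(2 * η)) :
    ∃ B : ℝ≥0∞ → ℝ → ℝ≥0∞, (∀ S T, S ≠ ∞ → B S T ≠ ∞) ∧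
      ∀ {A : Set ℤ} {T : ℝ} {U : ℝ → L2} {S : ℝ≥0∞}, 0 < T → IsFlow β A T U → MemHs s (U 0) →
        S ≠ ∞ → ‖U 0‖ₑ ≤ S →
        ∑' q : Freq, ENNReal.ofReal (q.mx ^ (2 * α + δ)) * ‖quadInt U 0 T q‖ₑ
          ≤ B S T * ENNReal.ofReal (hsNorm s (U 0)) ^ 3 := by
  have hs0 : 0 ≤ s := by linarith
  obtain ⟨C₁, hC₁, h₁⟩ := exists_quadSum_le hc hΦ hα hα' hδ hη hsδ (by linarith) hρ hs'
  obtain ⟨C₂, hC₂, h₂⟩ := exists_hsSq_le hc hΦ hs0 hs2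
  obtain ⟨C₃, hC₃, h₃⟩ := exists_cubicHat_weighted_le
  obtain ⟨B, hB, h₄⟩ := exists_lintegral_q4_bound hc hΦ
  -- The growth factor of the squared `H^s` norm on `[0, T]`, in terms of the `L²` size `S` and of
  -- `T` only.
  set M : ℝ≥0∞ → ℝ → ℝ≥0∞ := fun S T => 1 + C₂ * (S ^ 2 + S * (ENNReal.ofReal T + B S T)) with hM
  have hMt : ∀ S T, S ≠ ∞ → M S T ≠ ∞ := fun S T hS => by
    have := hB S T hS
    simp only [hM]; finiteness
  refine ⟨fun S T => (3 * (C₁ * S) + 4 * (C₁ * (B S T + (C₃ + 1) * ENNReal.ofReal T))) * M S T ^ 3,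
    fun S T hS => ?_, ?_⟩
  · have := hB S T hS
    have := hMt S T hS
    finiteness
  intro A T U S hT hU h0 hS hUS
  have hBt := hB S T hS
  have hQ := h₄ hT hU hS hUS
  set b : ℝ≥0∞ := ENNReal.ofReal (hsNorm s (U 0)) * M S T with hb
  have hbt : b ≠ ∞ := by
    have := hMt S T hS
    finiteness
  have hH : ∀ r ∈ Set.Icc 0 T, hsSq s (U r) ≤ b ^ 2 := fun r hr => by
    have hM1 : 1 ≤ M S T := le_self_add
    refine (h₂ hU h0 r hr).trans ?_
    rw [h0.hsSq_eq, hb, mul_pow]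
    -- As `M ≥ 1`, the factor `M` of the squared norm is bounded by `M²`, so that the norm itself is
    -- at most `b`, linear in the initial `H^s` norm.
    refine mul_le_mul' le_rfl (le_trans ?_ (le_self_pow hM1 two_ne_zero))
    simp only [hM]
    have := lintegral_q3_le U 0 T
    rw [sub_zero] at this
    gcongr
    exact this.trans (by gcongr)
  have hUS' : ∀ r ∈ Set.Icc 0 T, ‖U r‖ₑ ≤ S := fun r hr => by rwa [hU.enorm_eq hc hΦ hr]
  have h := tsum_mul_quadInt_le hc hΦ hT hU.cont hU.deriv (invariant_of_mx_phase β (2 * α + δ))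
    (w := fun q => ENNReal.ofReal (q.mx ^ (2 * α + δ)))
    (fun q => by rw [← ENNReal.ofReal_mul (Real.rpow_nonneg q.mx_pos.le _)])
    (K := C₁ * (S * b ^ 3)) (G := fun r => C₁ * b ^ 3 * (q4 (U r) + (C₃ + 1))) (fun r hr => by
      refine h₁ _ _ S b (fun k => (enorm_hat_le _ k).trans (hUS' r hr)) ?_ (hH r hr)
      refine le_trans ?_ (pow_le_pow_left' (hUS' r hr) 2)
      rw [← tsum_enorm_hat_sq]
      refine ENNReal.tsum_le_tsum fun k => pow_le_pow_left' (mul_le_of_le_one_left' ?_) 2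
      rw [← ENNReal.ofReal_one]
      exact ENNReal.ofReal_le_ofReal (Real.rpow_le_one_of_one_le_of_nonpos (one_le_jb k)
        (by norm_num))) (by
      filter_upwards [ae_restrict_mem measurableSet_Ioc, hU.ae_q4_ne_top] with r hr hr4
      refine (h₁ _ _ (q4 (U r) + (C₃ + 1)) b (fun k => ?_) ?_ (hH r ⟨hr.1.le, hr.2⟩)).trans
        (le_of_eq (by ring))
      · refine (enorm_drv_le β A U k r).trans ((enorm_cubicHat_le _ _).trans ((q3_le _).trans ?_))
        rw [add_comm]; gcongr; exact le_add_self
      · refine le_trans (ENNReal.tsum_le_tsum fun k => ?_) ((h₃ (U r) hr4).trans ?_)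
        · exact pow_le_pow_left' (mul_le_mul' le_rfl (enorm_drv_le β A U k r)) 2
        · gcongr; exact le_self_add)
  refine h.trans ?_
  rw [lintegral_const_mul' _ _ (by finiteness), lintegral_add_right _ measurable_const,
    setLIntegral_const, Real.volume_Ioc, sub_zero]
  calc _ ≤ 3 * (C₁ * (S * b ^ 3)) + 4 * (C₁ * b ^ 3 * (B S T + (C₃ + 1) * ENNReal.ofReal T)) := by
        gcongr
    _ = _ := by rw [hb]; ring

end

end

/-! ### The functional along a single flow -/

section

open Freq

/-- The phases of the interaction representation cancel against `e^{-irΦ}`: each term is the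
weighted time integral of a plain product of Fourier coefficients at time `-r`. -/
theorem quadTerm_eq (α β T : ℝ) (u : ℝ → L2) (q : Freq) : quadTerm α β T u q
    = ((jb q.k ^ (2 * α) : ℝ) : ℂ) * quadInt (fun r => u (-r)) 0 T q := by
  have hv : ∀ r k, vhat β u (-r) k = osc β (fun r => u (-r)) k r := fun r k => by
    rw [vhat, osc]; congr 2; push_cast; ring
  rw [quadTerm, quadInt, ← intervalIntegral.integral_const_mul]
  refine intervalIntegral.integral_congr fun r _ => ?_
  have h := quadProd_eq_osc β (fun r => u (-r)) q r
  simp only [hv]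
  linear_combination (-((jb q.k ^ (2 * α) : ℝ) : ℂ)) * h

theorem integral_norm_sq (f : L2) : ∫ y : Torus, ‖(f : Torus → ℂ) y‖ ^ 2 = 2 * Real.pi * ‖f‖ ^ 2 := by
  rw [AddCircle.volume_eq_smul_haarAddCircle, integral_smul_measure,
    ENNReal.toReal_ofReal Real.two_pi_pos.le, smul_eq_mul]
  congr 1
  have h := enorm_sq_eq_lintegral f
  have h2 : ∫ y, ‖(f : Torus → ℂ) y‖ ^ 2 ∂haarT = (∫⁻ y, ‖(f : Torus → ℂ) y‖ₑ ^ 2 ∂haarT).toReal := by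
    rw [integral_eq_lintegral_of_nonneg_ae (Eventually.of_forall fun _ => sq_nonneg _)
      ((aestronglyMeasurable_coe f).norm.pow 2)]
    congr 1
    refine lintegral_congr fun x => ?_
    rw [ENNReal.ofReal_pow (norm_nonneg _), ofReal_norm]
  rw [h2, ← h, ENNReal.toReal_pow, toReal_enorm]

/-- The subtraction of `‖f‖²/π`, equal to `2‖f‖²` in the normalized norm, removes the resonant terms
up to the diagonal one `|hat f k|⁴`. That one is real and disappears in the imaginary part. -/
theorem interactionTerm_eq (α : ℝ) {f : L2} (hf : q4 f ≠ ∞) (k : ℤ) : interactionTerm α f k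
    = ((2 * Real.pi * jb k ^ (2 * α) : ℝ) : ℂ)
      * (interaction f f k - ((‖hat f k‖ ^ 4 : ℝ) : ℂ)) := by
  have hsq : hat f k * conj (hat f k) = ((‖hat f k‖ ^ 2 : ℝ) : ℂ) := by
    rw [Complex.mul_conj, Complex.normSq_eq_norm_sq]
  have hL2 : Integrable (f : Torus → ℂ) haarT := (Lp.memLp f).integrable (by norm_num)
  have e : (fun x : Torus =>
      ((‖(f : Torus → ℂ) x‖ ^ 2 - 1 / Real.pi * ∫ y : Torus, ‖(f : Torus → ℂ) y‖ ^ 2 : ℝ) : ℂ)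
        * (f : Torus → ℂ) x) = fun x => cube (f x) - ((2 * ‖f‖ ^ 2 : ℝ) : ℂ) * f x := by
    funext x
    rw [integral_norm_sq, cube]
    have : 1 / Real.pi * (2 * Real.pi * ‖f‖ ^ 2) = 2 * ‖f‖ ^ 2 := by
      field_simp
    rw [this]; push_cast; ring
  have e2 : fourierCoeff (fun x => cube (f x) - ((2 * ‖f‖ ^ 2 : ℝ) : ℂ) * f x) k
      = cubicHat f k - ((2 * ‖f‖ ^ 2 : ℝ) : ℂ) * hat f k := by
    rw [cubicHat_eq, hat, fourierCoeff, fourierCoeff, fourierCoeff, ← integral_const_mul,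
      ← integral_sub ((integrable_cube (q3_ne_top hf)).fourier_smul (-k))
        ((hL2.fourier_smul (-k)).const_mul _)]
    refine integral_congr_ae (Eventually.of_forall fun x => ?_)
    simp only [smul_eq_mul]; ring
  rw [interactionTerm, e, e2, interaction, map_mul, Complex.conj_ofReal]
  push_cast at hsq ⊢
  linear_combination (-(4 * Real.pi * ((jb k ^ (2 * α) : ℝ) : ℂ) * (‖f‖ : ℂ) ^ 2)) * hsq

section

variable {β c : ℝ} (hc : 0 < c) (hΦ : ∀ q : Freq, c * q.pr ≤ |phase β q.k₁ q.k₂ q.k₃|)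
include hc hΦ

theorem IsFlow.hasSum_interactionTerm {A : Set ℤ} {T : ℝ} {U : ℝ → L2} (hT : 0 < T)
    (hU : IsFlow β A T U) {α : ℝ}
    (hs : Summable fun q : Freq => ((jb q.k ^ (2 * α) : ℝ) : ℂ) * quadInt U 0 T q) :
    HasSum (fun k => (∫ r in (0 : ℝ)..T, interactionTerm α (U r) k).im)
      (2 * Real.pi * (∑' q : Freq, ((jb q.k ^ (2 * α) : ℝ) : ℂ) * quadInt U 0 T q).im) := by
  have h := (Complex.imCLM.hasSum (hasSum_fiber (m := fun k => ((jb k ^ (2 * α) : ℝ) : ℂ))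
    hs)).mul_left (2 * Real.pi)
  refine h.congr_fun fun k => ?_
  rw [hU.tsum_fiber hc hΦ hT k]
  have hk : Continuous fun r => ((‖hat (U r) k‖ ^ 4 : ℝ) : ℂ) :=
    Complex.continuous_ofReal.comp (((continuous_hat k).comp hU.cont).norm.pow 4)
  have e : ∫ r in (0 : ℝ)..T, interactionTerm α (U r) k
      = ((2 * Real.pi * jb k ^ (2 * α) : ℝ) : ℂ) * ((∫ r in (0 : ℝ)..T, interaction (U r) (U r) k)
        - ((∫ r in (0 : ℝ)..T, ‖hat (U r) k‖ ^ 4 : ℝ) : ℂ)) := by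
    rw [← intervalIntegral.integral_ofReal, ← intervalIntegral.integral_sub
      (intervalIntegrable_interaction hT.le hU.cont hU.cont hU.q4_ne_top k)
      (hk.intervalIntegrable _ _),
      ← intervalIntegral.integral_const_mul, intervalIntegral.integral_of_le hT.le,
      intervalIntegral.integral_of_le hT.le]
    exact integral_congr_ae (hU.ae_q4_ne_top.mono fun r hr => interactionTerm_eq α hr k)
  rw [e, Complex.im_ofReal_mul, Complex.sub_im, Complex.ofReal_im, sub_zero, Complex.imCLM_apply,
    Complex.im_ofReal_mul]
  ring

/-- The properties of the functional for a single flow. -/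
theorem exists_quadForm_bound {α s : ℝ} (hα : 1 / 2 < α) (hα' : α ≤ 1)
    (hs : α - 1 / 2 - (α - 1 / 2) / 12 < s) (hs' : s < α - 1 / 2) :
    ∃ B : ℝ≥0∞ → ℝ → ℝ≥0∞, (∀ S T, S ≠ ∞ → B S T ≠ ∞) ∧
      ∀ {A : Set ℤ} {T : ℝ} {u : ℝ → L2} {S : ℝ≥0∞}, 0 < T → IsFlow β A T (fun r => u (-r)) →
        MemHs s (u 0) → S ≠ ∞ → ‖u 0‖ₑ ≤ S →
        ∑' q : Freq, ENNReal.ofReal (q.mx ^ ((α - 1 / 2) / 24)) * ‖quadTerm α β T u q‖ₑ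
          ≤ B S T * ENNReal.ofReal (hsNorm s (u 0)) ^ 3 ∧
        Summable (quadTerm α β T u) ∧
        HasSum (fun k : ℤ => (∫ r in (0 : ℝ)..T, interactionTerm α (u (-r)) k).im)
            (2 * Real.pi * quadForm α β T u) := by
  -- With `δ = η = (α - 1/2)/24` and `s > (11/12)(α - 1/2)`, the tightest condition is the one on `ρ
  -- = 3/8` at `α = 1`, where it amounts to `29/48 ≤ 30/48`.
  obtain ⟨B, hB, h⟩ := exists_tsum_mx_quadInt_le hc hΦ (α := α) (s := s) (δ := (α - 1 / 2) / 24)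
    (η := (α - 1 / 2) / 24) hα.le hα' (by linarith) (by linarith) (by linarith) (by linarith)
    (by linarith) (by linarith)
  refine ⟨fun S T => ENNReal.ofReal (3 ^ (2 * α)) * B S T, fun S T hS => ?_, ?_⟩
  · have := hB S T hS
    finiteness
  intro A T u S hT hU h0 hS hUS
  have h1 := h hT hU (by simpa using h0) hS (by simpa using hUS)
  simp only [neg_zero] at h1
  have h2 : ∑' q : Freq, ENNReal.ofReal (q.mx ^ ((α - 1 / 2) / 24)) * ‖quadTerm α β T u q‖ₑ
      ≤ ENNReal.ofReal (3 ^ (2 * α)) * B S T * ENNReal.ofReal (hsNorm s (u 0)) ^ 3 := by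
    rw [mul_assoc]
    refine le_trans ?_ (mul_le_mul' le_rfl h1)
    rw [← ENNReal.tsum_mul_left]
    refine ENNReal.tsum_le_tsum fun q => ?_
    rw [quadTerm_eq, enorm_mul, add_comm, Real.rpow_add q.mx_pos,
      ENNReal.ofReal_mul (Real.rpow_nonneg q.mx_pos.le _)]
    calc _ ≤ ENNReal.ofReal (q.mx ^ ((α - 1 / 2) / 24))
          * (ENNReal.ofReal (3 ^ (2 * α)) * ENNReal.ofReal (q.mx ^ (2 * α))
            * ‖quadInt (fun r => u (-r)) 0 T q‖ₑ) := by
          gcongr; exact enorm_jb_rpow_le (by linarith) q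
      _ = _ := by ring
  have h3 : Summable (quadTerm α β T u) := by
    have hb := hB S T hS
    refine Summable.of_enorm (ne_top_of_le_ne_top (by finiteness) (le_trans
      (ENNReal.tsum_le_tsum fun q => le_mul_of_one_le_left' ?_) h2))
    rw [← ENNReal.ofReal_one]
    exact ENNReal.ofReal_le_ofReal (Real.one_le_rpow q.one_le_mx (by linarith))
  refine ⟨h2, h3, ?_⟩
  have e : quadTerm α β T u = fun q => ((jb q.k ^ (2 * α) : ℝ) : ℂ)
      * quadInt (fun r => u (-r)) 0 T q := funext fun q => quadTerm_eq α β T u q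
  rw [quadForm, e]
  exact hU.hasSum_interactionTerm hc hΦ hT (by rw [← e]; exact h3)

end

end

/-! ### Energy inequality for the difference of two flows -/

section

open Freq

theorem ennreal_add_sq_le (a b : ℝ≥0∞) : (a + b) ^ 2 ≤ 2 * (a ^ 2 + b ^ 2) := by
  have h := ENNReal.rpow_add_le_mul_rpow_add_rpow a b (p := 2) (by norm_num)
  norm_num at h
  exact h

/-- Integration of the derivative of each `|hat (W r) k|²`. The finite frequency support permits
summing the modes before taking absolute values, so that the pairing can be evaluated in physical
space. -/
theorem norm_sq_sub_le {β : ℝ} {W : ℝ → L2} {d : ℤ → ℝ → ℂ} {a b : ℝ} {s : Finset ℤ}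
    (hd : ∀ k, HasIntDeriv (osc β W k) (d k) a b) (hs : ∀ r, ∀ k ∉ s, hat (W r) k = 0)
    {t : ℝ} (ht : t ∈ Set.Icc a b) :
    ‖W t‖ₑ ^ 2 ≤ ‖W a‖ₑ ^ 2
      + 2 * ∫⁻ r in Set.Ioc a b, ‖∑ k ∈ s, d k r * conj (osc β W k r)‖ₑ := by
  have hsq : ∀ k r, osc β W k r * conj (osc β W k r) = ((‖hat (W r) k‖ ^ 2 : ℝ) : ℂ) := fun k r => by
    rw [Complex.mul_conj, Complex.normSq_eq_norm_sq, osc, norm_mul, norm_cexp_neg_I_mul, one_mul]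
  have hn : ∀ r, ‖W r‖ ^ 2 = ∑ k ∈ s, ‖hat (W r) k‖ ^ 2 := fun r => by
    rw [← (hasSum_norm_hat_sq (W r)).tsum_eq, tsum_eq_sum]
    intro k hk; rw [hs r k hk]; simp
  have hd' : ∀ k, HasIntDeriv (osc β W k) (d k) a t := fun k => (hd k).mono le_rfl ht.1 ht.2
  have h1 : ∀ k, ((‖hat (W t) k‖ ^ 2 - ‖hat (W a) k‖ ^ 2 : ℝ) : ℂ)
      = ∫ r in a..t, (d k r * conj (osc β W k r) + osc β W k r * conj (d k r)) := fun k => by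
    rw [(((hd' k).mul ((hd' k).conjugate ht.1) ht.1).integral_eq ht.1), hsq, hsq, Complex.ofReal_sub]
  have h2 : ((‖W t‖ ^ 2 - ‖W a‖ ^ 2 : ℝ) : ℂ) = ∫ r in a..t,
      ((∑ k ∈ s, d k r * conj (osc β W k r)) + conj (∑ k ∈ s, d k r * conj (osc β W k r))) := by
    rw [hn, hn, ← Finset.sum_sub_distrib, Complex.ofReal_sum, Finset.sum_congr rfl fun k _ => h1 k,
      ← intervalIntegral.integral_finsetSum fun k _ =>
        (((hd' k).mul ((hd' k).conjugate ht.1) ht.1)).int]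
    refine intervalIntegral.integral_congr fun r _ => ?_
    simp only [map_sum, map_mul, Complex.conj_conj, Finset.sum_add_distrib]
    congr 1
    exact Finset.sum_congr rfl fun k _ => mul_comm _ _
  have h3 : ENNReal.ofReal (‖W t‖ ^ 2 - ‖W a‖ ^ 2)
      ≤ ∫⁻ r in Set.Ioc a b, 2 * ‖∑ k ∈ s, d k r * conj (osc β W k r)‖ₑ := by
    calc _ ≤ ‖((‖W t‖ ^ 2 - ‖W a‖ ^ 2 : ℝ) : ℂ)‖ₑ := by
          rw [← ofReal_norm, Complex.norm_real]
          exact ENNReal.ofReal_le_ofReal (Real.le_norm_self _)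
      _ ≤ ∫⁻ r in Set.Ioc a t, 2 * ‖∑ k ∈ s, d k r * conj (osc β W k r)‖ₑ := by
          rw [h2, intervalIntegral.integral_of_le ht.1]
          refine (enorm_integral_le_lintegral_enorm _).trans (lintegral_mono fun r => ?_)
          refine (enorm_add_le _ _).trans (le_of_eq ?_)
          rw [RCLike.enorm_conj, two_mul]
      _ ≤ _ := lintegral_mono_set (Set.Ioc_subset_Ioc_right ht.2)
  rw [lintegral_const_mul' _ _ (by simp)] at h3
  simp only [← ofReal_norm (W _)]
  rw [← ENNReal.ofReal_pow (norm_nonneg _), ← ENNReal.ofReal_pow (norm_nonneg _)]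
  calc ENNReal.ofReal (‖W t‖ ^ 2) = ENNReal.ofReal (‖W a‖ ^ 2 + (‖W t‖ ^ 2 - ‖W a‖ ^ 2)) := by
        congr 1; ring
    _ ≤ _ := ENNReal.ofReal_add_le.trans (add_le_add le_rfl h3)

/-- Read at a point with `F = |f|`, `G = |g|`, `D = |f - g|`, `W = |P_N f - g|`, `E = |f - P_N f|`:
the pairing is split into fourth powers, with the weight `m` free to balance sizes. -/
theorem pairing_le (F G D W E : ℝ≥0∞) (hD : D ≤ W + E) {m : ℝ≥0∞} (hm : m ≠ 0) (hm' : m ≠ ∞) :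
    2 * ((F ^ 2 + G ^ 2) * D) * W
      ≤ 8 * (m * (F ^ 4 + G ^ 4) + m⁻¹ * (W ^ 4 + E ^ 4)) := by
  have h1 : D * W ≤ 2 * (W ^ 2 + E ^ 2) := by
    calc D * W ≤ (W + E) * W := by gcongr
      _ = W ^ 2 + E * W := by ring
      _ ≤ W ^ 2 + (E ^ 2 + W ^ 2) := by gcongr; exact ennreal_mul_le_sq_add_sq E W
      _ ≤ W ^ 2 + (E ^ 2 + W ^ 2) + E ^ 2 := le_self_add
      _ = _ := by ring
  calc 2 * ((F ^ 2 + G ^ 2) * D) * W = 2 * ((F ^ 2 + G ^ 2) * (D * W)) := by ring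
    _ ≤ 2 * ((F ^ 2 + G ^ 2) * (2 * (W ^ 2 + E ^ 2))) := by gcongr
    _ = 4 * ((F ^ 2 + G ^ 2) * (W ^ 2 + E ^ 2)) := by ring
    _ ≤ 4 * (m * (F ^ 2 + G ^ 2) ^ 2 + m⁻¹ * (W ^ 2 + E ^ 2) ^ 2) := by
        gcongr; exact mul_le_weighted _ _ hm hm'
    _ ≤ 4 * (m * (2 * ((F ^ 2) ^ 2 + (G ^ 2) ^ 2)) + m⁻¹ * (2 * ((W ^ 2) ^ 2 + (E ^ 2) ^ 2))) := by
        gcongr <;> exact ennreal_add_sq_le _ _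
    _ = _ := by ring

/-- The pairing of the difference of two nonlinearities with the truncated difference. -/
theorem enorm_sum_cubicHat_sub_le {f g : L2} (hf : q4 f ≠ ∞) (hg : q4 g ≠ ∞) {N : ℕ}
    (hgN : proj N g = g) {m : ℝ≥0∞} (hm : m ≠ 0) (hm' : m ≠ ∞) :
    ‖∑ k ∈ freqs N, (cubicHat f k - cubicHat g k) * conj (hat (proj N f - g) k)‖ₑ
      ≤ 8 * (m * (q4 f + q4 g) + m⁻¹ * (q4 (proj N f - g) + q4 (f - proj N f))) := by
  set w := proj N f - g with hw
  have hwN : w = tpoly (freqs N) (hat w) := by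
    rw [← proj_eq_tpoly, hw]
    nth_rewrite 2 [← hgN]
    rw [← proj_sub]
    refine hat_ext fun k => ?_
    simp only [hat_proj, hat_sub]
    have := congrArg (fun f => hat f k) hgN
    simp only [hat_proj] at this
    rw [← this]
    split_ifs <;> simp
  have hi := (integrable_cube (q3_ne_top hf)).sub (integrable_cube (q3_ne_top hg))
  have h1 := integral_mul_conj_tpoly (freqs N) (hat w) hi
  rw [← hwN] at h1
  have h2 : ∀ k, fourierCoeff ((fun x => cube (f x)) - fun x => cube (g x)) k
      = cubicHat f k - cubicHat g k := fun k => by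
    rw [cubicHat_eq, cubicHat_eq, fourierCoeff, fourierCoeff, fourierCoeff,
      ← integral_sub]
    · exact integral_congr_ae (Eventually.of_forall fun x => smul_sub _ _ _)
    · exact (integrable_cube (q3_ne_top hf)).fourier_smul (-k)
    · exact (integrable_cube (q3_ne_top hg)).fourier_smul (-k)
  simp only [h2] at h1
  rw [← h1]
  refine (enorm_integral_le_lintegral_enorm _).trans ?_
  have hmeas : ∀ f : L2, AEMeasurable (fun x => ‖(f : Torus → ℂ) x‖ₑ ^ 4) haarT := fun f =>
    (aestronglyMeasurable_coe f).enorm.pow_const 4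
  calc _ ≤ ∫⁻ x, 8 * (m * (‖(f : Torus → ℂ) x‖ₑ ^ 4 + ‖(g : Torus → ℂ) x‖ₑ ^ 4)
        + m⁻¹ * (‖(w : Torus → ℂ) x‖ₑ ^ 4 + ‖((f - proj N f : L2) : Torus → ℂ) x‖ₑ ^ 4)) ∂haarT := by
        refine lintegral_mono_ae ?_
        filter_upwards [Lp.coeFn_sub f (proj N f), Lp.coeFn_sub (proj N f) g] with x hx hx'
        rw [enorm_mul, RCLike.enorm_conj]
        refine le_trans (mul_le_mul' (enorm_cube_sub_le _ _) le_rfl)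
          (pairing_le _ _ _ _ _ ?_ hm hm')
        rw [hw, hx, hx']
        refine le_trans (le_of_eq ?_) (enorm_add_le _ _)
        congr 1
        simp only [Pi.sub_apply]; ring
    _ = _ := by
        have hadd : AEMeasurable (fun x => m * (‖(f : Torus → ℂ) x‖ₑ ^ 4
            + ‖(g : Torus → ℂ) x‖ₑ ^ 4)) haarT := ((hmeas f).add (hmeas g)).const_mul m
        rw [lintegral_const_mul' _ _ (by simp), lintegral_add_left' hadd, lintegral_const_mul' _ _ hm',
          lintegral_const_mul' _ _ (ENNReal.inv_ne_top.2 hm), lintegral_add_left' (hmeas f),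
          lintegral_add_left' (hmeas w)]
        rfl

theorem osc_sub (β : ℝ) (F G : ℝ → L2) (k : ℤ) :
    osc β (fun r => F r - G r) k = fun r => osc β F k r - osc β G k r := by
  funext r; simp only [osc, hat_sub]; ring

theorem IsFlow.proj_eq {β T : ℝ} {N : ℕ} {V : ℝ → L2} (hV : IsFlow β {k | |k| ≤ N} T V) (r : ℝ) :
    proj N (V r) = V r := by
  refine hat_ext fun k => ?_
  rw [hat_proj]
  split_ifs with h
  · rfl
  · exact (hV.supp r k h).symm

section Pair

variable {β T : ℝ} {N : ℕ} {U V : ℝ → L2}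

/-- The time derivative of the truncated difference of two flows. -/
theorem hasIntDeriv_dif (hU : IsFlow β Set.univ T U) (hV : IsFlow β {k | |k| ≤ N} T V) (k : ℤ) :
    HasIntDeriv (osc β (fun r => proj N (U r) - V r) k)
      (fun r => (if |k| ≤ N then drv β Set.univ U k r else 0) - drv β {k | |k| ≤ N} V k r) 0 T := by
  rw [osc_sub]
  exact (hasIntDeriv_osc_proj hU.deriv N k).sub (hV.deriv k)

theorem dif_deriv_eq (k : ℤ) (r : ℝ) :
    (if |k| ≤ N then drv β Set.univ U k r else 0) - drv β {k | |k| ≤ N} V k r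
      = if |k| ≤ N then Complex.I * Complex.exp (-(Complex.I * (r * disp β k : ℝ)))
          * (cubicHat (U r) k - cubicHat (V r) k) else 0 := by
  classical
  simp only [drv, Set.indicator_apply, Set.mem_ofPred_eq, Set.mem_univ, if_true]
  split_ifs <;> ring

theorem enorm_dif_deriv_le (k : ℤ) (r : ℝ) :
    ‖(if |k| ≤ N then drv β Set.univ U k r else 0) - drv β {k | |k| ≤ N} V k r‖ₑ
      ≤ ‖cubicHat (U r) k - cubicHat (V r) k‖ₑ := by
  rw [dif_deriv_eq]
  split_ifs
  · rw [enorm_mul, enorm_mul, ← ofReal_norm (Complex.exp _), norm_cexp_neg_I_mul, ← ofReal_norm]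
    simp
  · simp

theorem dif_deriv_mul_conj {k : ℤ} (hk : |k| ≤ N) (W : ℝ → L2) (r : ℝ) :
    ((if |k| ≤ N then drv β Set.univ U k r else 0) - drv β {k | |k| ≤ N} V k r)
        * conj (osc β W k r)
      = Complex.I * ((cubicHat (U r) k - cubicHat (V r) k) * conj (hat (W r) k)) := by
  rw [dif_deriv_eq, if_pos hk, osc, map_mul]
  have : Complex.exp (-(Complex.I * (r * disp β k : ℝ)))
      * conj (Complex.exp (-(Complex.I * (r * disp β k : ℝ)))) = 1 := by
    rw [Complex.mul_conj, Complex.normSq_eq_norm_sq, norm_cexp_neg_I_mul]; simp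
  linear_combination (Complex.I * (cubicHat (U r) k - cubicHat (V r) k) * conj (hat (W r) k)) * this

end Pair

end

/-! ### Short-time stability and decay of the high frequencies in `L⁴` -/

section

open Freq

variable {β c : ℝ} (hc : 0 < c) (hΦ : ∀ q : Freq, c * q.pr ≤ |phase β q.k₁ q.k₂ q.k₃|)
include hc hΦ

/-- The difference estimate on a short time interval. -/
theorem exists_norm_dif_le : ∃ K : ℝ≥0∞, K ≠ ∞ ∧
    ∀ {T : ℝ} {N : ℕ} {U V : ℝ → L2} {Q y η : ℝ≥0∞} {a b : ℝ}, IsFlow β Set.univ T U →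
      IsFlow β {k | |k| ≤ N} T V → ∫⁻ r in Set.Ioc 0 T, q4 (U r) ≤ Q →
      ∫⁻ r in Set.Ioc 0 T, q4 (V r) ≤ Q → Q ≠ ∞ → 0 ≤ a → a < b → b ≤ T → y ≠ 0 → y ≠ ∞ →
      tailSup U T N ≤ y → ∫⁻ r in Set.Ioc 0 T, q4 (U r - proj N (U r)) ≤ y ^ 4 →
      η ≠ 0 → η ≠ ∞ →
      ∃ P : ℝ≥0∞, P ≠ ∞ ∧ (∀ r ∈ Set.Icc a b, ‖proj N (U r) - V r‖ₑ ≤ P) ∧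
        P ^ 2 ≤ ‖proj N (U a) - V a‖ₑ ^ 2
          + 16 * (η * (2 * Q) + η⁻¹ * (K * gain (b - a) * (1 + 4 * (ENNReal.ofReal T + Q))))
            * (P + y) ^ 2 + 16 * (η⁻¹ * y ^ 2) := by
  obtain ⟨K, hK, h⟩ := exists_lintegral_q4_le hc hΦ
  refine ⟨K, hK, ?_⟩
  intro T N U V Q y η a b hU hV hUQ hVQ hQ ha hab hb hy hyt hE hZ hη hηt
  set W : ℝ → L2 := fun r => proj N (U r) - V r with hW
  have hWc : Continuous W := ((continuous_proj N).comp hU.cont).sub hV.cont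
  have hsub : Set.Ioc a b ⊆ Set.Ioc 0 T := Set.Ioc_subset_Ioc ha hb
  -- The supremum `P` of `‖W‖` on the interval is attained, so the energy inequality at `t₀` is an
  -- inequality for `P` itself.
  obtain ⟨t₀, ht₀, hmax⟩ := isCompact_Icc.exists_isMaxOn (Set.nonempty_Icc.2 hab.le)
    hWc.norm.continuousOn
  have hP : ∀ r ∈ Set.Icc a b, ‖W r‖ₑ ≤ ‖W t₀‖ₑ := fun r hr => by
    rw [← ofReal_norm, ← ofReal_norm]; exact ENNReal.ofReal_le_ofReal (hmax hr)
  set P := ‖W t₀‖ₑ with hPdef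
  have hPt : P ≠ ∞ := enorm_ne_top
  set p := P + y with hp
  have hp0 : p ≠ 0 := by simp [hp, hy]
  have hpt : p ≠ ∞ := by finiteness
  have hp2 : p ^ 2 ≠ 0 := pow_ne_zero _ hp0
  have hp2t : p ^ 2 ≠ ∞ := by finiteness
  have hd : ∀ k, HasIntDeriv (osc β W k)
      (fun r => (if |k| ≤ N then drv β Set.univ U k r else 0) - drv β {k | |k| ≤ N} V k r) a b :=
    fun k => (hasIntDeriv_dif hU hV k).mono ha hab.le hb
  have hae : ∀ᵐ r ∂volume.restrict (Set.Ioc a b), q4 (U r) ≠ ∞ ∧ q4 (V r) ≠ ∞ :=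
    ae_mono (Measure.restrict_mono hsub le_rfl) (hU.ae_q4_ne_top.and hV.ae_q4_ne_top)
  have mU := measurable_q4_comp hU.cont
  have mV := measurable_q4_comp hV.cont
  have hUV : ∫⁻ r in Set.Ioc a b, (q4 (U r) + q4 (V r)) ≤ 2 * Q := by
    rw [lintegral_add_left mU, two_mul]
    exact add_le_add ((lintegral_mono_set hsub).trans hUQ) ((lintegral_mono_set hsub).trans hVQ)
  have hdist : ∀ r ∈ Set.Icc a b, ‖U r - V r‖ₑ ≤ p := fun r hr => by
    have e : U r - V r = W r + (U r - proj N (U r)) := by simp only [hW]; abel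
    rw [e]
    exact (enorm_add_le _ _).trans (add_le_add (hP r hr)
      ((le_tailSup U ⟨ha.trans hr.1, hr.2.trans hb⟩ N).trans hE))
  -- Both `W` and the coefficients of its time derivative are linear in `p`, so the `L⁴` estimate is
  -- homogeneous of degree four in `p` and carries the gain in the length.
  have hW4 : ∫⁻ r in Set.Ioc a b, q4 (W r)
      ≤ K * gain (b - a) * (1 + 4 * (ENNReal.ofReal T + Q)) * p ^ 4 := by
    refine (h (h := fun r => 2 * ((2 + (q4 (U r) + q4 (V r))) * p)) hab hWc hd ?_ hPt hP).trans ?_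
    · filter_upwards [hae, ae_restrict_mem measurableSet_Ioc] with r hr hrm k
      refine (enorm_dif_deriv_le k r).trans ((enorm_cubicHat_sub_le hr.1 hr.2 k).trans ?_)
      rw [add_assoc]
      gcongr
      exact hdist r ⟨hrm.1.le, hrm.2⟩
    · rw [lintegral_const_mul' _ _ (by simp), lintegral_mul_const' _ _ hpt,
        lintegral_add_left measurable_const, setLIntegral_const, Real.volume_Ioc]
      have h1 : ENNReal.ofReal (b - a) ≤ ENNReal.ofReal T := ENNReal.ofReal_le_ofReal (by linarith)
      have h2 : P ≤ p := le_self_add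
      calc _ ≤ K * gain (b - a) * (p ^ 4 + p ^ 3 * (2 * ((2 * ENNReal.ofReal T + 2 * Q) * p))) := by
            gcongr
        _ = _ := by ring
  -- This scaling turns the fourth powers of `p` and `y` into squares, which leaves a quadratic
  -- inequality with coefficients free of `p`; dividing by `p²` is why `y ≠ 0` is required.
  set m := η * p ^ 2 with hm
  have hm0 : m ≠ 0 := mul_ne_zero hη hp2
  have hmt : m ≠ ∞ := ENNReal.mul_ne_top hηt hp2t
  have hminv : m⁻¹ = η⁻¹ * (p ^ 2)⁻¹ := ENNReal.mul_inv (Or.inl hη) (Or.inl hηt)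
  have hpp : (p ^ 2)⁻¹ * p ^ 4 = p ^ 2 := by
    rw [show p ^ 4 = p ^ 2 * p ^ 2 by ring, ← mul_assoc, ENNReal.inv_mul_cancel hp2 hp2t, one_mul]
  have hpy : (p ^ 2)⁻¹ * y ^ 4 ≤ y ^ 2 := by
    calc (p ^ 2)⁻¹ * y ^ 4 ≤ (p ^ 2)⁻¹ * (p ^ 2 * y ^ 2) := by
          rw [show y ^ 4 = y ^ 2 * y ^ 2 by ring]
          gcongr
          exact le_add_self
      _ = _ := by rw [← mul_assoc, ENNReal.inv_mul_cancel hp2 hp2t, one_mul]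
  have hpair : ∫⁻ r in Set.Ioc a b, ‖∑ k ∈ freqs N,
      ((if |k| ≤ N then drv β Set.univ U k r else 0) - drv β {k | |k| ≤ N} V k r)
        * conj (osc β W k r)‖ₑ
      ≤ 8 * (m * (2 * Q) + m⁻¹ * (K * gain (b - a) * (1 + 4 * (ENNReal.ofReal T + Q)) * p ^ 4
        + y ^ 4)) := by
    calc _ ≤ ∫⁻ r in Set.Ioc a b, 8 * (m * (q4 (U r) + q4 (V r))
          + m⁻¹ * (q4 (W r) + q4 (U r - proj N (U r)))) := by
          refine lintegral_mono_ae ?_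
          filter_upwards [hae] with r hr
          rw [Finset.sum_congr rfl fun k hk => dif_deriv_mul_conj (mem_freqs.1 hk) W r,
            ← Finset.mul_sum, enorm_mul]
          refine le_trans (le_of_eq ?_)
            (enorm_sum_cubicHat_sub_le hr.1 hr.2 (hV.proj_eq r) hm0 hmt)
          rw [← ofReal_norm Complex.I, Complex.norm_I, ENNReal.ofReal_one, one_mul]
      _ = 8 * (m * (∫⁻ r in Set.Ioc a b, (q4 (U r) + q4 (V r)))
          + m⁻¹ * ((∫⁻ r in Set.Ioc a b, q4 (W r))
            + ∫⁻ r in Set.Ioc a b, q4 (U r - proj N (U r)))) := by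
          have hadd : Measurable fun r => m * (q4 (U r) + q4 (V r)) := (mU.add mV).const_mul m
          rw [lintegral_const_mul' _ _ (by simp), lintegral_add_left hadd,
            lintegral_const_mul' _ _ hmt, lintegral_const_mul' _ _ (ENNReal.inv_ne_top.2 hm0),
            lintegral_add_left (measurable_q4_comp hWc)]
      _ ≤ _ := by
          gcongr
          exact (lintegral_mono_set hsub).trans hZ
  refine ⟨P, hPt, hP, ?_⟩
  have hs : ∀ r, ∀ k ∉ freqs N, hat (W r) k = 0 := fun r k hk => by
    have hk' : ¬ |k| ≤ N := fun h => hk (mem_freqs.2 h)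
    simp only [hW, hat_sub, hat_proj, if_neg hk', hV.supp r k hk', sub_zero]
  refine (norm_sq_sub_le hd hs ht₀).trans ?_
  calc _ ≤ ‖W a‖ₑ ^ 2 + 2 * (8 * (m * (2 * Q) + m⁻¹ * (K * gain (b - a)
        * (1 + 4 * (ENNReal.ofReal T + Q)) * p ^ 4 + y ^ 4))) := by gcongr
    _ = ‖W a‖ₑ ^ 2 + 16 * (η * (2 * Q) * p ^ 2 + η⁻¹ * (K * gain (b - a)
        * (1 + 4 * (ENNReal.ofReal T + Q))) * ((p ^ 2)⁻¹ * p ^ 4)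
          + η⁻¹ * ((p ^ 2)⁻¹ * y ^ 4)) := by rw [hminv, hm]; ring
    _ ≤ ‖W a‖ₑ ^ 2 + 16 * (η * (2 * Q) * p ^ 2 + η⁻¹ * (K * gain (b - a)
        * (1 + 4 * (ENNReal.ofReal T + Q))) * p ^ 2 + η⁻¹ * y ^ 2) := by
        rw [hpp]; gcongr
    _ = _ := by ring

/-- The `L⁴` norm of the high frequencies of a flow tends to zero. -/
theorem IsFlow.tendsto_lintegral_q4_sub_proj {A : Set ℤ} {T : ℝ} {U : ℝ → L2} (hT : 0 < T)
    (hU : IsFlow β A T U) :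
    Tendsto (fun N => ∫⁻ r in Set.Ioc 0 T, q4 (U r - proj N (U r))) atTop (𝓝 0) := by
  obtain ⟨K, hK, h⟩ := exists_lintegral_q4_le hc hΦ
  obtain ⟨S, hS, hS'⟩ := exists_enorm_le hU.cont T
  have hH := hU.lintegral_q3_ne_top
  set H := ∫⁻ r in Set.Ioc 0 T, q3 (U r) with hHdef
  have hg := gain_ne_top (T - 0)
  have t1 := tendsto_tailSup hU.cont T
  have t2 : Tendsto (fun N => K * gain (T - 0) * (tailSup U T N ^ 4 + tailSup U T N ^ 3 * H)) atTop
      (𝓝 (K * gain (T - 0) * (0 ^ 4 + 0 ^ 3 * H))) :=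
    ENNReal.Tendsto.const_mul ((ENNReal.Tendsto.pow (n := 4) t1).add
      (ENNReal.Tendsto.mul_const (ENNReal.Tendsto.pow (n := 3) t1) (Or.inr hH))) (Or.inr (by finiteness))
  have e : K * gain (T - 0) * (0 ^ 4 + 0 ^ 3 * H) = 0 := by simp
  rw [e] at t2
  refine tendsto_of_tendsto_of_tendsto_of_le_of_le tendsto_const_nhds t2 (fun _ => zero_le)
    fun N => ?_
  -- The `L⁴` estimate is applied to the high-frequency part, with `S = tailSup`: every term carries
  -- at least its third power.
  refine h (d := fun k r => drv β A U k r - if |k| ≤ N then drv β A U k r else 0) hT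
    (hU.cont.sub ((continuous_proj N).comp hU.cont)) (fun k => ?_)
    (Eventually.of_forall fun r k => ?_) (ne_top_of_le_ne_top hS (tailSup_le hS' N))
    fun r hr => le_tailSup U hr N
  · rw [osc_sub]
    exact (hU.deriv k).sub (hasIntDeriv_osc_proj hU.deriv N k)
  · split_ifs
    · simp
    · rw [sub_zero]; exact (enorm_drv_le β A U k r).trans (enorm_cubicHat_le _ _)

end

/-! ### Convergence of the truncated flows and of the sums -/

section

open Freq

section

variable {β c : ℝ} (hc : 0 < c) (hΦ : ∀ q : Freq, c * q.pr ≤ |phase β q.k₁ q.k₂ q.k₃|)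
include hc hΦ

/-- Stability on a short time interval, whose length does not depend on its position. -/
theorem exists_length_tendsto_dif {T : ℝ} (hT : 0 < T) {U : ℝ → L2} {V : ℕ → ℝ → L2}
    (hU : IsFlow β Set.univ T U) (hV : ∀ N : ℕ, IsFlow β {k | |k| ≤ N} T (V N))
    (hV0 : ∀ N, V N 0 = proj N (U 0)) :
    ∃ l : ℝ, 0 < l ∧ ∀ a b, 0 ≤ a → a < b → b ≤ T → b - a ≤ l →
      Tendsto (fun N => ‖proj N (U a) - V N a‖ₑ) atTop (𝓝 0) →
      Tendsto (fun N => ‖proj N (U b) - V N b‖ₑ) atTop (𝓝 0) := by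
  obtain ⟨K, hK, h⟩ := exists_norm_dif_le hc hΦ
  obtain ⟨B, hB, hB'⟩ := exists_lintegral_q4_bound hc hΦ
  set Q := B ‖U 0‖ₑ T with hQdef
  have hQ : Q ≠ ∞ := hB _ _ enorm_ne_top
  have hUQ := hB' hT hU enorm_ne_top le_rfl
  have hVQ : ∀ N, ∫⁻ r in Set.Ioc 0 T, q4 (V N r) ≤ Q := fun N =>
    hB' hT (hV N) enorm_ne_top (by rw [hV0]; exact enorm_proj_le N _)
  -- As `256 = 16 · 16`, the term `16 * (η * (2 * Q))` is at most `1/16`; the `+ 1` keeps `η` finite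
  -- when `Q = 0`.
  set η : ℝ≥0∞ := (256 * (2 * Q + 1))⁻¹ with hη
  have hη0 : η ≠ 0 := ENNReal.inv_ne_zero.2 (by finiteness)
  have hηt : η ≠ ∞ := ENNReal.inv_ne_top.2 (by positivity)
  have h1 : 16 * (η * (2 * Q)) ≤ 16⁻¹ := by
    have e : (16 : ℝ≥0∞)⁻¹ = 16 * (η * (2 * Q + 1)) := by
      rw [hη, ENNReal.mul_inv (by simp) (by simp), mul_assoc,
        ENNReal.inv_mul_cancel (by positivity) (by finiteness), mul_one,
        show (256 : ℝ≥0∞) = 16 * 16 by norm_num, ENNReal.mul_inv (by simp) (by simp), ← mul_assoc,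
        ENNReal.mul_inv_cancel (by simp) (by simp), one_mul]
    rw [e]
    gcongr
    exact le_self_add
  have hηi : η⁻¹ ≠ ∞ := ENNReal.inv_ne_top.2 hη0
  have t1 : Tendsto (fun l => 16 * (η⁻¹ * (K * gain l * (1 + 4 * (ENNReal.ofReal T + Q))))) (𝓝 0)
      (𝓝 (16 * (η⁻¹ * (K * 0 * (1 + 4 * (ENNReal.ofReal T + Q)))))) :=
    ENNReal.Tendsto.const_mul (ENNReal.Tendsto.const_mul (ENNReal.Tendsto.mul_const
      (ENNReal.Tendsto.const_mul tendsto_gain (Or.inr hK)) (Or.inr (by finiteness)))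
      (Or.inr hηi)) (Or.inr (by simp))
  rw [mul_zero, zero_mul, mul_zero, mul_zero] at t1
  -- The length is chosen after `η`, hence in terms of `Q` and `T`. The same `Q` bounds `U` and all
  -- `V N`, so the length depends neither on `N` nor on the position of the interval.
  have h2 := ENNReal.tendsto_nhds_zero.1 t1 16⁻¹ (by simp)
  obtain ⟨l, hl, hl'⟩ := Metric.eventually_nhds_iff.1 h2
  refine ⟨l / 2, by linarith, fun a b ha hab hb hbl ha0 => ?_⟩
  set z : ℕ → ℝ≥0∞ := fun N => (∫⁻ r in Set.Ioc 0 T, q4 (U r - proj N (U r))) ^ (1 / 4 : ℝ) with hz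
  have hz0 : Tendsto z atTop (𝓝 0) := by
    have := (ENNReal.continuous_rpow_const (y := 1 / 4)).tendsto 0 |>.comp
      (hU.tendsto_lintegral_q4_sub_proj hc hΦ hT)
    rw [ENNReal.zero_rpow_of_pos (by norm_num)] at this
    exact this
  -- The three summands dominate the `L²` tail, dominate the fourth root of the `L⁴` tail, and keep
  -- `y N` nonzero.
  set y : ℕ → ℝ≥0∞ := fun N => tailSup U T N + z N + ((N : ℝ≥0∞) + 1)⁻¹ with hy
  have hinv : Tendsto (fun N : ℕ => ((N : ℝ≥0∞) + 1)⁻¹) atTop (𝓝 0) := by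
    have := ENNReal.tendsto_inv_nat_nhds_zero.comp (tendsto_add_atTop_nat 1)
    refine this.congr fun N => ?_
    simp
  have hy0 : Tendsto y atTop (𝓝 0) := by
    have := ((tendsto_tailSup hU.cont T).add hz0).add hinv
    simpa using this
  have hne : ∀ᶠ N in atTop, y N ≠ ∞ :=
    (hy0.eventually (gt_mem_nhds ENNReal.zero_lt_top)).mono fun N hN => hN.ne
  have hsq : ∀ᶠ N in atTop, ‖proj N (U b) - V N b‖ₑ ^ 2
      ≤ 2 * (‖proj N (U a) - V N a‖ₑ ^ 2 + (1 + 16 * η⁻¹) * y N ^ 2) := by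
    filter_upwards [hne] with N hN
    have hyN : y N ≠ 0 := by simp [hy]
    obtain ⟨P, hP, hP', hP2⟩ := h hU (hV N) hUQ (hVQ N) hQ ha hab hb hyN hN
      (le_self_add.trans le_self_add) (by
        have e : z N ^ 4 = ∫⁻ r in Set.Ioc 0 T, q4 (U r - proj N (U r)) := by
          rw [hz, ← ENNReal.rpow_natCast, ← ENNReal.rpow_mul]; norm_num
        rw [← e]
        exact pow_le_pow_left' (le_add_self.trans le_self_add) 4) hη0 hηt
    have h3 : 16 * (η * (2 * Q) + η⁻¹ * (K * gain (b - a) * (1 + 4 * (ENNReal.ofReal T + Q))))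
        ≤ 16⁻¹ + 16⁻¹ := by
      rw [mul_add]
      refine add_le_add h1 (hl' ?_)
      rw [Real.dist_eq, sub_zero, abs_of_pos (sub_pos.2 hab)]
      linarith
    have h4 : (16 : ℝ≥0∞)⁻¹ + 16⁻¹ ≤ 4⁻¹ := by
      have e : (16 : ℝ≥0∞)⁻¹ ≤ 4⁻¹ * 2⁻¹ := by
        rw [← ENNReal.mul_inv (by simp) (by simp)]
        exact ENNReal.inv_le_inv.2 (by norm_num)
      calc _ ≤ (4 : ℝ≥0∞)⁻¹ * 2⁻¹ + 4⁻¹ * 2⁻¹ := add_le_add e e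
        _ = 4⁻¹ := by rw [← mul_add, ENNReal.inv_two_add_inv_two, mul_one]
    -- The coefficient of `(P + y)²` is at most `1/4`, and `(P + y)² ≤ 2(P² + y²)`; half of `P²`
    -- remains on the right and is absorbed.
    have h5 : P ^ 2 ≤ ‖proj N (U a) - V N a‖ₑ ^ 2 + 4⁻¹ * (2 * (P ^ 2 + y N ^ 2))
        + 16 * (η⁻¹ * y N ^ 2) := by
      refine hP2.trans ?_
      gcongr
      · exact h3.trans h4
      · exact ennreal_add_sq_le _ _
    have h6 : (4 : ℝ≥0∞)⁻¹ * 2 = 2⁻¹ := by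
      rw [show (4 : ℝ≥0∞) = 2 * 2 by norm_num, ENNReal.mul_inv (by simp) (by simp), mul_assoc,
        ENNReal.inv_mul_cancel (by simp) (by simp), mul_one]
    have h7 : P ^ 2 ≤ 2⁻¹ * P ^ 2 + (‖proj N (U a) - V N a‖ₑ ^ 2 + (1 + 16 * η⁻¹) * y N ^ 2) := by
      calc P ^ 2 ≤ _ := h5
        _ = 2⁻¹ * P ^ 2 + (‖proj N (U a) - V N a‖ₑ ^ 2 + (2⁻¹ + 16 * η⁻¹) * y N ^ 2) := by
            rw [← mul_assoc, h6]; ring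
        _ ≤ _ := by gcongr; simp
    have h8 : 2⁻¹ * P ^ 2 ≤ ‖proj N (U a) - V N a‖ₑ ^ 2 + (1 + 16 * η⁻¹) * y N ^ 2 := by
      have e : 2⁻¹ * P ^ 2 + 2⁻¹ * P ^ 2 = P ^ 2 := by
        rw [← add_mul, ENNReal.inv_two_add_inv_two, one_mul]
      have hf : 2⁻¹ * P ^ 2 ≠ ∞ := by finiteness
      rw [← ENNReal.add_le_add_iff_left hf, e]
      exact h7
    calc _ ≤ P ^ 2 := pow_le_pow_left' (hP' b ⟨hab.le, le_rfl⟩) 2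
      _ = 2 * (2⁻¹ * P ^ 2) := by
          rw [← mul_assoc, ENNReal.mul_inv_cancel (by simp) (by simp), one_mul]
      _ ≤ _ := by gcongr
  have t2 : Tendsto (fun N => 2 * (‖proj N (U a) - V N a‖ₑ ^ 2 + (1 + 16 * η⁻¹) * y N ^ 2)) atTop
      (𝓝 (2 * (0 ^ 2 + (1 + 16 * η⁻¹) * 0 ^ 2))) :=
    ENNReal.Tendsto.const_mul ((ENNReal.Tendsto.pow ha0).add (ENNReal.Tendsto.const_mul
      (ENNReal.Tendsto.pow hy0) (Or.inr (by finiteness)))) (Or.inr (by simp))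
  have e0 : 2 * (0 ^ 2 + (1 + 16 * η⁻¹) * 0 ^ 2) = 0 := by simp
  rw [e0] at t2
  have t3 := tendsto_of_tendsto_of_tendsto_of_le_of_le' tendsto_const_nhds t2
    (Eventually.of_forall fun _ => zero_le) hsq
  have t4 := (ENNReal.continuous_rpow_const (y := 1 / 2)).tendsto 0 |>.comp t3
  rw [ENNReal.zero_rpow_of_pos (by norm_num)] at t4
  refine t4.congr fun N => ?_
  simp only [Function.comp_apply]
  rw [← ENNReal.rpow_natCast, ← ENNReal.rpow_mul]; norm_num

/-- Convergence of the truncated flows. -/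
theorem tendsto_truncated_flow {T : ℝ} (hT : 0 < T) {U : ℝ → L2} {V : ℕ → ℝ → L2}
    (hU : IsFlow β Set.univ T U) (hV : ∀ N : ℕ, IsFlow β {k | |k| ≤ N} T (V N))
    (hV0 : ∀ N, V N 0 = proj N (U 0)) {t : ℝ} (ht : t ∈ Set.Icc 0 T) :
    Tendsto (fun N => V N t) atTop (𝓝 (U t)) := by
  obtain ⟨l, hl, h⟩ := exists_length_tendsto_dif hc hΦ hT hU hV hV0
  have key : ∀ (j : ℕ), ∀ t ∈ Set.Icc 0 T, t ≤ j * l →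
      Tendsto (fun N => ‖proj N (U t) - V N t‖ₑ) atTop (𝓝 0) := by
    intro j
    induction j with
    | zero =>
      intro t ht htj
      have : t = 0 := le_antisymm (by simpa using htj) ht.1
      subst this
      simp [hV0]
    | succ j ih =>
      intro t ht htj
      rcases le_or_gt t (j * l) with hle | hlt
      · exact ih t ht hle
      · have hj : 0 ≤ (j : ℝ) * l := by positivity
        refine h (j * l) t hj hlt ht.2 ?_ (ih _ ⟨hj, hlt.le.trans ht.2⟩ le_rfl)
        push_cast at htj
        linarith
  obtain ⟨j, hj⟩ := exists_nat_ge (t / l)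
  have t1 := key j t ht (by rwa [div_le_iff₀ hl] at hj)
  have t2 : Tendsto (fun N => proj N (U t) - V N t) atTop (𝓝 0) := by
    rw [tendsto_iff_edist_tendsto_0]
    simpa only [edist_zero_right] using t1
  have t3 := (tendsto_proj (U t)).sub t2
  simpa using t3

/-- Convergence of the quadrilinear time integrals. -/
theorem tendsto_quadInt {T : ℝ} (hT : 0 < T) {U : ℝ → L2} {V : ℕ → ℝ → L2}
    (hU : IsFlow β Set.univ T U) (hV : ∀ N : ℕ, IsFlow β {k | |k| ≤ N} T (V N))
    (hV0 : ∀ N, V N 0 = proj N (U 0)) (q : Freq) :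
    Tendsto (fun N => quadInt (V N) 0 T q) atTop (𝓝 (quadInt U 0 T q)) := by
  have hcont : Continuous fun f : L2 => quadProd f q :=
    (((continuous_hat _).mul (Complex.continuous_conj.comp (continuous_hat _))).mul
      (continuous_hat _)).mul (Complex.continuous_conj.comp (continuous_hat _))
  have hn : ∀ (f : L2) k, ‖hat f k‖ ≤ ‖f‖ := fun f k => by
    have := enorm_hat_le f k
    rwa [← ofReal_norm, ← ofReal_norm, ENNReal.ofReal_le_ofReal_iff (norm_nonneg _)] at this
  refine intervalIntegral.tendsto_integral_filter_of_dominated_convergence (fun _ => ‖U 0‖ ^ 4)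
    (Eventually.of_forall fun N => (continuous_quadProd (hV N).cont q).aestronglyMeasurable)
    (Eventually.of_forall fun N => Eventually.of_forall fun r hr => ?_)
    intervalIntegrable_const (Eventually.of_forall fun r hr => ?_)
  · rw [Set.uIoc_of_le hT.le] at hr
    have h1 : ‖V N r‖ ≤ ‖U 0‖ := by
      rw [(hV N).norm_eq hc hΦ ⟨hr.1.le, hr.2⟩, hV0]; exact norm_proj_le N _
    have h2 : ∀ k, ‖hat (V N r) k‖ ≤ ‖U 0‖ := fun k => (hn _ k).trans h1
    simp only [quadProd, norm_mul, RCLike.norm_conj]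
    calc _ ≤ ‖U 0‖ * ‖U 0‖ * ‖U 0‖ * ‖U 0‖ := by gcongr <;> exact h2 _
      _ = _ := by ring
  · rw [Set.uIoc_of_le hT.le] at hr
    exact (hcont.tendsto _).comp
      (tendsto_truncated_flow hc hΦ hT hU hV hV0 ⟨hr.1.le, hr.2⟩)

end

/-- Convergence of sums over the frequencies with a uniform decay in the largest frequency. -/
theorem tendsto_tsum_freq {F : ℕ → Freq → ℂ} {G : Freq → ℂ} {δ : ℝ} (hδ : 0 < δ) {M : ℝ≥0∞}
    (hM : M ≠ ∞) (hF : ∀ N, ∑' q : Freq, ENNReal.ofReal (q.mx ^ δ) * ‖F N q‖ₑ ≤ M)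
    (hFs : ∀ N, Summable (F N)) (hGs : Summable G) (h : ∀ q, Tendsto (fun N => F N q) atTop (𝓝 (G q))) :
    Tendsto (fun N => ∑' q, F N q) atTop (𝓝 (∑' q, G q)) := by
  have htail : ∀ n N, ‖∑ q ∈ box (freqs n), F N q - ∑' q, F N q‖
      ≤ (((n : ℝ) + 1) / 3) ^ (-δ) * M.toReal := by
    intro n N
    have hp : (0 : ℝ) < ((n : ℝ) + 1) / 3 := by positivity
    rw [← ENNReal.ofReal_le_ofReal_iff (by positivity), ofReal_norm,
      ENNReal.ofReal_mul (by positivity), ENNReal.ofReal_toReal hM, enorm_sub_rev,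
      ← (hFs N).sum_add_tsum_subtype_compl (box (freqs n)), add_sub_cancel_left]
    refine enorm_tsum_le_tsum_enorm.trans ?_
    refine le_trans ?_ (mul_le_mul' le_rfl (hF N))
    rw [← ENNReal.tsum_mul_left]
    refine le_trans (ENNReal.tsum_le_tsum fun q => ?_) (ENNReal.tsum_comp_le_tsum_of_injective
      Subtype.val_injective fun q => ENNReal.ofReal ((((n : ℝ) + 1) / 3) ^ (-δ))
        * (ENNReal.ofReal (q.mx ^ δ) * ‖F N q‖ₑ))
    obtain ⟨q, hq⟩ := q
    -- Outside the box some component exceeds `n` in modulus, and every bracket is at most `3 *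
    -- q.mx`.
    have hmx : ((n : ℝ) + 1) / 3 ≤ q.mx := by
      have hbr : ∀ k : ℤ, ¬ k ∈ freqs n → |k| ≤ |q.x| + |q.y| + |q.z| → ((n : ℝ) + 1) / 3 ≤ q.mx := by
        intro k hk hk'
        have h1 := br_le_mx hk'
        rw [mem_freqs, not_le] at hk
        have h2 : (n : ℝ) < |(k : ℝ)| := by exact_mod_cast hk
        unfold br at h1
        linarith
      have hab := q.abs_le
      by_contra hcon
      refine hq (mem_box.2 ⟨⟨?_, ?_, ?_⟩, ?_⟩)
      · by_contra hk; exact hcon (hbr _ hk hab.1.2)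
      · by_contra hk; exact hcon (hbr _ hk hab.2.1)
      · by_contra hk; exact hcon (hbr _ hk hab.2.2)
      · by_contra hk; exact hcon (hbr _ hk hab.1.1)
    rw [← mul_assoc, ← ENNReal.ofReal_mul (by positivity)]
    refine le_mul_of_one_le_left' ?_
    rw [← ENNReal.ofReal_one]
    refine ENNReal.ofReal_le_ofReal ?_
    rw [Real.rpow_neg hp.le, ← div_eq_inv_mul, one_le_div (by positivity)]
    exact Real.rpow_le_rpow hp.le hmx hδ.le
  -- The box sums converge uniformly in `N`, which permits interchanging the limits in the box size
  -- and in `N`.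
  have hunif : TendstoUniformlyOnFilter (fun n N => ∑ q ∈ box (freqs n), F N q)
      (fun N => ∑' q, F N q) atTop atTop := by
    rw [Metric.tendstoUniformlyOnFilter_iff]
    intro ε hε
    have h1 : Tendsto (fun n : ℕ => (((n : ℝ) + 1) / 3) ^ (-δ) * M.toReal) atTop (𝓝 0) := by
      have h2 : Tendsto (fun n : ℕ => ((n : ℝ) + 1) / 3) atTop atTop :=
        (tendsto_atTop_add_const_right _ _ tendsto_natCast_atTop_atTop).atTop_div_const (by norm_num)
      simpa using ((tendsto_rpow_neg_atTop hδ).comp h2).mul_const M.toReal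
    have h3 := (h1.eventually (gt_mem_nhds hε))
    refine (h3.prod_inl atTop).mono fun p hp => ?_
    rw [dist_comm, dist_eq_norm]
    exact (htail p.1 p.2).trans_lt hp
  exact hunif.tendsto_of_eventually_tendsto
    (Eventually.of_forall fun n => tendsto_finsetSum _ fun q _ => h q)
    (hGs.hasSum.comp tendsto_box)

end

/-! ### Sobolev norms of the truncated data and the real-valued bound -/

section

open Freq

theorem jb_mul_hat_proj_sq_le (s : ℝ) (N : ℕ) (f : L2) (k : ℤ) :
    jb k ^ (2 * s) * ‖hat (proj N f) k‖ ^ 2 ≤ jb k ^ (2 * s) * ‖hat f k‖ ^ 2 := by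
  refine mul_le_mul_of_nonneg_left ?_ (jb_rpow_nonneg _ _)
  rw [hat_proj]
  split_ifs
  · exact le_rfl
  · simp

theorem MemHs.proj {s : ℝ} {f : L2} (h : MemHs s f) (N : ℕ) : MemHs s (proj N f) :=
  Summable.of_nonneg_of_le (fun k => jb_mul_sq_nonneg s _ k) (jb_mul_hat_proj_sq_le s N f) h

theorem MemHs.hsNorm_proj_le {s : ℝ} {f : L2} (h : MemHs s f) (N : ℕ) :
    hsNorm s (ThirdOrderNLS.proj N f) ≤ hsNorm s f :=
  Real.sqrt_le_sqrt ((h.proj N).tsum_le_tsum (jb_mul_hat_proj_sq_le s N f) h)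

theorem abs_quadForm_le {α β T δ : ℝ} (hδ : 0 ≤ δ) {u : ℝ → L2} {B : ℝ≥0∞} (hB : B ≠ ∞) {b : ℝ}
    (hb : 0 ≤ b) (h : ∑' q : Freq, ENNReal.ofReal (q.mx ^ δ) * ‖quadTerm α β T u q‖ₑ
      ≤ B * ENNReal.ofReal b ^ 3) : |quadForm α β T u| ≤ B.toReal * b ^ 3 := by
  rw [← ENNReal.ofReal_le_ofReal_iff (by positivity), ENNReal.ofReal_mul (by positivity),
    ENNReal.ofReal_toReal hB, ENNReal.ofReal_pow hb]
  refine le_trans ?_ h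
  calc _ ≤ ‖∑' q : Freq, quadTerm α β T u q‖ₑ := by
        rw [← ofReal_norm]
        exact ENNReal.ofReal_le_ofReal (Complex.abs_im_le_norm _)
    _ ≤ ∑' q : Freq, ‖quadTerm α β T u q‖ₑ := enorm_tsum_le_tsum_enorm
    _ ≤ _ := by
        refine ENNReal.tsum_le_tsum fun q => le_mul_of_one_le_left' ?_
        rw [← ENNReal.ofReal_one]
        exact ENNReal.ofReal_le_ofReal (Real.one_le_rpow q.one_le_mx hδ)

end

end ThirdOrderNLS

end

/-! ### Assembly of the three statements -/

theorem lemma3p1 (α β : ℝ) (hα : 1 / 2 < α) (hα' : α ≤ 1)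
    (hβ : ∀ m : ℤ, 2 * β / 3 ≠ (m : ℝ)) :
    ∃ ε₀ : ℝ, 0 < ε₀ ∧ ∀ ε s : ℝ, 0 < ε → ε < ε₀ → s = α - 1 / 2 - ε →
      ∃ C : ℝ → ℝ → ℝ, ∀ (T : ℝ), 0 < T → ∀ u₀ : ThirdOrderNLS.L2, ThirdOrderNLS.MemHs s u₀ →
        -- the bound for the solution
        (∀ u : ℝ → ThirdOrderNLS.L2, ThirdOrderNLS.IsSolution β s u₀ u →
          Summable (ThirdOrderNLS.quadTerm α β T u) ∧
          |ThirdOrderNLS.quadForm α β T u| ≤ C ‖u₀‖ T * ThirdOrderNLS.hsNorm s u₀ ^ 3 ∧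
          HasSum (fun k : ℤ => (∫ r in (0 : ℝ)..T, ThirdOrderNLS.interactionTerm α (u (-r)) k).im)
            (2 * Real.pi * ThirdOrderNLS.quadForm α β T u)) ∧
        -- the same bound, with the same constant, for the truncated solutions
        (∀ (N : ℕ) (uN : ℝ → ThirdOrderNLS.L2), ThirdOrderNLS.IsTruncatedSolution β N u₀ uN →
          Summable (ThirdOrderNLS.quadTerm α β T uN) ∧
          |ThirdOrderNLS.quadForm α β T uN| ≤ C ‖u₀‖ T * ThirdOrderNLS.hsNorm s u₀ ^ 3 ∧
          HasSum (fun k : ℤ => (∫ r in (0 : ℝ)..T, ThirdOrderNLS.interactionTerm α (uN (-r)) k).im)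
            (2 * Real.pi * ThirdOrderNLS.quadForm α β T uN)) ∧
        -- the convergence
        (∀ (u : ℝ → ThirdOrderNLS.L2) (uN : ℕ → ℝ → ThirdOrderNLS.L2),
          ThirdOrderNLS.IsSolution β s u₀ u →
          (∀ N : ℕ, ThirdOrderNLS.IsTruncatedSolution β N u₀ (uN N)) →
          Filter.Tendsto (fun N : ℕ => ThirdOrderNLS.quadForm α β T (uN N)) Filter.atTop
            (nhds (ThirdOrderNLS.quadForm α β T u))) := by
  -- This places `s` strictly between `(11/12)(α - 1/2)` and `α - 1/2`, the range in which the
  -- exponent conditions hold; in particular `s > 0`.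
  refine ⟨(α - 1 / 2) / 12, by linarith, fun ε s hε hε₀ hs => ?_⟩
  obtain ⟨c, hc, hΦ⟩ := ThirdOrderNLS.exists_phase_lower β hβ
  obtain ⟨B, hB, h⟩ := ThirdOrderNLS.exists_quadForm_bound hc hΦ hα hα' (s := s)
    (by linarith) (by linarith)
  have hs0 : 0 ≤ s := by linarith
  have hδ : 0 < (α - 1 / 2) / 24 := by linarith
  refine ⟨fun a T => (B (ENNReal.ofReal a) T).toReal, fun T hT u₀ hu₀ => ?_⟩
  have hBt : B (ENNReal.ofReal ‖u₀‖) T ≠ ∞ := hB _ _ ENNReal.ofReal_ne_top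
  have hU := fun (u : ℝ → ThirdOrderNLS.L2) (hu : ThirdOrderNLS.IsSolution β s u₀ u) =>
    h hT (hu.isFlow hs0 hT) (by rwa [hu.initial]) (S := ENNReal.ofReal ‖u₀‖) ENNReal.ofReal_ne_top
      (by rw [hu.initial, ofReal_norm])
  have hV := fun (N : ℕ) (u : ℝ → ThirdOrderNLS.L2)
      (hu : ThirdOrderNLS.IsTruncatedSolution β N u₀ u) =>
    h hT (hu.isFlow hT) (by rw [hu.initial]; exact hu₀.proj N) (S := ENNReal.ofReal ‖u₀‖)
      ENNReal.ofReal_ne_top (by rw [hu.initial, ofReal_norm]; exact ThirdOrderNLS.enorm_proj_le N u₀)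
  have hV' := fun (N : ℕ) (u : ℝ → ThirdOrderNLS.L2)
      (hu : ThirdOrderNLS.IsTruncatedSolution β N u₀ u) =>
    (hV N u hu).1.trans (b := B (ENNReal.ofReal ‖u₀‖) T
      * ENNReal.ofReal (ThirdOrderNLS.hsNorm s (u 0)) ^ 3)
      (c := B (ENNReal.ofReal ‖u₀‖) T * ENNReal.ofReal (ThirdOrderNLS.hsNorm s u₀) ^ 3) (by
        rw [hu.initial]
        gcongr
        exact hu₀.hsNorm_proj_le N)
  refine ⟨fun u hu => ⟨(hU u hu).2.1, ?_, (hU u hu).2.2⟩,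
    fun N u hu => ⟨(hV N u hu).2.1, ?_, (hV N u hu).2.2⟩, fun u uN hu huN => ?_⟩
  · have h1 := (hU u hu).1
    rw [hu.initial] at h1
    exact ThirdOrderNLS.abs_quadForm_le hδ.le hBt (Real.sqrt_nonneg _) h1
  · exact ThirdOrderNLS.abs_quadForm_le hδ.le hBt (Real.sqrt_nonneg _) (hV' N u hu)
  -- The weighted sums for all `uN N` share one bound, because projecting the datum increases
  -- neither its `L²` nor its `H^s` norm.
  · refine (Complex.continuous_im.tendsto _).comp (ThirdOrderNLS.tendsto_tsum_freq hδ
      (M := B (ENNReal.ofReal ‖u₀‖) T * ENNReal.ofReal (ThirdOrderNLS.hsNorm s u₀) ^ 3)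
      (by finiteness) (fun N => hV' N (uN N) (huN N)) (fun N => (hV N (uN N) (huN N)).2.1)
      (hU u hu).2.1 fun q => ?_)
    simp only [ThirdOrderNLS.quadTerm_eq]
    refine (ThirdOrderNLS.tendsto_quadInt hc hΦ hT (hu.isFlow hs0 hT)
      (fun N => (huN N).isFlow hT) (fun N => ?_) q).const_mul _
    simp only [neg_zero, hu.initial, (huN N).initial]
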